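/- Let $\mathbb D\subset\mathbb C$ be the open unit disc. A function $h$ on $\mathbb D$ is a \emph{quasiconformal weight} if $h(z)=|J(z,\psi)|$ for almost every $z\in\mathbb D$, where $\psi$ is a quasiconformal homeomorphism of $\mathbb D$ onto a domain $\Omega\subset\mathbb C$, that is, a homeomorphism with $\psi\in W^{1,2}_{\mathrm{loc}}(\mathbb D)$ and $|D\psi|^2\le K|J(\cdot,\psi)|$ a.e. for some constant $1\le K<\infty$. It is \emph{regular} if $\iint_{\mathbb D}h^{\beta}\,dx\,dy<\infty$ for some $\beta>1$. Let $W^{1,2}(\mathbb D,h,1)$ be the space of locally integrable, weakly differentiable $f:\mathbb D\to\mathbb R$ with $f\in L^2(\mathbb D,h)$ and $\nabla f\in L^2(\mathbb D)$, where $L^r(\mathbb D,h)$ is the $L^r$ space of the measure $h\,dx\,dy$. Let $\mu_1[h,\mathbb D]\le\mu_2[h,\mathbb D]\le\dots$ be the eigenvalues, repeated according to multiplicity, of the problem $$\iint_{\mathbb D}\langle\nabla f,\nabla g\rangle\,dx\,dy=\mu\iint_{\mathbb D}h f g\,dx\,dy\qquad\text{for all } g\in W^{1,2}(\mathbb D,h,1),\qquad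 f\in W^{1,2}(\mathbb D,h,1).$$ Let $B_{r,2}(\mathbb D,h)$ be the best constant in $$\|f-f_{\mathbb D,h}\mid L^r(\mathbb D,h)\|\le B_{r,2}(\mathbb D,h)\,\|\nabla f\mid L^2(\mathbb D)\|\qquad\text{for all } f\in W^{1,2}(\mathbb D,h,1),$$ where $f_{\mathbb D,h}=\bigl(\iint_{\mathbb D}h\,dx\,dy\bigr)^{-1}\iint_{\mathbb D}fh\,dx\,dy$. \textbf{Theorem.} Let $h_1,h_2$ be regular quasiconformal weights on $\mathbb D$, and suppose that for some $1<s\le\infty$ $$d_s(h_1,h_2):=\bigl\|(h_1-h_2)\,\min\{h_1,h_2\}^{\frac{1-s}{s}}\mid L^s(\mathbb D)\bigr\|<\infty,$$ where for $s=\infty$ the exponents $\frac{1-s}{s}$ and $\frac{2s}{s-1}$ are read as $-1$ and $2$. Put $$B:=\max\Bigl\{B_{\frac{2s}{s-1},2}(\mathbb D,h_1),\,B_{\frac{2s}{s-1},2}(\mathbb D,h_2)\Bigr\}.$$ Then $B<\infty$, and for every integer $n\ge1$ the $n$-th eigenvalues $\mu_n[h_1,\mathbb D]$ and $\mu_n[h_2,\mathbb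 D]$ exist and $$\bigl|\mu_n[h_1,\mathbb D]-\mu_n[h_2,\mathbb D]\bigr|\le \tilde c_n\,B^2\,d_s(h_1,h_2),\qquad \tilde c_n=\max\bigl\{\mu_n^2[h_1,\mathbb D],\,\mu_n^2[h_2,\mathbb D]\bigr\}.$$ -/

import Mathlib

open MeasureTheory Set
open scoped ENNReal

noncomputable section

namespace SpectralStability

/-- The open unit disc in the plane. -/
def unitDisc : Set ℂ := Metric.ball 0 1

/-- `D` is the weak (distributional) total derivative of `f` on the open set `U`:
both are locally integrable on `U`, and integration by parts holds against every real
`C^∞` function with compact support in `U`. -/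
structure HasWeakFDerivOn {F : Type*} [NormedAddCommGroup F] [NormedSpace ℝ F]
    (U : Set ℂ) (f : ℂ → F) (D : ℂ → (ℂ →L[ℝ] F)) : Prop where
  locallyIntegrableOn : LocallyIntegrableOn f U volume
  locallyIntegrableOn_deriv : LocallyIntegrableOn D U volume
  integral_eq : ∀ η : ℂ → ℝ, ContDiff ℝ (⊤ : ℕ∞) η → HasCompactSupport η → tsupport η ⊆ U →
    ∀ v : ℂ, ∫ z in U, (fderiv ℝ η z v) • f z = -∫ z in U, η z • D z v

/-- `ψ` is a quasiconformal homeomorphism of its (open) source onto its (open) target with weak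
derivative `D`: it is of class `W^{1,2}_loc`, and `|Dψ|² ≤ K |J(·, ψ)|` almost everywhere for
some constant `1 ≤ K < ∞`. -/
def IsQuasiconformal (ψ : OpenPartialHomeomorph ℂ ℂ) (D : ℂ → (ℂ →L[ℝ] ℂ)) : Prop :=
  HasWeakFDerivOn ψ.source ψ D ∧
  LocallyIntegrableOn (fun z => ‖D z‖ ^ 2) ψ.source volume ∧
  ∃ K : ℝ, 1 ≤ K ∧ ∀ᵐ z ∂(volume.restrict ψ.source), ‖D z‖ ^ 2 ≤ K * |(D z).det|

/-- `h` is a quasiconformal weight on the unit disc: almost everywhere on the disc it is the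
absolute value of the Jacobian of a quasiconformal homeomorphism of the disc onto some domain
(`ψ.target`). -/
def IsQuasiconformalWeight (h : ℂ → ℝ) : Prop :=
  ∃ (ψ : OpenPartialHomeomorph ℂ ℂ) (D : ℂ → (ℂ →L[ℝ] ℂ)),
    ψ.source = unitDisc ∧ IsQuasiconformal ψ D ∧
    ∀ᵐ z ∂(volume.restrict unitDisc), h z = |(D z).det|

/-- Regularity of the weight: `∬_𝔻 |h|^β < ∞` for some `1 < β < ∞`. -/
def IsRegularWeight (h : ℂ → ℝ) : Prop :=
  ∃ β : ℝ, 1 < β ∧ MemLp h (ENNReal.ofReal β) (volume.restrict unitDisc)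

/-- The measure `h(z) dx dy` on the unit disc; `L^p(𝔻, h)` is `L^p` of this measure. -/
def weightMeasure (h : ℂ → ℝ) : Measure ℂ :=
  (volume.restrict unitDisc).withDensity fun z => ENNReal.ofReal (h z)

/-- `f` belongs to the two-weighted Sobolev space `W^{1,2}(𝔻, h, 1)` and has weak derivative
`Df`. -/
def MemSobolev (h : ℂ → ℝ) (f : ℂ → ℝ) (Df : ℂ → (ℂ →L[ℝ] ℝ)) : Prop :=
  HasWeakFDerivOn unitDisc f Df ∧ MemLp f 2 (weightMeasure h) ∧
    MemLp Df 2 (volume.restrict unitDisc)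

/-- The Dirichlet form `∬_𝔻 ⟨∇f, ∇g⟩ dx dy`, in terms of the derivatives of `f` and `g`. -/
def dirichletForm (Df Dg : ℂ → (ℂ →L[ℝ] ℝ)) : ℝ :=
  ∫ z in unitDisc, (Df z 1 * Dg z 1 + Df z Complex.I * Dg z Complex.I)

/-- `f` is a weak solution in `W^{1,2}(𝔻, h, 1)` of the weighted Neumann eigenvalue problem
`∬ ⟨∇f, ∇g⟩ = lam ∬ h f g` for all `g` in `W^{1,2}(𝔻, h, 1)`. -/
def IsWeakSolution (h : ℂ → ℝ) (lam : ℝ) (f : ℂ → ℝ) : Prop :=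
  ∃ Df : ℂ → (ℂ →L[ℝ] ℝ), MemSobolev h f Df ∧
    ∀ (g : ℂ → ℝ) (Dg : ℂ → (ℂ →L[ℝ] ℝ)), MemSobolev h g Dg →
      dirichletForm Df Dg = lam * ∫ z, f z * g z ∂(weightMeasure h)

/-- The set of real `t` such that at least `n` eigenvalues, counted with multiplicity, are at
most `t`: there are `n` linearly independent eigenfunctions (as classes modulo equality almost
everywhere on the disc) whose eigenvalues are at most `t`. -/
def eigenvalueLevels (h : ℂ → ℝ) (n : ℕ) : Set ℝ :=
  {t | ∃ (lam : Fin n → ℝ) (u : Fin n → (ℂ →ₘ[volume.restrict unitDisc] ℝ)),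
    LinearIndependent ℝ u ∧ ∀ i, lam i ≤ t ∧ IsWeakSolution h (lam i) (u i)}

/-- `μ_n[h, 𝔻]` for `n ≥ 1`: the `n`-th eigenvalue in nondecreasing order, each eigenvalue being
repeated according to its multiplicity. -/
def neumannEigenvalue (h : ℂ → ℝ) (n : ℕ) : ℝ := sInf (eigenvalueLevels h n)

/-- The best constant `B_{r,2}(𝔻, h)` in the weighted Poincaré–Sobolev inequality
`‖f - f_{𝔻,h} | L^r(𝔻, h)‖ ≤ C ‖∇f | L^2(𝔻)‖`, `f ∈ W^{1,2}(𝔻, h, 1)`, where `f_{𝔻,h}` is the mean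
value of `f` with respect to `h(z) dx dy`. -/
def poincareSobolevConst (r : ℝ≥0∞) (h : ℂ → ℝ) : ℝ≥0∞ :=
  sInf {C | ∀ (f : ℂ → ℝ) (Df : ℂ → (ℂ →L[ℝ] ℝ)), MemSobolev h f Df →
    eLpNorm (fun z => f z - ⨍ w, f w ∂(weightMeasure h)) r (weightMeasure h) ≤
      C * eLpNorm Df 2 (volume.restrict unitDisc)}

/-- `B_{r,2}` for a pair of weights: the larger of the two best constants. -/
def poincareSobolevConst₂ (r : ℝ≥0∞) (h₁ h₂ : ℂ → ℝ) : ℝ≥0∞ :=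
  max (poincareSobolevConst r h₁) (poincareSobolevConst r h₂)

/-- `d_s(h₁, h₂) = ‖(h₁ - h₂) min{h₁, h₂}^{(1-s)/s} | L^s(𝔻)‖`. The exponent is written
`(1 - s) / s = -(1 - s⁻¹)`, which also makes sense (as `-1`) for `s = ∞`. -/
def weightDist (s : ℝ≥0∞) (h₁ h₂ : ℂ → ℝ) : ℝ≥0∞ :=
  eLpNorm (fun z => ‖h₁ z - h₂ z‖ₑ *
    ENNReal.ofReal (min (h₁ z) (h₂ z)) ^ (-(1 - s⁻¹).toReal)) s (volume.restrict unitDisc)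

/-- The exponent `2s / (s - 1) = 2 / (1 - s⁻¹)`, which equals `2` for `s = ∞`. -/
def sobolevExponent (s : ℝ≥0∞) : ℝ≥0∞ := 2 / (1 - s⁻¹)

/-- `c̃_n = max {μ_n[h₁, 𝔻]², μ_n[h₂, 𝔻]²}`. -/
def eigenvalueConst (h₁ h₂ : ℂ → ℝ) (n : ℕ) : ℝ :=
  max (neumannEigenvalue h₁ n ^ 2) (neumannEigenvalue h₂ n ^ 2)

end SpectralStability

end

/-! All weights are compared on one Hilbert space, the `L²` weak gradients on the disc
(`gradientSpace`). A regular weight `h` enters only through the operator `S_h` =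
`IsRegularWeight.primitive`, which sends a gradient to its primitive of `h`-mean zero in `L²(h)`.
Testing the eigenvalue problem with constants shows that nonconstant eigenfunctions correspond to
solutions of `⟨F, G⟩ = μ ⟨S_h F, S_h G⟩`. Since `S_h` is compact, the spectral theorem gives a
min-max principle: `t ≥ 0` is a level for `n` iff `‖F‖² ≤ t ‖S_h F‖²` on some space of gradients of
dimension at least `n - 1`, the missing dimension being that of the constants
(`mem_eigenvalueLevels_of_subspace`, `exists_subspace_of_mem_eigenvalueLevels`).

Stability is then a perturbation of quadratic forms. Hölder and the Poincaré–Sobolev inequality give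
`‖S_{h₂} F‖² ≤ ‖S_{h₁} F‖² + δ ‖F‖²` with `δ = B² d_s`, and the same with the weights exchanged
(`norm_sq_primitive_le`). Inserted into min-max, this yields `μ_n[h₂] ≤ μ_n[h₁] / (1 - μ_n[h₁] δ)`
when the denominator is positive, and elementary algebra finishes (`sub_le_of_div_le`).

The analytic input is finiteness of `B` and compactness of `S_h`. On a disc intersected with the
unit disc, a function differs from a constant by at most a truncated Riesz potential of its gradient
(`exists_const_enorm_sub_le`). For `h ∈ L^β` with `β > 1` that potential maps `L²` to `L^{2p}(h)`,
with norm tending to zero with the truncation radius (`exists_rieszPotential_bound`). A fixed radius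
gives Poincaré–Sobolev; small radii give approximation by step functions, hence compactness.
Quasiconformality ensures that the weight is not almost everywhere zero; polynomials in `re z` then
provide test spaces of every dimension, so every `μ_n` exists. -/

noncomputable section

namespace SpectralStability

open Filter Topology

/-! ### The truncated Riesz kernel -/

/-- The kernel `|z|⁻¹` truncated to the disc of radius `R`. -/
def rieszKernel (R : ℝ) (z : ℂ) : ℝ≥0∞ := (Metric.ball (0 : ℂ) R).indicator (fun z => ‖z‖ₑ⁻¹) z

@[fun_prop]
lemma measurable_rieszKernel (R : ℝ) : Measurable (rieszKernel R) :=
  (measurable_enorm.inv).indicator measurableSet_ball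

lemma rieszKernel_rpow (R : ℝ) {b : ℝ} (hb : 0 < b) (z : ℂ) :
    rieszKernel R z ^ b = (Metric.ball (0 : ℂ) R).indicator (fun z => (‖z‖ₑ⁻¹) ^ b) z := by
  by_cases hz : z ∈ Metric.ball (0 : ℂ) R
  · simp only [rieszKernel, indicator_of_mem hz]
  · simp only [rieszKernel, indicator_of_notMem hz, ENNReal.zero_rpow_of_pos hb]

/-- In polar coordinates the integrand becomes `r ^ (1 - b)` on `(0, R)`, integrable at the origin
because `b < 2`. -/
lemma lintegral_rieszKernel_rpow_lt_top (R : ℝ) {b : ℝ} (hb : 0 < b) (hb2 : b < 2) :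
    ∫⁻ z, rieszKernel R z ^ b < ⊤ := by
  have h1 : Integrable (fun z : ℂ => (Iio R).indicator (fun y : ℝ => y ^ (-b)) ‖z‖) volume := by
    rw [integrable_fun_norm_addHaar volume (f := (Iio R).indicator (fun y : ℝ => y ^ (-b)))]
    have h2 : IntegrableOn (fun y : ℝ => y ^ (1 - b)) (Ioo 0 R) := by
      rcases le_or_gt R 0 with hR | hR
      · simp [Ioo_eq_empty_of_le hR]
      · rw [← integrableOn_Ioc_iff_integrableOn_Ioo, ← intervalIntegrable_iff_integrableOn_Ioc_of_le hR.le]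
        exact intervalIntegral.intervalIntegrable_rpow' (by linarith)
    rw [← integrable_indicator_iff measurableSet_Ioi]
    rw [← integrable_indicator_iff measurableSet_Ioo] at h2
    refine h2.congr (ae_of_all _ fun y => ?_)
    by_cases hy : 0 < y
    · by_cases hyR : y < R
      · simp only [Complex.finrank_real_complex, indicator, mem_Ioo, hy, hyR, and_self, if_true,
          mem_Ioi, mem_Iio, smul_eq_mul]
        rw [sub_eq_add_neg, Real.rpow_add hy]
        norm_num
      · simp [indicator, hyR]
    · simp [indicator, hy]
  have h3 := h1.lintegral_lt_top
  refine lt_of_le_of_lt (le_of_eq (lintegral_congr_ae ?_)) h3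
  have h0 : ∀ᵐ z : ℂ, z ≠ 0 := by simp [ae_iff]
  filter_upwards [h0] with z hz
  rw [rieszKernel_rpow R hb]
  by_cases hzR : ‖z‖ < R
  · simp only [indicator, Metric.mem_ball, dist_zero_right, hzR, if_true, mem_Iio]
    rw [← ofReal_norm, ENNReal.inv_rpow, ENNReal.ofReal_rpow_of_pos (norm_pos_iff.2 hz),
      ← ENNReal.ofReal_inv_of_pos (by positivity), Real.rpow_neg (norm_nonneg _)]
  · simp [indicator, hzR]

/-- For `R ≤ 1` the kernel is the radius-one kernel restricted to a shrinking disc, so absolute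
continuity of the integral applies. This decay later makes the weighted embedding compact. -/
lemma tendsto_lintegral_rieszKernel_rpow {b : ℝ} (hb : 0 < b) (hb2 : b < 2) :
    Tendsto (fun R : ℝ => ∫⁻ z, rieszKernel R z ^ b) (𝓝[>] 0) (𝓝 0) := by
  have h1 : Tendsto (fun R : ℝ => ∫⁻ z in Metric.ball (0 : ℂ) R, rieszKernel 1 z ^ b) (𝓝[>] 0)
      (𝓝 0) := by
    refine tendsto_setLIntegral_zero (lintegral_rieszKernel_rpow_lt_top 1 hb hb2).ne ?_
    have : Tendsto (fun R : ℝ => ENNReal.ofReal R ^ 2 * (NNReal.pi : ℝ≥0∞)) (𝓝[>] 0)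
        (𝓝 (ENNReal.ofReal 0 ^ 2 * (NNReal.pi : ℝ≥0∞))) := by
      refine ENNReal.Tendsto.mul_const (ENNReal.Tendsto.pow ?_) (Or.inr ENNReal.coe_ne_top)
      exact (ENNReal.continuous_ofReal.tendsto 0).mono_left nhdsWithin_le_nhds
    refine (this.congr fun R => ?_).trans (by simp)
    simp [Complex.volume_ball]
  refine h1.congr' ?_
  have : ∀ᶠ R : ℝ in 𝓝[>] 0, R ≤ 1 :=
    (eventually_le_nhds (by norm_num)).filter_mono nhdsWithin_le_nhds
  filter_upwards [this] with R hR
  rw [← lintegral_indicator measurableSet_ball]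
  refine lintegral_congr fun z => ?_
  rw [rieszKernel_rpow R hb]
  by_cases hz : ‖z‖ < R
  · simp [indicator, hz, hz.trans_le hR, rieszKernel]
  · simp [indicator, hz]

/-! ### A pointwise estimate by Riesz potentials for smooth functions -/

lemma lintegral_comp_smul_complex (f : ℂ → ℝ≥0∞) {t : ℝ} (ht : 0 < t) :
    ∫⁻ w, f (t • w) = ENNReal.ofReal (t ^ 2)⁻¹ * ∫⁻ w, f w := by
  have e : MeasurableEmbedding (fun w : ℂ => t • w) :=
    (Homeomorph.smulOfNeZero t ht.ne').measurableEmbedding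
  rw [← e.lintegral_map, Measure.map_addHaar_smul _ ht.ne', lintegral_smul_measure,
    Complex.finrank_real_complex, abs_of_pos (by positivity), smul_eq_mul]

/-- The power `-3` comes from substituting `v = t (y - x)` in the plane: the Jacobian gives `t⁻²`,
and `|y - x| = |v| / t` gives one more factor. -/
lemma lintegral_rpow_neg_three_Ioi {a : ℝ} (ha : 0 < a) :
    ∫⁻ t in Ioi a, ENNReal.ofReal (t ^ (-3 : ℝ)) = ENNReal.ofReal (2 * a ^ 2)⁻¹ := by
  rw [← ofReal_integral_eq_lintegral_ofReal (integrableOn_Ioi_rpow_of_lt (by norm_num) ha),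
    integral_Ioi_rpow_of_lt (by norm_num) ha]
  · congr 1
    norm_num
    ring
  · filter_upwards [ae_restrict_mem measurableSet_Ioi] with t ht
    exact Real.rpow_nonneg (ha.trans ht).le _

/-- Integrating a function along all segments from `x` to the points of a set costs no more than
its Riesz potential at `x`. -/
lemma lintegral_segments_le {G : ℂ → ℝ≥0∞} (hG : Measurable G) {R : ℝ} (hR : 0 < R) (x : ℂ)
    {s : Set ℂ} (hs : s ⊆ Metric.ball x R) :
    ∫⁻ y in s, ∫⁻ t in Ioc (0 : ℝ) 1, G (x + t • (y - x)) * ‖y - x‖ₑ ≤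
      ENNReal.ofReal (R ^ 2 / 2) * ∫⁻ z, G z * rieszKernel R (z - x) := by
  -- The integrand after the substitution `v = t • (y - x)`; the condition `|y - x| < R` turns into
  -- `t > |v| / R`.
  have hball : ∀ v : ℂ, ∀ t : ℝ, 0 < t → ENNReal.ofReal (t ^ 2)⁻¹ * (G (x + v) *
      (Metric.ball (0 : ℂ) R).indicator (fun w => ‖w‖ₑ) (t⁻¹ • v)) =
      G (x + v) * ‖v‖ₑ * (Ioi (‖v‖ / R)).indicator (fun t => ENNReal.ofReal (t ^ (-3 : ℝ))) t := by
    intro v t ht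
    by_cases hv : ‖v‖ / R < t
    · have : t⁻¹ • v ∈ Metric.ball (0 : ℂ) R := by
        rw [mem_ball_zero_iff, norm_smul, Real.norm_of_nonneg (by positivity), inv_mul_lt_iff₀ ht]
        rwa [div_lt_iff₀ hR] at hv
      rw [indicator_of_mem this, indicator_of_mem (by exact hv), enorm_smul,
        Real.enorm_of_nonneg (by positivity)]
      have : ENNReal.ofReal (t ^ (-3 : ℝ)) = ENNReal.ofReal (t ^ 2)⁻¹ * ENNReal.ofReal t⁻¹ := by
        rw [← ENNReal.ofReal_mul (by positivity), Real.rpow_neg ht.le]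
        congr 1
        norm_num
        field_simp
      rw [this]
      ring
    · have : t⁻¹ • v ∉ Metric.ball (0 : ℂ) R := by
        rw [mem_ball_zero_iff, norm_smul, Real.norm_of_nonneg (by positivity), inv_mul_lt_iff₀ ht]
        rwa [div_lt_iff₀ hR] at hv
      rw [indicator_of_notMem this, indicator_of_notMem (by exact hv)]
      simp
  calc ∫⁻ y in s, ∫⁻ t in Ioc (0 : ℝ) 1, G (x + t • (y - x)) * ‖y - x‖ₑ
      ≤ ∫⁻ y in Metric.ball x R, ∫⁻ t in Ioc (0 : ℝ) 1, G (x + t • (y - x)) * ‖y - x‖ₑ :=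
        lintegral_mono_set hs
    _ = ∫⁻ t in Ioc (0 : ℝ) 1, ∫⁻ y in Metric.ball x R, G (x + t • (y - x)) * ‖y - x‖ₑ := by
        refine lintegral_lintegral_swap ?_
        refine Measurable.aemeasurable ?_
        unfold Function.uncurry
        fun_prop
    _ = ∫⁻ t in Ioc (0 : ℝ) 1, ∫⁻ v, G (x + v) * ‖v‖ₑ *
          (Ioi (‖v‖ / R)).indicator (fun t => ENNReal.ofReal (t ^ (-3 : ℝ))) t := by
        refine setLIntegral_congr_fun measurableSet_Ioc fun t ht => ?_
        rw [← lintegral_indicator measurableSet_ball,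
          ← lintegral_add_left_eq_self _ x]
        have e : ∀ w : ℂ, (Metric.ball x R).indicator
            (fun y => G (x + t • (y - x)) * ‖y - x‖ₑ) (x + w) =
            G (x + t • w) * (Metric.ball (0 : ℂ) R).indicator (fun w => ‖w‖ₑ) (t⁻¹ • (t • w)) := by
          intro w
          rw [inv_smul_smul₀ ht.1.ne']
          by_cases hw : ‖w‖ < R
          · simp [indicator, hw]
          · simp [indicator, hw]
        simp_rw [e]
        rw [lintegral_comp_smul_complex (fun v => G (x + v) *
          (Metric.ball (0 : ℂ) R).indicator (fun w => ‖w‖ₑ) (t⁻¹ • v)) ht.1,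
          ← lintegral_const_mul' _ _ ENNReal.ofReal_ne_top]
        exact lintegral_congr fun v => hball v t ht.1
    _ = ∫⁻ v, ∫⁻ t in Ioc (0 : ℝ) 1, G (x + v) * ‖v‖ₑ *
          (Ioi (‖v‖ / R)).indicator (fun t => ENNReal.ofReal (t ^ (-3 : ℝ))) t := by
        refine lintegral_lintegral_swap ?_
        refine Measurable.aemeasurable ?_
        have : MeasurableSet {p : ℝ × ℂ | ‖p.2‖ / R < p.1} :=
          measurableSet_lt (by fun_prop) (by fun_prop)
        have h2 : Measurable (fun p : ℝ × ℂ => {p : ℝ × ℂ | ‖p.2‖ / R < p.1}.indicator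
          (fun p => ENNReal.ofReal (p.1 ^ (-3 : ℝ))) p) :=
          Measurable.indicator (by fun_prop) this
        have h3 : Measurable (fun p : ℝ × ℂ => G (x + p.2) * ‖p.2‖ₑ) := by fun_prop
        exact h3.mul h2
    _ ≤ ∫⁻ v, ENNReal.ofReal (R ^ 2 / 2) * (G (x + v) * rieszKernel R v) := by
        have h0 : ∀ᵐ z : ℂ, z ≠ 0 := by simp [ae_iff]
        refine lintegral_mono_ae ?_
        filter_upwards [h0] with v hv
        have hv' : 0 < ‖v‖ := norm_pos_iff.2 hv
        rw [lintegral_const_mul _ (Measurable.indicator (by fun_prop) measurableSet_Ioi)]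
        by_cases hvR : ‖v‖ < R
        -- Dropping `t ≤ 1` leaves the integral of `t⁻³` over `t > |v| / R`, equal to `R² / (2
        -- |v|²)`; multiplied by `|v|` it is the kernel with constant `R² / 2`.
        · calc _ ≤ G (x + v) * ‖v‖ₑ * ENNReal.ofReal (2 * (‖v‖ / R) ^ 2)⁻¹ := by
                rw [← lintegral_rpow_neg_three_Ioi (by positivity),
                  ← lintegral_indicator measurableSet_Ioi]
                gcongr
                exact Measure.restrict_le_self
            _ = _ := by
                rw [rieszKernel, indicator_of_mem (by simpa using hvR)]
                have : ‖v‖ₑ * ENNReal.ofReal (2 * (‖v‖ / R) ^ 2)⁻¹ =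
                    ENNReal.ofReal (R ^ 2 / 2) * ‖v‖ₑ⁻¹ := by
                  rw [← ofReal_norm, ← ENNReal.ofReal_inv_of_pos hv',
                    ← ENNReal.ofReal_mul hv'.le, ← ENNReal.ofReal_mul (by positivity)]
                  congr 1
                  field_simp
                rw [mul_assoc, this]
                ring
        · have : ∫⁻ t in Ioc (0 : ℝ) 1, (Ioi (‖v‖ / R)).indicator
              (fun t => ENNReal.ofReal (t ^ (-3 : ℝ))) t = 0 := by
            rw [setLIntegral_congr_fun measurableSet_Ioc (g := fun _ => 0)]
            · simp
            · intro t ht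
              refine indicator_of_notMem ?_ _
              have : 1 ≤ ‖v‖ / R := by rw [le_div_iff₀ hR]; linarith
              simpa using ht.2.trans this
          rw [this]
          simp
    _ = _ := by
        rw [lintegral_const_mul' _ _ ENNReal.ofReal_ne_top]
        congr 1
        rw [← lintegral_add_left_eq_self (fun z => G z * rieszKernel R (z - x)) x]
        simp

/-- Fundamental theorem of calculus along the segment, which stays in `E` by convexity. -/
lemma enorm_sub_le_lintegral_segment {F : ℂ → ℝ} (hF : ContDiff ℝ 1 F) {E : Set ℂ}
    (hE : Convex ℝ E) {G : ℂ → ℝ≥0∞} (hG : ∀ z ∈ E, ‖fderiv ℝ F z‖ₑ ≤ G z) {x y : ℂ}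
    (hx : x ∈ E) (hy : y ∈ E) :
    ‖F x - F y‖ₑ ≤ ∫⁻ t in Ioc (0 : ℝ) 1, G (x + t • (y - x)) * ‖y - x‖ₑ := by
  have hd : ∀ t : ℝ, HasDerivAt (fun t : ℝ => F (x + t • (y - x)))
      (fderiv ℝ F (x + t • (y - x)) (y - x)) t := by
    intro t
    have h1 := ((hF.differentiable one_ne_zero) (x + t • (y - x))).hasFDerivAt
    have h2 : HasDerivAt (fun t : ℝ => x + t • (y - x)) (y - x) t := by
      simpa using ((hasDerivAt_id t).smul_const (y - x)).const_add x
    exact h1.comp_hasDerivAt t h2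
  have hc : Continuous fun t : ℝ => fderiv ℝ F (x + t • (y - x)) (y - x) :=
    ((hF.continuous_fderiv one_ne_zero).comp (by fun_prop)).clm_apply continuous_const
  have h := intervalIntegral.integral_eq_sub_of_hasDerivAt (a := 0) (b := 1) (fun t _ => hd t)
    (hc.intervalIntegrable _ _)
  simp only [one_smul, zero_smul, add_zero, add_sub_cancel] at h
  rw [← enorm_neg, neg_sub, ← h, intervalIntegral.integral_of_le zero_le_one]
  refine (enorm_integral_le_lintegral_enorm _).trans ?_
  refine setLIntegral_mono_ae' measurableSet_Ioc (ae_of_all _ fun t ht => ?_)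
  have hm : x + t • (y - x) ∈ E := hE.add_smul_sub_mem hx hy ⟨ht.1.le, ht.2⟩
  exact (ContinuousLinearMap.le_opENorm _ _).trans (mul_le_mul_left (hG _ hm) _)

/-- For a smooth function on a convex set that contains a disc of radius `R / 8`, the oscillation
is controlled by the truncated Riesz potential of the gradient. -/
lemma enorm_sub_le_riesz {F : ℂ → ℝ} (hF : ContDiff ℝ 1 F) {E : Set ℂ}
    (hE : Convex ℝ E) {G : ℂ → ℝ≥0∞} (hGm : Measurable G) (hG : ∀ z ∈ E, ‖fderiv ℝ F z‖ₑ ≤ G z)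
    {R : ℝ} (hR : 0 < R) (hER : ∀ x ∈ E, ∀ y ∈ E, dist y x < R) {y₀ : ℂ}
    (hy₀ : Metric.ball y₀ (R / 8) ⊆ E) {x x' : ℂ} (hx : x ∈ E) (hx' : x' ∈ E) :
    ‖F x - F x'‖ₑ ≤ 16 * ((∫⁻ z, G z * rieszKernel R (z - x)) +
      ∫⁻ z, G z * rieszKernel R (z - x')) := by
  set B := Metric.ball y₀ (R / 8)
  -- Both points are joined to all `y` in the fixed disc `B`; integrating the triangle inequality
  -- through `y` over `B` removes `F y`.
  have key : ∀ x ∈ E, ∫⁻ y in B, ‖F x - F y‖ₑ ≤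
      ENNReal.ofReal (R ^ 2 / 2) * ∫⁻ z, G z * rieszKernel R (z - x) := by
    intro x hx
    refine le_trans ?_ (lintegral_segments_le hGm hR x (s := B) fun y hy => hER x hx y (hy₀ hy))
    exact setLIntegral_mono_ae' measurableSet_ball
      (ae_of_all _ fun y hy => enorm_sub_le_lintegral_segment hF hE hG hx (hy₀ hy))
  have hcont : Continuous F := hF.continuous
  have hsum : volume B * ‖F x - F x'‖ₑ ≤ ENNReal.ofReal (R ^ 2 / 2) *
      ((∫⁻ z, G z * rieszKernel R (z - x)) + ∫⁻ z, G z * rieszKernel R (z - x')) := by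
    calc volume B * ‖F x - F x'‖ₑ = ∫⁻ y in B, ‖F x - F x'‖ₑ := by
          rw [setLIntegral_const, mul_comm]
      _ ≤ ∫⁻ y in B, (‖F x - F y‖ₑ + ‖F x' - F y‖ₑ) := by
          refine lintegral_mono fun y => ?_
          have : F x - F x' = (F x - F y) - (F x' - F y) := by ring
          rw [this]
          exact enorm_sub_le
      _ = (∫⁻ y in B, ‖F x - F y‖ₑ) + ∫⁻ y in B, ‖F x' - F y‖ₑ :=
          lintegral_add_left (by fun_prop) _
      _ ≤ _ := by
          rw [mul_add]
          exact add_le_add (key x hx) (key x' hx')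
  -- Here `volume B = π R² / 64`, so `16 * volume B = π R² / 4 ≥ R² / 2`.
  have hvol : ENNReal.ofReal (R ^ 2 / 2) ≤ 16 * volume B := by
    have hpi : (ENNReal.ofReal Real.pi) = (NNReal.pi : ℝ≥0∞) :=
      ENNReal.ofReal_coe_nnreal (p := NNReal.pi)
    rw [Complex.volume_ball, ← hpi, ← ENNReal.ofReal_pow (by positivity),
      ← ENNReal.ofReal_mul (by positivity)]
    have : (16 : ℝ≥0∞) = ENNReal.ofReal 16 := by norm_num
    rw [this, ← ENNReal.ofReal_mul (by positivity)]
    refine ENNReal.ofReal_le_ofReal ?_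
    nlinarith [Real.pi_gt_three, sq_nonneg R]
  have hB0 : volume B ≠ 0 := (Metric.measure_ball_pos volume y₀ (by positivity)).ne'
  have hBt : volume B ≠ ⊤ := measure_ball_lt_top.ne
  rw [← ENNReal.mul_le_mul_iff_right hB0 hBt]
  refine hsum.trans ((mul_le_mul_left hvol _).trans (le_of_eq ?_))
  ring

/-! ### Mollification and the pointwise estimate for weakly differentiable functions -/

lemma isOpen_unitDisc : IsOpen unitDisc := Metric.isOpen_ball

lemma measurableSet_unitDisc : MeasurableSet unitDisc := measurableSet_ball

/-- The truncated Riesz potential of order one. -/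
def rieszPotential (R : ℝ) (g : ℂ → ℝ≥0∞) (x : ℂ) : ℝ≥0∞ := ∫⁻ z, g z * rieszKernel R (z - x)

lemma measurable_rieszPotential (R : ℝ) {g : ℂ → ℝ≥0∞} (hg : Measurable g) :
    Measurable (rieszPotential R g) := by
  unfold rieszPotential
  refine Measurable.lintegral_prod_right' (f := fun p : ℂ × ℂ => g p.2 * rieszKernel R (p.2 - p.1)) ?_
  fun_prop

lemma lintegral_rieszPotential_lt_top (R : ℝ) {g : ℂ → ℝ≥0∞} (hg : Measurable g)
    (hgi : ∫⁻ z, g z < ⊤) : ∫⁻ x, rieszPotential R g x < ⊤ := by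
  unfold rieszPotential
  rw [lintegral_lintegral_swap (by unfold Function.uncurry; fun_prop)]
  have : ∀ z : ℂ, ∫⁻ x, g z * rieszKernel R (z - x) = g z * ∫⁻ x, rieszKernel R x := by
    intro z
    rw [lintegral_const_mul _ (by fun_prop), lintegral_sub_left_eq_self (rieszKernel R) z]
  simp_rw [this]
  rw [lintegral_mul_const _ hg]
  refine ENNReal.mul_lt_top hgi ?_
  simpa using lintegral_rieszKernel_rpow_lt_top R zero_lt_one one_lt_two

/-- The mollification of a nonnegative function. -/
def lmollify (φ : ContDiffBump (0 : ℂ)) (g : ℂ → ℝ≥0∞) (x : ℂ) : ℝ≥0∞ :=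
  ∫⁻ w, ENNReal.ofReal (φ.normed volume w) * g (x - w)

lemma measurable_ofReal_normed (φ : ContDiffBump (0 : ℂ)) :
    Measurable fun w => ENNReal.ofReal (φ.normed volume w) :=
  (φ.continuous_normed.measurable).ennreal_ofReal

lemma measurable_lmollify (φ : ContDiffBump (0 : ℂ)) {g : ℂ → ℝ≥0∞} (hg : Measurable g) :
    Measurable (lmollify φ g) := by
  unfold lmollify
  refine Measurable.lintegral_prod_right'
    (f := fun p : ℂ × ℂ => ENNReal.ofReal (φ.normed volume p.2) * g (p.1 - p.2)) ?_
  exact ((measurable_ofReal_normed φ).comp measurable_snd).mul (by fun_prop)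

/-- Both operations are convolutions and commute by Tonelli and translation. Potentials of mollified
gradient bounds thus become mollified potentials, whose almost everywhere limit is given by
`tendsto_lmollify`. -/
lemma rieszPotential_lmollify (R : ℝ) (φ : ContDiffBump (0 : ℂ)) {g : ℂ → ℝ≥0∞}
    (hg : Measurable g) (x : ℂ) :
    rieszPotential R (lmollify φ g) x = lmollify φ (rieszPotential R g) x := by
  have hφ := measurable_ofReal_normed φ
  unfold rieszPotential lmollify
  have h1 : ∀ z : ℂ, (∫⁻ w, ENNReal.ofReal (φ.normed volume w) * g (z - w)) *
      rieszKernel R (z - x) =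
      ∫⁻ w, ENNReal.ofReal (φ.normed volume w) * g (z - w) * rieszKernel R (z - x) := by
    intro z
    have h2 : Measurable fun w => g (z - w) := by fun_prop
    exact (lintegral_mul_const _ (hφ.mul h2)).symm
  simp_rw [h1]
  rw [lintegral_lintegral_swap]
  · refine lintegral_congr fun w => ?_
    rw [← lintegral_const_mul _ (by fun_prop), ← lintegral_sub_right_eq_self
      (fun z => ENNReal.ofReal (φ.normed volume w) * (g z * rieszKernel R (z - (x - w)))) w]
    refine lintegral_congr fun z => ?_
    rw [mul_assoc, show z - w - (x - w) = z - x by ring]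
  · unfold Function.uncurry
    refine Measurable.aemeasurable ?_
    exact ((hφ.comp measurable_snd).mul (by fun_prop)).mul (by fun_prop)

/-- Lebesgue differentiation transferred to `ℝ≥0∞`: an integrable `u` is almost everywhere finite,
so passing to `toReal` does not change its mollifications. -/
lemma tendsto_lmollify {ι : Type*} {φ : ι → ContDiffBump (0 : ℂ)} {l : Filter ι}
    {K : ℝ} (hφ : Tendsto (fun i => (φ i).rOut) l (𝓝 0))
    (hφ' : ∀ᶠ i in l, (φ i).rOut ≤ K * (φ i).rIn) {u : ℂ → ℝ≥0∞} (hu : Measurable u)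
    (hui : ∫⁻ x, u x < ⊤) : ∀ᵐ x : ℂ, Tendsto (fun i => lmollify (φ i) u x) l (𝓝 (u x)) := by
  have hfin : ∀ᵐ x, u x < ⊤ := ae_lt_top hu hui.ne
  have hint : Integrable (fun x => (u x).toReal) :=
    integrable_toReal_of_lintegral_ne_top hu.aemeasurable hui.ne
  filter_upwards [ContDiffBump.ae_convolution_tendsto_right_of_locallyIntegrable hφ hφ'
    hint.locallyIntegrable, hfin] with x hx hxt
  rw [← ENNReal.ofReal_toReal hxt.ne]
  refine (ENNReal.tendsto_ofReal hx).congr fun i => ?_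
  have hex : ConvolutionExistsAt ((φ i).normed volume) (fun x => (u x).toReal) x
      (ContinuousLinearMap.lsmul ℝ ℝ) volume :=
    (φ i).hasCompactSupport_normed.convolutionExists_left _ (φ i).continuous_normed
      hint.locallyIntegrable x
  have h0 : ∀ w : ℂ, 0 ≤ (φ i).normed volume w := (φ i).nonneg_normed
  rw [convolution_def, ofReal_integral_eq_lintegral_ofReal hex]
  · have hfin' : ∀ᵐ w : ℂ, u (x - w) < ⊤ :=
      (quasiMeasurePreserving_sub_left volume x).ae hfin
    refine lintegral_congr_ae ?_
    filter_upwards [hfin'] with w hw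
    simp only [ContinuousLinearMap.lsmul_apply, smul_eq_mul]
    rw [ENNReal.ofReal_mul (h0 w), ENNReal.ofReal_toReal hw.ne]
  · exact ae_of_all _ fun w => mul_nonneg (h0 w) ENNReal.toReal_nonneg

/-- The mollification of a function on the disc, cut off outside a smaller disc. -/
def mollify (φ : ContDiffBump (0 : ℂ)) (ρ : ℝ) (f : ℂ → ℝ) : ℂ → ℝ :=
  convolution (φ.normed volume) ((Metric.ball 0 ρ).indicator f) (ContinuousLinearMap.lsmul ℝ ℝ)
    volume

lemma HasWeakFDerivOn.integrable_indicator {f : ℂ → ℝ} {Df : ℂ → (ℂ →L[ℝ] ℝ)}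
    (hf : HasWeakFDerivOn unitDisc f Df) {ρ : ℝ} (hρ : ρ < 1) :
    Integrable ((Metric.ball 0 ρ).indicator f) := by
  rw [integrable_indicator_iff measurableSet_ball]
  refine (hf.locallyIntegrableOn.integrableOn_compact_subset
    (Metric.closedBall_subset_ball hρ) (isCompact_closedBall 0 ρ)).mono_set
    Metric.ball_subset_closedBall

lemma contDiff_mollify (φ : ContDiffBump (0 : ℂ)) {ρ : ℝ} {f : ℂ → ℝ}
    (hf : Integrable ((Metric.ball 0 ρ).indicator f)) : ContDiff ℝ 1 (mollify φ ρ f) :=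
  φ.hasCompactSupport_normed.contDiff_convolution_left _ φ.contDiff_normed hf.locallyIntegrable

/-- Differentiation falls on the bump. The translated bump is supported inside the disc of radius
`ρ`, where the cutoff is invisible, so it is an admissible test function and the derivative moves
onto `f`. -/
lemma enorm_fderiv_mollify_le (φ : ContDiffBump (0 : ℂ)) {ρ : ℝ} (hρ : ρ < 1) {f : ℂ → ℝ}
    {Df : ℂ → (ℂ →L[ℝ] ℝ)} (hf : HasWeakFDerivOn unitDisc f Df) {g : ℂ → ℝ≥0∞}
    (hg : ∀ᵐ z ∂(volume.restrict unitDisc), ‖Df z‖ₑ ≤ g z) {x : ℂ} (hx : ‖x‖ + φ.rOut < ρ) :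
    ‖fderiv ℝ (mollify φ ρ f) x‖ₑ ≤ lmollify φ g x := by
  have hfi := hf.integrable_indicator hρ
  set fρ := (Metric.ball 0 ρ).indicator f
  set η : ℂ → ℝ := fun y => φ.normed volume (x - y)
  have hη : ContDiff ℝ (⊤ : ℕ∞) η := (φ.contDiff_normed).comp (contDiff_const.sub contDiff_id)
  have hηsupp : tsupport η ⊆ Metric.closedBall x φ.rOut := by
    refine closure_minimal (fun y hy => ?_) Metric.isClosed_closedBall
    have : x - y ∈ Function.support (φ.normed (volume : Measure ℂ)) := hy
    rw [φ.support_normed_eq] at this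
    rw [Metric.mem_closedBall, dist_comm, dist_eq_norm]
    exact (by simpa using this : ‖x - y‖ < φ.rOut).le
  have hball : Metric.closedBall x φ.rOut ⊆ Metric.ball 0 ρ := by
    refine Metric.closedBall_subset_ball' ?_
    rw [dist_zero_right]; linarith
  have hηc : HasCompactSupport η :=
    HasCompactSupport.of_support_subset_isCompact (isCompact_closedBall x φ.rOut)
      (subset_closure.trans hηsupp)
  have hηD : tsupport η ⊆ unitDisc :=
    hηsupp.trans (hball.trans (Metric.ball_subset_ball hρ.le))
  have hderiv : ∀ v : ℂ, fderiv ℝ (mollify φ ρ f) x v = ∫ y in unitDisc, η y • Df y v := by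
    intro v
    have h1 := (φ.hasCompactSupport_normed (μ := volume)).hasFDerivAt_convolution_left
      (μ := volume) (ContinuousLinearMap.lsmul ℝ ℝ) φ.contDiff_normed hfi.locallyIntegrable x
    have hcs : HasCompactSupport (fderiv ℝ (φ.normed volume)) :=
      (φ.hasCompactSupport_normed (μ := volume)).fderiv ℝ
    have hex : ConvolutionExistsAt (fderiv ℝ (φ.normed (volume : Measure ℂ))) fρ x
        (ContinuousLinearMap.precompL ℂ (ContinuousLinearMap.lsmul ℝ ℝ)) volume :=
      hcs.convolutionExists_left _ ((φ.contDiff_normed (n := 1)).continuous_fderiv one_ne_zero)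
        hfi.locallyIntegrable x
    have h2 := hf.integral_eq η hη hηc hηD v
    rw [← neg_eq_iff_eq_neg] at h2
    rw [mollify, h1.fderiv, ← h2, convolution_def, ContinuousLinearMap.integral_apply hex,
      ← integral_sub_left_eq_self _ _ x, ← integral_neg,
      ← integral_indicator measurableSet_unitDisc]
    refine integral_congr_ae (ae_of_all _ fun y => ?_)
    have hfd : fderiv ℝ η y v = - fderiv ℝ (φ.normed volume) (x - y) v := by
      have h3 : HasFDerivAt η ((fderiv ℝ (φ.normed volume) (x - y)).comp
          (-ContinuousLinearMap.id ℝ ℂ)) y := by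
        refine HasFDerivAt.comp y
          ((φ.contDiff_normed (n := 1)).differentiable one_ne_zero _).hasFDerivAt ?_
        simpa using (hasFDerivAt_id y).const_sub x
      rw [h3.fderiv]
      simp
    simp only [sub_sub_cancel, ContinuousLinearMap.precompL_apply,
      ContinuousLinearMap.lsmul_apply]
    by_cases hy : y ∈ Metric.ball (0 : ℂ) ρ
    · have hyD : y ∈ Metric.ball (0 : ℂ) 1 := Metric.ball_subset_ball hρ.le hy
      rw [unitDisc, indicator_of_mem hyD, hfd]
      simp [fρ, indicator_of_mem hy]
    · have h4 : fderiv ℝ η y = 0 := by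
        refine image_eq_zero_of_notMem_tsupport fun h => hy ?_
        exact hball (hηsupp (tsupport_fderiv_subset ℝ h))
      have h5 : fρ y = 0 := indicator_of_notMem hy _
      rw [h5]
      simp [indicator, h4]
  have hbound : ∀ v : ℂ, ‖fderiv ℝ (mollify φ ρ f) x v‖ₑ ≤ lmollify φ g x * ‖v‖ₑ := by
    intro v
    rw [hderiv]
    refine (enorm_integral_le_lintegral_enorm _).trans ?_
    calc ∫⁻ y in unitDisc, ‖η y • Df y v‖ₑ
        ≤ ∫⁻ y in unitDisc, ENNReal.ofReal (η y) * g y * ‖v‖ₑ := by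
          refine lintegral_mono_ae ?_
          filter_upwards [hg] with y hy
          rw [enorm_smul, mul_assoc, Real.enorm_of_nonneg (φ.nonneg_normed _)]
          gcongr
          exact (ContinuousLinearMap.le_opENorm _ _).trans (mul_le_mul_left hy _)
      _ ≤ ∫⁻ y, ENNReal.ofReal (η y) * g y * ‖v‖ₑ := setLIntegral_le_lintegral _ _
      _ = _ := by
          rw [lintegral_mul_const' _ _ enorm_ne_top, lmollify,
            ← lintegral_sub_left_eq_self _ x]
          simp [η]
  by_cases htop : lmollify φ g x = ⊤
  · rw [htop]; exact le_top
  rw [← ENNReal.ofReal_toReal htop, ← ofReal_norm]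
  refine ENNReal.ofReal_le_ofReal (ContinuousLinearMap.opNorm_le_bound _ ENNReal.toReal_nonneg ?_)
  intro v
  have := ENNReal.toReal_mono (ENNReal.mul_ne_top htop enorm_ne_top) (hbound v)
  simpa using this

/-- A sequence of mollifiers. -/
def mollifier (n : ℕ) : ContDiffBump (0 : ℂ) where
  rIn := 1 / ((n : ℝ) + 1)
  rOut := 2 * (1 / ((n : ℝ) + 1))
  rIn_pos := Nat.one_div_pos_of_nat
  rIn_lt_rOut := by linarith [Nat.one_div_pos_of_nat (α := ℝ) (n := n)]

lemma tendsto_mollifier_rOut : Tendsto (fun n => (mollifier n).rOut) atTop (𝓝 0) := by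
  simpa [mollifier] using (tendsto_one_div_add_atTop_nhds_zero_nat (𝕜 := ℝ)).const_mul 2

/-- **Pointwise oscillation estimate.** On a convex subset of the disc that contains a disc of
comparable radius, the oscillation of a weakly differentiable function is controlled by the
truncated Riesz potential of its gradient. -/
theorem HasWeakFDerivOn.exists_enorm_sub_le {f : ℂ → ℝ} {Df : ℂ → (ℂ →L[ℝ] ℝ)}
    (hf : HasWeakFDerivOn unitDisc f Df) {g : ℂ → ℝ≥0∞} (hgm : Measurable g)
    (hgi : ∫⁻ z, g z < ⊤) (hg : ∀ᵐ z ∂(volume.restrict unitDisc), ‖Df z‖ₑ ≤ g z)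
    {E : Set ℂ} (hE : Convex ℝ E) (hED : E ⊆ unitDisc) {R : ℝ} (hR : 0 < R)
    (hER : ∀ x ∈ E, ∀ y ∈ E, dist y x < R) {y₀ : ℂ} {r₀ : ℝ} (hr₀ : r₀ < 1)
    (hy₀ : Metric.ball y₀ (R / 8) ⊆ E) (hy₀' : Metric.ball y₀ (R / 8) ⊆ Metric.ball 0 r₀) :
    ∃ S : Set ℂ, (∀ᵐ z : ℂ, z ∈ S) ∧ ∀ x ∈ S, ∀ x' ∈ S, x ∈ E → x' ∈ E →
      ‖f x - f x'‖ₑ ≤ 16 * (rieszPotential R g x + rieszPotential R g x') := by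
  -- Only countably many cutoff radii are used, so one null set serves all pairs `x`, `x'`.
  let ρ : ℕ → ℝ := fun m => 1 - 1 / ((m : ℝ) + 1)
  have hρ1 : ∀ m, ρ m < 1 := fun m => by
    have := Nat.one_div_pos_of_nat (α := ℝ) (n := m)
    simp only [ρ]; linarith
  have hρlim : Tendsto ρ atTop (𝓝 1) := by
    simpa [ρ] using (tendsto_one_div_add_atTop_nhds_zero_nat (𝕜 := ℝ)).const_sub 1
  have hrat : ∀ᶠ n in atTop, (mollifier n).rOut ≤ 2 * (mollifier n).rIn :=
    Eventually.of_forall fun n => le_rfl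
  have hum := measurable_rieszPotential R hgm
  have hu := tendsto_lmollify tendsto_mollifier_rOut hrat hum
    (lintegral_rieszPotential_lt_top R hgm hgi)
  have hF : ∀ᵐ x : ℂ, ∀ m, Tendsto (fun n => mollify (mollifier n) (ρ m) f x) atTop
      (𝓝 ((Metric.ball 0 (ρ m)).indicator f x)) :=
    ae_all_iff.2 fun m => ContDiffBump.ae_convolution_tendsto_right_of_locallyIntegrable
      tendsto_mollifier_rOut hrat (hf.integrable_indicator (hρ1 m)).locallyIntegrable
  refine ⟨_, hu.and hF, fun x hx x' hx' hxE hx'E => ?_⟩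
  have hxD : ‖x‖ < 1 := by simpa [unitDisc] using hED hxE
  have hxD' : ‖x'‖ < 1 := by simpa [unitDisc] using hED hx'E
  -- The smooth estimate is applied on `E ∩ ball 0 ρ₁`, which contains both points and the reference
  -- disc and leaves room `ρ m - ρ₁` for the mollifier.
  obtain ⟨ρ₁, hρ₁, hρ₁'⟩ := exists_between (max_lt (max_lt hxD hxD') hr₀)
  obtain ⟨m, hm⟩ := (hρlim.eventually_const_lt hρ₁').exists
  have hxρ : ‖x‖ < ρ₁ := (le_max_left _ _).trans_lt ((le_max_left _ _).trans_lt hρ₁)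
  have hxρ' : ‖x'‖ < ρ₁ := (le_max_right _ _).trans_lt ((le_max_left _ _).trans_lt hρ₁)
  have hrρ : r₀ < ρ₁ := (le_max_right _ _).trans_lt hρ₁
  have hfx := hx.2 m
  have hfx' := hx'.2 m
  rw [indicator_of_mem (by simpa using hxρ.trans hm)] at hfx
  rw [indicator_of_mem (by simpa using hxρ'.trans hm)] at hfx'
  refine le_of_tendsto_of_tendsto (hfx.sub hfx').enorm
    (ENNReal.Tendsto.const_mul (hx.1.add hx'.1) (Or.inr (by norm_num))) ?_
  have hev : ∀ᶠ n in atTop, (mollifier n).rOut < ρ m - ρ₁ :=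
    tendsto_mollifier_rOut.eventually_lt_const (by linarith)
  filter_upwards [hev] with n hn
  rw [← rieszPotential_lmollify R _ hgm, ← rieszPotential_lmollify R _ hgm]
  refine enorm_sub_le_riesz (contDiff_mollify _ (hf.integrable_indicator (hρ1 m)))
    (hE.inter (convex_ball 0 ρ₁)) (measurable_lmollify _ hgm) (fun z hz => ?_) hR
    (fun x hx y hy => hER x hx.1 y hy.1) (y₀ := y₀)
    (subset_inter hy₀ (hy₀'.trans (Metric.ball_subset_ball hrρ.le))) ⟨hxE, by simpa using hxρ⟩
    ⟨hx'E, by simpa using hxρ'⟩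
  refine enorm_fderiv_mollify_le _ (hρ1 m) hf hg ?_
  have : ‖z‖ < ρ₁ := by simpa using hz.2
  linarith

/-- A weakly differentiable function on the part of a disc inside the unit disc differs from a
constant at most by a truncated Riesz potential of its gradient. -/
theorem HasWeakFDerivOn.exists_const_enorm_sub_le {f : ℂ → ℝ} {Df : ℂ → (ℂ →L[ℝ] ℝ)}
    (hf : HasWeakFDerivOn unitDisc f Df) {g : ℂ → ℝ≥0∞} (hgm : Measurable g)
    (hgi : ∫⁻ z, g z < ⊤) (hg : ∀ᵐ z ∂(volume.restrict unitDisc), ‖Df z‖ₑ ≤ g z)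
    {x₀ : ℂ} (hx₀ : x₀ ∈ unitDisc) {δ : ℝ} (hδ : 0 < δ) (hδ1 : δ ≤ 1) :
    ∃ c : ℝ, ∀ᵐ z : ℂ, z ∈ unitDisc ∩ Metric.ball x₀ δ →
      ‖f z - c‖ₑ ≤ 16 * rieszPotential (2 * δ) g z := by
  have hx₀' : ‖x₀‖ < 1 := by simpa [unitDisc] using hx₀
  set E := unitDisc ∩ Metric.ball x₀ δ
  -- Moving the centre inward by at most `δ / 2` makes a disc of radius `2 * δ / 8` fit inside `E`,
  -- even when `x₀` is close to the unit circle.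
  set y₀ : ℂ := (1 - δ / 2) • x₀
  have hy₀n : ‖y₀‖ ≤ 1 - δ / 2 := by
    rw [norm_smul, Real.norm_of_nonneg (by linarith)]
    nlinarith [norm_nonneg x₀]
  have hy₀d : dist y₀ x₀ ≤ δ / 2 := by
    rw [dist_eq_norm, show y₀ - x₀ = (-(δ / 2)) • x₀ by simp only [y₀]; module, norm_smul, norm_neg,
      Real.norm_of_nonneg (by linarith)]
    nlinarith [norm_nonneg x₀]
  have hb : Metric.ball y₀ (2 * δ / 8) ⊆ Metric.ball 0 (1 - δ / 4) := by
    refine Metric.ball_subset_ball' ?_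
    rw [dist_zero_right]; linarith
  obtain ⟨S, hS, hSE⟩ := hf.exists_enorm_sub_le hgm hgi hg (E := E)
    ((convex_ball 0 1).inter (convex_ball x₀ δ)) inter_subset_left (R := 2 * δ) (by linarith)
    (fun x hx y hy => by
      have h1 := Metric.mem_ball.1 hx.2
      have h2 := Metric.mem_ball.1 hy.2
      linarith [dist_triangle_right y x x₀]) (y₀ := y₀) (r₀ := 1 - δ / 4) (by linarith)
    (subset_inter (hb.trans (Metric.ball_subset_ball (by linarith)))
      (Metric.ball_subset_ball' (by linarith))) hb
  set u := rieszPotential (2 * δ) g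
  have hfin : ∀ᵐ z, u z < ⊤ := ae_lt_top (measurable_rieszPotential _ hgm)
    (lintegral_rieszPotential_lt_top _ hgm hgi).ne
  let T : Set ℂ := {z | z ∈ S ∧ z ∈ E ∧ u z < ⊤}
  -- All values of `f - 16 u` lie below all values of `f + 16 u`, so the infimum of the latter is a
  -- constant separating them.
  have hT : ∀ x ∈ T, ∀ x' ∈ T, f x - 16 * (u x).toReal ≤ f x' + 16 * (u x').toReal := by
    intro x hx x' hx'
    have h := hSE x hx.1 x' hx'.1 hx.2.1 hx'.2.1
    have h2 := ENNReal.toReal_mono (ENNReal.mul_ne_top (by norm_num)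
      (ENNReal.add_ne_top.2 ⟨hx.2.2.ne, hx'.2.2.ne⟩)) h
    rw [ENNReal.toReal_mul, ENNReal.toReal_add hx.2.2.ne hx'.2.2.ne, toReal_enorm,
      Real.norm_eq_abs] at h2
    have h3 := (abs_le.1 h2).2
    norm_num at h3
    linarith
  rcases T.eq_empty_or_nonempty with hTe | ⟨x₁, hx₁⟩
  · refine ⟨0, ?_⟩
    filter_upwards [hS, hfin] with z hz1 hz2 hzE
    exact absurd (show z ∈ T from ⟨hz1, hzE, hz2⟩) (by simp [hTe])
  refine ⟨sInf ((fun x => f x + 16 * (u x).toReal) '' T), ?_⟩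
  filter_upwards [hS, hfin] with z hz1 hz2 hzE
  have hz : z ∈ T := ⟨hz1, hzE, hz2⟩
  have hlow : f z - 16 * (u z).toReal ≤ sInf ((fun x => f x + 16 * (u x).toReal) '' T) :=
    le_csInf ⟨_, mem_image_of_mem _ hx₁⟩ (by rintro _ ⟨x', hx', rfl⟩; exact hT z hz x' hx')
  have hup : sInf ((fun x => f x + 16 * (u x).toReal) '' T) ≤ f z + 16 * (u z).toReal :=
    csInf_le ⟨f x₁ - 16 * (u x₁).toReal, by rintro _ ⟨x', hx', rfl⟩; exact hT x₁ hx₁ x' hx'⟩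
      (mem_image_of_mem _ hz)
  rw [← ENNReal.ofReal_toReal hz2.ne, show (16 : ℝ≥0∞) = ENNReal.ofReal 16 by norm_num,
    ← ENNReal.ofReal_mul (by norm_num), ← ofReal_norm, Real.norm_eq_abs]
  exact ENNReal.ofReal_le_ofReal (abs_le.2 ⟨by linarith, by linarith⟩)

/-! ### Weighted estimates for the Riesz potential -/

/-- Cauchy–Schwarz after splitting the kernel into its powers `a / 2` and `1 - a / 2`; by
translation the second factor does not depend on `x`. -/
lemma rieszPotential_rpow_two_le (R : ℝ) {g : ℂ → ℝ≥0∞} (hg : Measurable g) {a : ℝ} (ha : 0 < a)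
    (ha2 : a < 2) (x : ℂ) :
    rieszPotential R g x ^ (2 : ℝ) ≤
      (∫⁻ z, g z ^ (2 : ℝ) * rieszKernel R (z - x) ^ a) * ∫⁻ z, rieszKernel R z ^ (2 - a) := by
  have h1 : rieszPotential R g x = ∫⁻ z, ((fun z => g z * rieszKernel R (z - x) ^ (a / 2)) *
      fun z => rieszKernel R (z - x) ^ (1 - a / 2)) z := by
    refine lintegral_congr fun z => ?_
    simp only [Pi.mul_apply]
    rw [mul_assoc, ← ENNReal.rpow_add_of_nonneg _ _ (by linarith) (by linarith)]
    simp
  have h2 := ENNReal.lintegral_mul_le_Lp_mul_Lq volume Real.HolderConjugate.two_two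
    (f := fun z => g z * rieszKernel R (z - x) ^ (a / 2))
    (g := fun z => rieszKernel R (z - x) ^ (1 - a / 2)) (by fun_prop) (by fun_prop)
  rw [← h1] at h2
  refine (ENNReal.rpow_le_rpow h2 (by norm_num : (0 : ℝ) ≤ 2)).trans (le_of_eq ?_)
  rw [ENNReal.mul_rpow_of_nonneg _ _ (by norm_num : (0 : ℝ) ≤ 2), ← ENNReal.rpow_mul,
    ← ENNReal.rpow_mul]
  norm_num
  congr 1
  · refine lintegral_congr fun z => ?_
    rw [mul_pow, ← ENNReal.rpow_natCast (_ ^ (a / 2)), ← ENNReal.rpow_mul]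
    norm_num
  · rw [← lintegral_sub_right_eq_self (fun z => rieszKernel R z ^ (2 - a)) x]
    refine lintegral_congr fun z => ?_
    rw [← ENNReal.rpow_natCast (_ ^ (1 - a / 2)), ← ENNReal.rpow_mul]
    congr 1
    norm_num
    ring

/-- Jensen for the measure with density `w`, whose total mass contributes the power `p - 1`. -/
lemma lintegral_mul_rpow_le {α : Type*} [MeasurableSpace α] {μ : Measure α} {w f : α → ℝ≥0∞}
    (hw : Measurable w) (hf : Measurable f) {p : ℝ} (hp : 1 ≤ p) :
    (∫⁻ z, w z * f z ∂μ) ^ p ≤ (∫⁻ z, w z ∂μ) ^ (p - 1) * ∫⁻ z, w z * f z ^ p ∂μ := by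
  have hp0 : 0 < p := by linarith
  have h := eLpNorm'_le_eLpNorm'_mul_rpow_measure_univ (μ := μ.withDensity w) zero_lt_one hp
    hf.aestronglyMeasurable
  simp only [eLpNorm', enorm_eq_self, ENNReal.rpow_one, div_one] at h
  rw [lintegral_withDensity_eq_lintegral_mul _ hw hf,
    lintegral_withDensity_eq_lintegral_mul _ hw (by fun_prop),
    withDensity_apply _ MeasurableSet.univ, Measure.restrict_univ] at h
  refine (ENNReal.rpow_le_rpow h hp0.le).trans (le_of_eq ?_)
  rw [ENNReal.mul_rpow_of_nonneg _ _ hp0.le, ← ENNReal.rpow_mul, ← ENNReal.rpow_mul, mul_comm,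
    one_div_mul_cancel hp0.ne', ENNReal.rpow_one]
  congr 2
  field_simp

/-- **Weighted Hardy–Littlewood–Sobolev type estimate** for the truncated Riesz potential. -/
theorem lintegral_rieszPotential_rpow_mul_le (R : ℝ) {g H : ℂ → ℝ≥0∞} (hg : Measurable g)
    (hH : Measurable H) {p β β' : ℝ} (hp : 1 ≤ p) (hβ : β.HolderConjugate β') :
    ∫⁻ x, rieszPotential R g x ^ (2 * p) * H x ≤
      (∫⁻ z, g z ^ (2 : ℝ)) ^ p * ((∫⁻ z, rieszKernel R z ^ (2 - 1 / (p * β'))) ^ p *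
      ((∫⁻ x, H x ^ β) ^ (1 / β) * (∫⁻ z, rieszKernel R z) ^ (1 / β'))) := by
  have hp0 : 0 < p := by linarith
  have hβ'1 : 1 < β' := hβ.symm.lt
  have hβ'0 : 0 < β' := hβ.symm.pos
  -- With this exponent `a * p * β' = 1`, so Hölder against `H` leaves exactly the first power of
  -- the kernel, while `2 - a < 2` keeps the other kernel integral finite.
  set a := 1 / (p * β') with ha
  have ha0 : 0 < a := by positivity
  have ha1 : a ≤ 1 := by
    rw [ha, div_le_one (by positivity)]
    nlinarith
  have hap : a * p * β' = 1 := by rw [ha]; field_simp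
  set M := ∫⁻ z, rieszKernel R z ^ (2 - a)
  have hgm2 : Measurable fun z => g z ^ (2 : ℝ) := by fun_prop
  have hpt : ∀ x, rieszPotential R g x ^ (2 * p) ≤ M ^ p * ((∫⁻ z, g z ^ (2 : ℝ)) ^ (p - 1) *
      ∫⁻ z, g z ^ (2 : ℝ) * rieszKernel R (z - x) ^ (a * p)) := by
    intro x
    rw [ENNReal.rpow_mul]
    refine (ENNReal.rpow_le_rpow (rieszPotential_rpow_two_le R hg ha0 (by linarith) x)
      hp0.le).trans ?_
    rw [ENNReal.mul_rpow_of_nonneg _ _ hp0.le, mul_comm]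
    gcongr
    refine (lintegral_mul_rpow_le hgm2 (by fun_prop) hp).trans (le_of_eq ?_)
    simp_rw [← ENNReal.rpow_mul]
  have hinner : ∀ z, ∫⁻ x, rieszKernel R (z - x) ^ (a * p) * H x ≤
      (∫⁻ x, H x ^ β) ^ (1 / β) * (∫⁻ z, rieszKernel R z) ^ (1 / β') := by
    intro z
    have h := ENNReal.lintegral_mul_le_Lp_mul_Lq volume hβ (f := H)
      (g := fun x => rieszKernel R (z - x) ^ (a * p)) hH.aemeasurable (by fun_prop)
    simp only [Pi.mul_apply, ← ENNReal.rpow_mul, hap, ENNReal.rpow_one] at h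
    rw [lintegral_sub_left_eq_self (rieszKernel R) z] at h
    simpa only [mul_comm] using h
  calc ∫⁻ x, rieszPotential R g x ^ (2 * p) * H x
      ≤ ∫⁻ x, M ^ p * ((∫⁻ z, g z ^ (2 : ℝ)) ^ (p - 1) *
          ∫⁻ z, g z ^ (2 : ℝ) * (rieszKernel R (z - x) ^ (a * p) * H x)) := by
        refine lintegral_mono fun x => ?_
        have : ∫⁻ z, g z ^ (2 : ℝ) * (rieszKernel R (z - x) ^ (a * p) * H x) =
            (∫⁻ z, g z ^ (2 : ℝ) * rieszKernel R (z - x) ^ (a * p)) * H x := by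
          rw [← lintegral_mul_const _ (by fun_prop)]
          simp only [mul_assoc]
        rw [this, ← mul_assoc, ← mul_assoc, mul_assoc (M ^ p)]
        exact mul_le_mul_left (hpt x) _
    _ = M ^ p * ((∫⁻ z, g z ^ (2 : ℝ)) ^ (p - 1) *
          ∫⁻ z, g z ^ (2 : ℝ) * ∫⁻ x, rieszKernel R (z - x) ^ (a * p) * H x) := by
        have hm : Measurable (Function.uncurry fun x z => g z ^ (2 : ℝ) *
            (rieszKernel R (z - x) ^ (a * p) * H x)) := by
          unfold Function.uncurry; fun_prop
        have hm' : Measurable fun x => ∫⁻ z, g z ^ (2 : ℝ) *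
            (rieszKernel R (z - x) ^ (a * p) * H x) := hm.lintegral_prod_right'
        rw [lintegral_const_mul _ (hm'.const_mul _), lintegral_const_mul _ hm',
          lintegral_lintegral_swap hm.aemeasurable]
        congr 2
        refine lintegral_congr fun z => ?_
        exact lintegral_const_mul _ (by fun_prop)
    _ ≤ M ^ p * ((∫⁻ z, g z ^ (2 : ℝ)) ^ (p - 1) * ∫⁻ z, g z ^ (2 : ℝ) *
          ((∫⁻ x, H x ^ β) ^ (1 / β) * (∫⁻ z, rieszKernel R z) ^ (1 / β'))) := by
        gcongr with z
        exact hinner z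
    _ = _ := by
        rw [lintegral_mul_const _ hgm2]
        nth_rewrite 2 [← ENNReal.rpow_one (∫⁻ z, g z ^ (2 : ℝ))]
        rw [← mul_assoc ((∫⁻ z, g z ^ (2 : ℝ)) ^ (p - 1)),
          ← ENNReal.rpow_add_of_nonneg _ _ (by linarith) zero_le_one, sub_add_cancel]
        ring

/-! ### Regular weights and the weighted Poincaré–Sobolev inequality -/

/-- A Borel representative extended by zero lets the Riesz estimates over all of `ℂ` be used. -/
lemma IsRegularWeight.exists_density {h : ℂ → ℝ} (hh : IsRegularWeight h) :
    ∃ β : ℝ, 1 < β ∧ ∃ H : ℂ → ℝ≥0∞, Measurable H ∧ weightMeasure h = volume.withDensity H ∧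
      ∫⁻ x, H x ^ β < ⊤ := by
  obtain ⟨β, hβ, hm⟩ := hh
  have hmeas := hm.aestronglyMeasurable.aemeasurable.ennreal_ofReal
  refine ⟨β, hβ, unitDisc.indicator (hmeas.mk _),
    hmeas.measurable_mk.indicator measurableSet_unitDisc, ?_, ?_⟩
  · rw [withDensity_indicator measurableSet_unitDisc, weightMeasure]
    exact withDensity_congr_ae hmeas.ae_eq_mk
  · have h1 : ∀ x, unitDisc.indicator (hmeas.mk _) x ^ β =
        unitDisc.indicator (fun x => hmeas.mk _ x ^ β) x := by
      intro x
      by_cases hx : x ∈ unitDisc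
      · simp [hx]
      · simp [hx, ENNReal.zero_rpow_of_pos (by linarith : 0 < β)]
    simp_rw [h1]
    rw [lintegral_indicator measurableSet_unitDisc]
    have h2 := lintegral_rpow_enorm_lt_top_of_eLpNorm_lt_top (by simp; linarith)
      ENNReal.ofReal_ne_top hm.eLpNorm_lt_top
    rw [ENNReal.toReal_ofReal (by linarith)] at h2
    refine lt_of_le_of_lt (lintegral_mono_ae ?_) h2
    filter_upwards [hmeas.ae_eq_mk] with x hx
    rw [← hx]
    gcongr
    exact Real.ofReal_le_enorm _

lemma weightMeasure_absolutelyContinuous (h : ℂ → ℝ) :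
    weightMeasure h ≪ volume.restrict unitDisc := withDensity_absolutelyContinuous _ _

lemma ae_weightMeasure_of_ae {P : ℂ → Prop} (h : ℂ → ℝ) (H : ∀ᵐ z : ℂ, z ∈ unitDisc → P z) :
    ∀ᵐ z ∂(weightMeasure h), P z :=
  (weightMeasure_absolutelyContinuous h).ae_le ((ae_restrict_iff' measurableSet_unitDisc).2 H)

lemma volume_unitDisc_ne_top : volume unitDisc ≠ ⊤ := measure_ball_lt_top.ne

instance isFiniteMeasure_restrict_unitDisc : IsFiniteMeasure (volume.restrict unitDisc) :=
  isFiniteMeasure_restrict.2 volume_unitDisc_ne_top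

lemma IsRegularWeight.isFiniteMeasure {h : ℂ → ℝ} (hh : IsRegularWeight h) :
    IsFiniteMeasure (weightMeasure h) := by
  obtain ⟨β, hβ, hm⟩ := hh
  have h1 : MemLp h 1 (volume.restrict unitDisc) :=
    hm.mono_exponent (by simpa using hβ.le)
  refine isFiniteMeasure_withDensity (ne_of_lt ?_)
  refine lt_of_le_of_lt (lintegral_mono fun x => Real.ofReal_le_enorm (h x)) ?_
  exact (memLp_one_iff_integrable.1 h1).2

/-- The Riesz potential is bounded from `L²` to `L^{2p}` of a regular weight, with a constant that
tends to zero with the truncation radius. -/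
lemma IsRegularWeight.exists_rieszPotential_bound {h : ℂ → ℝ} (hh : IsRegularWeight h) {p : ℝ}
    (hp : 1 ≤ p) : ∃ K : ℝ → ℝ≥0∞, (∀ R, K R < ⊤) ∧ Tendsto K (𝓝[>] 0) (𝓝 0) ∧
      ∀ (R : ℝ) (g : ℂ → ℝ≥0∞), Measurable g →
        ∫⁻ x, (16 * rieszPotential R g x) ^ (2 * p) ∂(weightMeasure h) ≤
          K R * (∫⁻ z, g z ^ (2 : ℝ)) ^ p := by
  obtain ⟨β, hβ, H, hH, hHd, hHi⟩ := hh.exists_density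
  have hc : β.HolderConjugate (Real.conjExponent β) := Real.HolderConjugate.conjExponent hβ
  set β' := Real.conjExponent β
  have hp0 : 0 < p := by linarith
  have hβ' : 1 < β' := hc.symm.lt
  have ha0 : 0 < 1 / (p * β') := by positivity
  have ha1 : 1 / (p * β') < 1 := by
    rw [div_lt_one (by positivity)]
    nlinarith
  have hlt : ∀ R, ∫⁻ z, rieszKernel R z ^ (2 - 1 / (p * β')) < ⊤ := fun R =>
    lintegral_rieszKernel_rpow_lt_top R (by linarith) (by linarith)
  have hlt1 : ∀ R, ∫⁻ z, rieszKernel R z < ⊤ := fun R => by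
    simpa using lintegral_rieszKernel_rpow_lt_top R zero_lt_one one_lt_two
  have hlim := tendsto_lintegral_rieszKernel_rpow (b := 2 - 1 / (p * β')) (by linarith)
    (by linarith)
  have hlim1 : Tendsto (fun R : ℝ => ∫⁻ z, rieszKernel R z) (𝓝[>] 0) (𝓝 0) := by
    simpa using tendsto_lintegral_rieszKernel_rpow zero_lt_one one_lt_two
  have hHt : (∫⁻ x, H x ^ β) ^ (1 / β) < ⊤ :=
    ENNReal.rpow_lt_top_of_nonneg (by positivity) hHi.ne
  have h16 : (16 : ℝ≥0∞) ^ (2 * p) < ⊤ := ENNReal.rpow_lt_top_of_nonneg (by linarith) (by norm_num)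
  refine ⟨fun R => 16 ^ (2 * p) * ((∫⁻ z, rieszKernel R z ^ (2 - 1 / (p * β'))) ^ p *
      ((∫⁻ x, H x ^ β) ^ (1 / β) * (∫⁻ z, rieszKernel R z) ^ (1 / β'))), fun R => ?_, ?_, ?_⟩
  · refine ENNReal.mul_lt_top h16 (ENNReal.mul_lt_top ?_ (ENNReal.mul_lt_top hHt ?_))
    · exact ENNReal.rpow_lt_top_of_nonneg hp0.le (hlt R).ne
    · exact ENNReal.rpow_lt_top_of_nonneg (by positivity) (hlt1 R).ne
  · have e1 := (ENNReal.continuous_rpow_const (y := p)).tendsto 0 |>.comp hlim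
    have e2 := (ENNReal.continuous_rpow_const (y := 1 / β')).tendsto 0 |>.comp hlim1
    simp only [ENNReal.zero_rpow_of_pos hp0] at e1
    rw [ENNReal.zero_rpow_of_pos (by positivity)] at e2
    have e3 := ENNReal.Tendsto.const_mul (a := (∫⁻ x, H x ^ β) ^ (1 / β)) e2 (Or.inr hHt.ne)
    have e4 := ENNReal.Tendsto.mul e1 (Or.inr (by simp)) e3 (Or.inr (by simp))
    have e5 := ENNReal.Tendsto.const_mul (a := (16 : ℝ≥0∞) ^ (2 * p)) e4 (Or.inr h16.ne)
    simpa using e5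
  · intro R g hg
    have hu := measurable_rieszPotential R hg
    rw [hHd, lintegral_withDensity_eq_lintegral_mul _ hH (by fun_prop)]
    calc ∫⁻ x, (H * fun x => (16 * rieszPotential R g x) ^ (2 * p)) x
        = ∫⁻ x, 16 ^ (2 * p) * (rieszPotential R g x ^ (2 * p) * H x) := by
          refine lintegral_congr fun x => ?_
          simp only [Pi.mul_apply]
          rw [ENNReal.mul_rpow_of_nonneg _ _ (by linarith), mul_comm, mul_assoc]
      _ = 16 ^ (2 * p) * ∫⁻ x, rieszPotential R g x ^ (2 * p) * H x :=
          lintegral_const_mul _ (by fun_prop)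
      _ ≤ _ := mul_le_mul_right (lintegral_rieszPotential_rpow_mul_le R hg hH hp hc) _
      _ = _ := by
          rw [mul_comm ((∫⁻ z, g z ^ (2 : ℝ)) ^ p)]
          exact (mul_assoc _ _ _).symm

/-- A Borel version of the gradient norm, extended by zero; it is integrable because the disc has
finite area. -/
lemma exists_measurable_enorm {Df : ℂ → (ℂ →L[ℝ] ℝ)} (hD : MemLp Df 2 (volume.restrict unitDisc)) :
    ∃ g : ℂ → ℝ≥0∞, Measurable g ∧ ∫⁻ z, g z < ⊤ ∧
      (∀ᵐ z ∂(volume.restrict unitDisc), ‖Df z‖ₑ ≤ g z) ∧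
      (∫⁻ z, g z ^ (2 : ℝ)) = eLpNorm Df 2 (volume.restrict unitDisc) ^ (2 : ℝ) := by
  have hm := hD.aestronglyMeasurable.enorm
  refine ⟨unitDisc.indicator (hm.mk _), hm.measurable_mk.indicator measurableSet_unitDisc, ?_, ?_, ?_⟩
  · rw [lintegral_indicator measurableSet_unitDisc, lintegral_congr_ae hm.ae_eq_mk.symm]
    exact (memLp_one_iff_integrable.1 (hD.mono_exponent (by norm_num))).2
  · filter_upwards [hm.ae_eq_mk, ae_restrict_mem measurableSet_unitDisc] with z hz hzD
    rw [indicator_of_mem hzD, hz]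
  · have h1 : ∀ x, unitDisc.indicator (hm.mk _) x ^ (2 : ℝ) =
        unitDisc.indicator (fun x => hm.mk _ x ^ (2 : ℝ)) x := by
      intro x
      by_cases hx : x ∈ unitDisc
      · simp [hx]
      · simp [hx]
    simp_rw [h1]
    rw [lintegral_indicator measurableSet_unitDisc,
      eLpNorm_eq_lintegral_rpow_enorm_toReal two_ne_zero (by norm_num), ← ENNReal.rpow_mul]
    norm_num
    refine lintegral_congr_ae ?_
    filter_upwards [hm.ae_eq_mk] with z hz
    rw [hz]

/-- **Weighted Poincaré–Sobolev inequality**, modulo constants. -/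
theorem IsRegularWeight.exists_poincare {h : ℂ → ℝ} (hh : IsRegularWeight h) {p : ℝ}
    (hp : 1 ≤ p) : ∃ C : ℝ≥0∞, C < ⊤ ∧ ∀ (f : ℂ → ℝ) (Df : ℂ → (ℂ →L[ℝ] ℝ)),
      HasWeakFDerivOn unitDisc f Df → MemLp Df 2 (volume.restrict unitDisc) →
      ∃ c : ℝ, eLpNorm (fun z => f z - c) (ENNReal.ofReal (2 * p)) (weightMeasure h) ≤
        C * eLpNorm Df 2 (volume.restrict unitDisc) := by
  obtain ⟨K, hK, -, hKb⟩ := hh.exists_rieszPotential_bound hp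
  have hp0 : 0 < p := by linarith
  -- The disc of radius `δ = 1` about the origin is the whole unit disc, hence the truncation radius
  -- `2 * δ = 2`.
  refine ⟨K 2 ^ (1 / (2 * p)), ENNReal.rpow_lt_top_of_nonneg (by positivity) (hK 2).ne, ?_⟩
  intro f Df hf hD
  obtain ⟨g, hgm, hgi, hg, hg2⟩ := exists_measurable_enorm hD
  obtain ⟨c, hc⟩ := hf.exists_const_enorm_sub_le hgm hgi hg (x₀ := 0) (by simp [unitDisc])
    one_pos le_rfl
  refine ⟨c, ?_⟩
  have hae : ∀ᵐ z ∂(weightMeasure h), ‖f z - c‖ₑ ≤ 16 * rieszPotential 2 g z := by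
    refine ae_weightMeasure_of_ae h ?_
    filter_upwards [hc] with z hz hzD
    simpa using hz ⟨hzD, hzD⟩
  rw [eLpNorm_eq_lintegral_rpow_enorm_toReal (by simpa using hp0) ENNReal.ofReal_ne_top,
    ENNReal.toReal_ofReal (by positivity)]
  calc (∫⁻ x, ‖f x - c‖ₑ ^ (2 * p) ∂(weightMeasure h)) ^ (1 / (2 * p))
      ≤ (∫⁻ x, (16 * rieszPotential 2 g x) ^ (2 * p) ∂(weightMeasure h)) ^ (1 / (2 * p)) := by
        refine ENNReal.rpow_le_rpow (lintegral_mono_ae ?_) (by positivity)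
        filter_upwards [hae] with z hz
        exact ENNReal.rpow_le_rpow hz (by positivity)
    _ ≤ (K 2 * (∫⁻ z, g z ^ (2 : ℝ)) ^ p) ^ (1 / (2 * p)) :=
        ENNReal.rpow_le_rpow (hKb 2 g hgm) (by positivity)
    _ = _ := by
        rw [ENNReal.mul_rpow_of_nonneg _ _ (by positivity), hg2, ← ENNReal.rpow_mul,
          ← ENNReal.rpow_mul]
        have : 2 * (p * (1 / (2 * p))) = 1 := by field_simp
        rw [this, ENNReal.rpow_one]

/-- Subtracting the mean is subtracting `c` and then the mean of `f - c`, a constant whose `L^r`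
norm is at most that of `f - c`; hence the factor two. This replaces the unspecified constant of
`exists_poincare` by the weighted mean. -/
lemma eLpNorm_sub_average_le {α : Type*} [MeasurableSpace α] {ν : Measure α} [IsFiniteMeasure ν]
    {f : α → ℝ} (hf : AEStronglyMeasurable f ν) {r : ℝ≥0∞} (hr : 1 ≤ r) (c : ℝ) :
    eLpNorm (fun z => f z - ⨍ w, f w ∂ν) r ν ≤ 2 * eLpNorm (fun z => f z - c) r ν := by
  rcases eq_or_ne ν 0 with rfl | hν
  · simp
  by_cases htop : eLpNorm (fun z => f z - c) r ν = ⊤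
  · rw [htop]; simp
  have hmem : MemLp (fun z => f z - c) r ν :=
    ⟨hf.sub aestronglyMeasurable_const, lt_top_iff_ne_top.2 htop⟩
  have hint : Integrable (fun z => f z - c) ν := hmem.integrable hr
  have hint' : Integrable f ν := by
    refine (hint.add (integrable_const c)).congr (ae_of_all _ fun z => ?_)
    simp
  have hν0 : ν univ ≠ 0 := by simpa using hν
  have havg : (⨍ w, f w ∂ν) - c = ⨍ w, (f w - c) ∂ν := by
    have hr0 : ν.real univ ≠ 0 := by simp [Measure.real, hν0, ENNReal.toReal_eq_zero_iff]
    rw [average_eq, average_eq, integral_sub hint' (integrable_const c), integral_const]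
    simp only [smul_eq_mul]
    field_simp
  have hconst : eLpNorm (fun _ : α => (⨍ w, f w ∂ν) - c) r ν ≤ eLpNorm (fun z => f z - c) r ν := by
    have hr0 : r ≠ 0 := (zero_lt_one.trans_le hr).ne'
    rw [eLpNorm_const _ hr0 hν, havg]
    have h1 : ‖⨍ w, (f w - c) ∂ν‖ₑ ≤ (ν univ)⁻¹ * eLpNorm (fun z => f z - c) 1 ν := by
      rw [average_eq, enorm_smul, eLpNorm_one_eq_lintegral_enorm]
      refine mul_le_mul' (le_of_eq ?_) (enorm_integral_le_lintegral_enorm _)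
      rw [Real.enorm_of_nonneg (by positivity), Measure.real, ← ENNReal.toReal_inv,
        ENNReal.ofReal_toReal (by simpa using hν)]
    have h2 := eLpNorm_le_eLpNorm_mul_rpow_measure_univ (μ := ν) hr hmem.aestronglyMeasurable
    calc ‖⨍ w, (f w - c) ∂ν‖ₑ * ν univ ^ (1 / r.toReal)
        ≤ (ν univ)⁻¹ * (eLpNorm (fun z => f z - c) r ν *
            ν univ ^ (1 / (1 : ℝ≥0∞).toReal - 1 / r.toReal)) * ν univ ^ (1 / r.toReal) := by
          gcongr
          exact h1.trans (mul_le_mul_right h2 _)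
      _ = (ν univ)⁻¹ * (ν univ ^ (1 / (1 : ℝ≥0∞).toReal - 1 / r.toReal) *
            ν univ ^ (1 / r.toReal)) * eLpNorm (fun z => f z - c) r ν := by ring
      _ = _ := by
          rw [← ENNReal.rpow_add _ _ hν0 (measure_ne_top _ _)]
          simp only [ENNReal.toReal_one, sub_add_cancel, div_one, ENNReal.rpow_one]
          rw [ENNReal.inv_mul_cancel hν0 (measure_ne_top _ _), one_mul]
  have e : (fun z => f z - ⨍ w, f w ∂ν) =
      (fun z => f z - c) - fun _ => (⨍ w, f w ∂ν) - c := by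
    ext z; simp
  rw [e, two_mul]
  exact (eLpNorm_sub_le hmem.aestronglyMeasurable aestronglyMeasurable_const hr).trans
    (add_le_add le_rfl hconst)

lemma HasWeakFDerivOn.aestronglyMeasurable {f : ℂ → ℝ} {Df : ℂ → (ℂ →L[ℝ] ℝ)}
    (hf : HasWeakFDerivOn unitDisc f Df) :
    AEStronglyMeasurable f (volume.restrict unitDisc) :=
  hf.locallyIntegrableOn.aestronglyMeasurable

lemma HasWeakFDerivOn.aestronglyMeasurable_weight {f : ℂ → ℝ} {Df : ℂ → (ℂ →L[ℝ] ℝ)}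
    (hf : HasWeakFDerivOn unitDisc f Df) (h : ℂ → ℝ) :
    AEStronglyMeasurable f (weightMeasure h) :=
  hf.aestronglyMeasurable.mono_ac (weightMeasure_absolutelyContinuous h)

theorem IsRegularWeight.exists_poincare_average {h : ℂ → ℝ} (hh : IsRegularWeight h) {r : ℝ≥0∞}
    (hr : 2 ≤ r) (hr' : r ≠ ⊤) : ∃ C : ℝ≥0∞, C < ⊤ ∧ ∀ (f : ℂ → ℝ) (Df : ℂ → (ℂ →L[ℝ] ℝ)),
      HasWeakFDerivOn unitDisc f Df → MemLp Df 2 (volume.restrict unitDisc) →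
      eLpNorm (fun z => f z - ⨍ w, f w ∂(weightMeasure h)) r (weightMeasure h) ≤
        C * eLpNorm Df 2 (volume.restrict unitDisc) := by
  have := hh.isFiniteMeasure
  have hr2 : 2 ≤ r.toReal := by simpa using ENNReal.toReal_mono hr' hr
  obtain ⟨C, hC, hCb⟩ := hh.exists_poincare (p := r.toReal / 2) (by linarith)
  rw [mul_div_cancel₀ _ two_ne_zero, ENNReal.ofReal_toReal hr'] at hCb
  refine ⟨2 * C, ENNReal.mul_lt_top (by norm_num) hC, fun f Df hf hD => ?_⟩
  obtain ⟨c, hc⟩ := hCb f Df hf hD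
  refine (eLpNorm_sub_average_le (hf.aestronglyMeasurable_weight h)
    (one_le_two.trans hr) c).trans ?_
  rw [mul_assoc]
  exact mul_le_mul_right hc _

lemma IsRegularWeight.memLp {h : ℂ → ℝ} (hh : IsRegularWeight h) {r : ℝ≥0∞}
    (hr : 2 ≤ r) (hr' : r ≠ ⊤) {f : ℂ → ℝ} {Df : ℂ → (ℂ →L[ℝ] ℝ)}
    (hf : HasWeakFDerivOn unitDisc f Df) (hD : MemLp Df 2 (volume.restrict unitDisc)) :
    MemLp f r (weightMeasure h) := by
  have := hh.isFiniteMeasure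
  obtain ⟨C, hC, hCb⟩ := hh.exists_poincare_average hr hr'
  have h1 : MemLp (fun z => f z - ⨍ w, f w ∂(weightMeasure h)) r (weightMeasure h) :=
    ⟨(hf.aestronglyMeasurable_weight h).sub aestronglyMeasurable_const,
      (hCb f Df hf hD).trans_lt (ENNReal.mul_lt_top hC hD.eLpNorm_lt_top)⟩
  refine (h1.add (memLp_const (⨍ w, f w ∂(weightMeasure h)))).ae_eq (ae_of_all _ fun z => ?_)
  simp

/-- Weighted square integrability is automatic by Poincaré, so the Sobolev space is the same for all
regular weights. The comparison of two weights rests on this. -/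
lemma IsRegularWeight.memSobolev_iff {h : ℂ → ℝ} (hh : IsRegularWeight h) {f : ℂ → ℝ}
    {Df : ℂ → (ℂ →L[ℝ] ℝ)} : MemSobolev h f Df ↔
      HasWeakFDerivOn unitDisc f Df ∧ MemLp Df 2 (volume.restrict unitDisc) :=
  ⟨fun H => ⟨H.1, H.2.2⟩, fun H => ⟨H.1, hh.memLp le_rfl (by norm_num) H.1 H.2, H.2⟩⟩

theorem IsRegularWeight.poincareSobolevConst_lt_top {h : ℂ → ℝ} (hh : IsRegularWeight h)
    {r : ℝ≥0∞} (hr : 2 ≤ r) (hr' : r ≠ ⊤) : poincareSobolevConst r h < ⊤ := by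
  obtain ⟨C, hC, hCb⟩ := hh.exists_poincare_average hr hr'
  have hmem : C ∈ {C : ℝ≥0∞ | ∀ (f : ℂ → ℝ) (Df : ℂ → (ℂ →L[ℝ] ℝ)), MemSobolev h f Df →
      eLpNorm (fun z => f z - ⨍ w, f w ∂(weightMeasure h)) r (weightMeasure h) ≤
        C * eLpNorm Df 2 (volume.restrict unitDisc)} := fun f Df H => hCb f Df H.1 H.2.2
  exact (sInf_le hmem).trans_lt hC

/-- The best constant is admissible in the Poincaré–Sobolev inequality. -/
theorem IsRegularWeight.eLpNorm_sub_average_le {h : ℂ → ℝ} (hh : IsRegularWeight h)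
    {r : ℝ≥0∞} (hr : 2 ≤ r) (hr' : r ≠ ⊤) {f : ℂ → ℝ} {Df : ℂ → (ℂ →L[ℝ] ℝ)}
    (hf : HasWeakFDerivOn unitDisc f Df) (hD : MemLp Df 2 (volume.restrict unitDisc)) :
    eLpNorm (fun z => f z - ⨍ w, f w ∂(weightMeasure h)) r (weightMeasure h) ≤
      poincareSobolevConst r h * eLpNorm Df 2 (volume.restrict unitDisc) := by
  obtain ⟨C, hC, hCb⟩ := hh.exists_poincare_average hr hr'
  have hlt := (hh.poincareSobolevConst_lt_top hr hr').ne
  refine ENNReal.le_of_forall_pos_le_add fun ε hε _ => ?_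
  set A := eLpNorm Df 2 (volume.restrict unitDisc)
  have hA : A ≠ ⊤ := hD.eLpNorm_lt_top.ne
  -- Dividing by `A + 1` rather than `A` covers a vanishing gradient norm.
  have hε' : (ε : ℝ≥0∞) / (A + 1) ≠ 0 := by
    simp [hε.ne', ENNReal.div_eq_zero_iff, hA]
  obtain ⟨B, hB, hB'⟩ := sInf_lt_iff.1 (ENNReal.lt_add_right hlt hε')
  refine (hB f Df (hh.memSobolev_iff.2 ⟨hf, hD⟩)).trans ?_
  calc B * A ≤ (poincareSobolevConst r h + ε / (A + 1)) * A := mul_le_mul_left hB'.le _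
    _ = poincareSobolevConst r h * A + ε / (A + 1) * A := add_mul _ _ _
    _ ≤ _ := by
        gcongr
        calc (ε : ℝ≥0∞) / (A + 1) * A ≤ ε / (A + 1) * (A + 1) := by gcongr; exact le_self_add
          _ = ε := ENNReal.div_mul_cancel (by simp) (by simp [hA])

/-! ### Approximation by step functions -/

/-- **Rellich-type approximation**: up to a small multiple of the gradient norm, every Sobolev
function is a step function on a fixed finite partition. -/
theorem IsRegularWeight.exists_step_approx {h : ℂ → ℝ} (hh : IsRegularWeight h) {ε : ℝ≥0∞}
    (hε : ε ≠ 0) : ∃ (N : ℕ) (A : Fin N → Set ℂ), (∀ j, MeasurableSet (A j)) ∧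
      ∀ (f : ℂ → ℝ) (Df : ℂ → (ℂ →L[ℝ] ℝ)), HasWeakFDerivOn unitDisc f Df →
        MemLp Df 2 (volume.restrict unitDisc) → ∃ c : Fin N → ℝ,
          eLpNorm (fun z => f z - ∑ j, (A j).indicator (fun _ => c j) z) 2 (weightMeasure h) ≤
            ε * eLpNorm Df 2 (volume.restrict unitDisc) := by
  obtain ⟨K, hK, hKlim, hKb⟩ := hh.exists_rieszPotential_bound le_rfl
  have hε2 : 0 < ε ^ (2 : ℝ) := by
    rw [ENNReal.rpow_two]
    exact pos_iff_ne_zero.2 (pow_ne_zero 2 hε)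
  have hlt1 : ∀ᶠ R : ℝ in 𝓝[>] 0, R ≤ 2 :=
    (eventually_le_nhds (by norm_num)).filter_mono nhdsWithin_le_nhds
  -- `K R < ε²` gives the accuracy, and `R ≤ 2` permits discs of radius `δ = R / 2 ≤ 1` in the
  -- oscillation estimate.
  obtain ⟨R, ⟨hKR, hR2⟩, hR0⟩ := (((hKlim.eventually_lt_const hε2).and hlt1).and
    self_mem_nhdsWithin).exists
  have hR0 : 0 < R := hR0
  have htb : TotallyBounded unitDisc :=
    (isCompact_closedBall (0 : ℂ) 1).totallyBounded.subset Metric.ball_subset_closedBall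
  obtain ⟨t, htD, htf, htc⟩ := Metric.finite_approx_of_totallyBounded htb (R / 2) (by linarith)
  obtain ⟨N, x, hx⟩ : ∃ (N : ℕ) (x : Fin N → ℂ), range x = t :=
    ⟨_, _, htf.toFinset.equivFin.symm.surjective.range_comp (Subtype.val) |>.trans (by simp)⟩
  -- Each disc minus the earlier ones: a point of the unit disc lies only in the piece of the first
  -- disc containing it. The pieces do not depend on `f`.
  refine ⟨N, fun j => Metric.ball (x j) (R / 2) \ ⋃ i : {i // i < j}, Metric.ball (x i) (R / 2),
    fun j => measurableSet_ball.diff (MeasurableSet.iUnion fun i => measurableSet_ball), ?_⟩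
  intro f Df hf hD
  obtain ⟨g, hgm, hgi, hg, hg2⟩ := exists_measurable_enorm hD
  have hxD : ∀ j, x j ∈ unitDisc := fun j => htD (hx ▸ mem_range_self j)
  choose c hc using fun j => hf.exists_const_enorm_sub_le hgm hgi hg (hxD j) (half_pos hR0)
    (by linarith)
  refine ⟨c, ?_⟩
  have hae : ∀ᵐ z ∂(weightMeasure h), ‖f z - ∑ j, (Metric.ball (x j) (R / 2) \
      ⋃ i : {i // i < j}, Metric.ball (x i) (R / 2)).indicator (fun _ => c j) z‖ₑ ≤
      16 * rieszPotential R g z := by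
    refine ae_weightMeasure_of_ae h ?_
    filter_upwards [ae_all_iff.2 hc] with z hz hzD
    have hex : ∃ j, z ∈ Metric.ball (x j) (R / 2) := by
      have := htc hzD
      rw [← hx] at this
      simpa using this
    obtain ⟨j, hj, hjmin⟩ : ∃ j, z ∈ Metric.ball (x j) (R / 2) ∧
        ∀ i, i < j → z ∉ Metric.ball (x i) (R / 2) := by
      obtain ⟨j, hj, hm⟩ := WellFounded.has_min wellFounded_lt
        {j | z ∈ Metric.ball (x j) (R / 2)} hex
      exact ⟨j, hj, fun i hi hz => hm i hz hi⟩
    rw [Finset.sum_eq_single j]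
    · rw [indicator_of_mem]
      · have := hz j ⟨hzD, hj⟩
        rwa [mul_div_cancel₀ _ two_ne_zero] at this
      · refine ⟨hj, ?_⟩
        simpa using fun i hi => hjmin i hi
    · intro i _ hij
      refine indicator_of_notMem ?_ _
      rintro ⟨hi, hi'⟩
      rcases lt_or_gt_of_ne hij with h1 | h1
      · exact hjmin i h1 hi
      · exact hi' (mem_iUnion.2 ⟨⟨j, h1⟩, hj⟩)
    · simp
  rw [eLpNorm_eq_lintegral_rpow_enorm_toReal two_ne_zero (by norm_num)]
  simp only [ENNReal.toReal_ofNat]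
  have h2 := hKb R g hgm
  simp only [mul_one, ENNReal.rpow_one] at h2
  calc _ ≤ (K R * ∫⁻ z, g z ^ (2 : ℝ)) ^ (1 / (2 : ℝ)) := by
        refine ENNReal.rpow_le_rpow (le_trans (lintegral_mono_ae ?_) h2) (by positivity)
        filter_upwards [hae] with z hz
        exact ENNReal.rpow_le_rpow hz (by positivity)
    _ ≤ (ε ^ (2 : ℝ) * eLpNorm Df 2 (volume.restrict unitDisc) ^ (2 : ℝ)) ^ (1 / (2 : ℝ)) := by
        rw [hg2]
        gcongr
    _ = _ := by
        rw [← ENNReal.mul_rpow_of_nonneg _ _ (by norm_num), ← ENNReal.rpow_mul]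
        norm_num

/-! ### Algebra of weak derivatives -/

lemma LocallyIntegrableOn.integrableOn_smul_of_tsupport {F : Type*} [NormedAddCommGroup F]
    [NormedSpace ℝ F] {f : ℂ → F} {U : Set ℂ} (hf : LocallyIntegrableOn f U volume) {ζ : ℂ → ℝ}
    (hζ : Continuous ζ) (hc : HasCompactSupport ζ) (hU : tsupport ζ ⊆ U) :
    IntegrableOn (fun z => ζ z • f z) U volume := by
  have h1 : IntegrableOn f (tsupport ζ) volume := hf.integrableOn_compact_subset hU hc
  have h2 : IntegrableOn (fun z => ζ z • f z) (tsupport ζ) volume :=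
    h1.continuousOn_smul hζ.continuousOn hc
  refine ((integrableOn_iff_integrable_of_support_subset ?_).1 h2).integrableOn
  exact (Function.support_smul_subset_left ζ f).trans (subset_tsupport ζ)

lemma continuous_fderiv_apply {η : ℂ → ℝ} (hη : ContDiff ℝ (⊤ : ℕ∞) η) (v : ℂ) :
    Continuous fun z => fderiv ℝ η z v :=
  (hη.continuous_fderiv (by simp)).clm_apply continuous_const

lemma tsupport_fderiv_apply_subset_tsupport (η : ℂ → ℝ) (v : ℂ) :
    tsupport (fun z => fderiv ℝ η z v) ⊆ tsupport η :=
  closure_minimal (fun z hz => tsupport_fderiv_subset ℝ (subset_tsupport _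
    fun h => hz (by simp [h]))) (isClosed_tsupport _)

lemma hasCompactSupport_fderiv_apply {η : ℂ → ℝ} (hη : HasCompactSupport η) (v : ℂ) :
    HasCompactSupport fun z => fderiv ℝ η z v :=
  hη.mono' ((subset_tsupport _).trans (tsupport_fderiv_apply_subset_tsupport η v))

lemma LocallyIntegrableOn.clm_comp {F G : Type*} [NormedAddCommGroup F] [NormedSpace ℝ F]
    [NormedAddCommGroup G] [NormedSpace ℝ G] {f : ℂ → F} {U : Set ℂ}
    (hf : LocallyIntegrableOn f U volume) (L : F →L[ℝ] G) :
    LocallyIntegrableOn (fun z => L (f z)) U volume := fun x hx => by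
  obtain ⟨t, ht, hft⟩ := hf x hx
  exact ⟨t, ht, L.integrable_comp hft⟩

section Algebra

variable {F : Type*} [NormedAddCommGroup F] [NormedSpace ℝ F] {f g : ℂ → F} {D E : ℂ → (ℂ →L[ℝ] F)}

lemma HasWeakFDerivOn.integrableOn_fderiv_smul {U : Set ℂ} (hf : HasWeakFDerivOn U f D)
    {η : ℂ → ℝ} (hη : ContDiff ℝ (⊤ : ℕ∞) η) (hc : HasCompactSupport η) (hU : tsupport η ⊆ U)
    (v : ℂ) : IntegrableOn (fun z => (fderiv ℝ η z v) • f z) U volume :=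
  LocallyIntegrableOn.integrableOn_smul_of_tsupport hf.locallyIntegrableOn
    (continuous_fderiv_apply hη v) (hasCompactSupport_fderiv_apply hc v)
    ((tsupport_fderiv_apply_subset_tsupport η v).trans hU)

lemma HasWeakFDerivOn.integrableOn_smul_deriv {U : Set ℂ} (hf : HasWeakFDerivOn U f D)
    {η : ℂ → ℝ} (hη : ContDiff ℝ (⊤ : ℕ∞) η) (hc : HasCompactSupport η) (hU : tsupport η ⊆ U)
    (v : ℂ) : IntegrableOn (fun z => η z • D z v) U volume :=
  LocallyIntegrableOn.integrableOn_smul_of_tsupport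
    (LocallyIntegrableOn.clm_comp hf.locallyIntegrableOn_deriv (ContinuousLinearMap.apply ℝ F v))
    hη.continuous hc hU

lemma HasWeakFDerivOn.add {U : Set ℂ} (hf : HasWeakFDerivOn U f D) (hg : HasWeakFDerivOn U g E) :
    HasWeakFDerivOn U (fun z => f z + g z) (fun z => D z + E z) where
  locallyIntegrableOn := hf.locallyIntegrableOn.add hg.locallyIntegrableOn
  locallyIntegrableOn_deriv := fun x hx => by
    obtain ⟨t, ht, hft⟩ := hf.locallyIntegrableOn_deriv x hx
    obtain ⟨s, hs, hgs⟩ := hg.locallyIntegrableOn_deriv x hx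
    exact ⟨t ∩ s, inter_mem ht hs, Integrable.add (ε' := ℂ →L[ℝ] F)
      (hft.mono_set inter_subset_left) (hgs.mono_set inter_subset_right)⟩
  integral_eq η hη hc hU v := by
    simp only [smul_add, add_apply]
    rw [integral_add (hf.integrableOn_fderiv_smul hη hc hU v)
      (hg.integrableOn_fderiv_smul hη hc hU v), integral_add
      (hf.integrableOn_smul_deriv hη hc hU v) (hg.integrableOn_smul_deriv hη hc hU v),
      hf.integral_eq η hη hc hU v, hg.integral_eq η hη hc hU v, neg_add]

lemma HasWeakFDerivOn.const_smul {U : Set ℂ} (hf : HasWeakFDerivOn U f D) (c : ℝ) :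
    HasWeakFDerivOn U (fun z => c • f z) (fun z => c • D z) where
  locallyIntegrableOn := hf.locallyIntegrableOn.smul c
  locallyIntegrableOn_deriv := hf.locallyIntegrableOn_deriv.smul c
  integral_eq η hη hc hU v := by
    simp only [smul_apply, smul_comm _ c]
    rw [integral_smul, integral_smul, hf.integral_eq η hη hc hU v, smul_neg]

lemma HasWeakFDerivOn.sub {U : Set ℂ} (hf : HasWeakFDerivOn U f D) (hg : HasWeakFDerivOn U g E) :
    HasWeakFDerivOn U (fun z => f z - g z) (fun z => D z - E z) := by
  simpa [sub_eq_add_neg] using hf.add (hg.const_smul (-1))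

lemma HasWeakFDerivOn.congr {U : Set ℂ} (hf : HasWeakFDerivOn U f D)
    (hfg : f =ᵐ[volume.restrict U] g) (hDE : D =ᵐ[volume.restrict U] E) :
    HasWeakFDerivOn U g E where
  locallyIntegrableOn := hf.locallyIntegrableOn.congr hfg
  locallyIntegrableOn_deriv := hf.locallyIntegrableOn_deriv.congr hDE
  integral_eq η hη hc hU v := by
    have h1 : ∫ z in U, (fderiv ℝ η z v) • f z = ∫ z in U, (fderiv ℝ η z v) • g z :=
      integral_congr_ae (hfg.mono fun z hz => by simp only [hz])
    have h2 : ∫ z in U, η z • D z v = ∫ z in U, η z • E z v :=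
      integral_congr_ae (hDE.mono fun z hz => by simp only [hz])
    rw [← h1, ← h2, hf.integral_eq η hη hc hU v]

lemma HasWeakFDerivOn.clm_comp {U : Set ℂ} [CompleteSpace F] (hf : HasWeakFDerivOn U f D)
    (L : F →L[ℝ] ℝ) : HasWeakFDerivOn U (fun z => L (f z)) (fun z => L.comp (D z)) where
  locallyIntegrableOn := LocallyIntegrableOn.clm_comp hf.locallyIntegrableOn L
  locallyIntegrableOn_deriv := LocallyIntegrableOn.clm_comp hf.locallyIntegrableOn_deriv
    (ContinuousLinearMap.compL ℝ ℂ F ℝ L)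
  integral_eq η hη hc hU v := by
    have h1 := L.integral_comp_comm (hf.integrableOn_fderiv_smul hη hc hU v)
    have h2 := L.integral_comp_comm (hf.integrableOn_smul_deriv hη hc hU v)
    simp only [map_smul] at h1 h2
    simp only [ContinuousLinearMap.comp_apply]
    rw [h1, h2, hf.integral_eq η hη hc hU v, map_neg]

lemma hasWeakFDerivOn_of_contDiff (U : Set ℂ) {f : ℂ → ℝ} (hf : ContDiff ℝ 1 f) :
    HasWeakFDerivOn U f (fderiv ℝ f) where
  locallyIntegrableOn := hf.continuous.locallyIntegrable.locallyIntegrableOn U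
  locallyIntegrableOn_deriv :=
    (hf.continuous_fderiv one_ne_zero).locallyIntegrable.locallyIntegrableOn U
  integral_eq η hη hc hηU v := by
    have hfd : Continuous fun z => fderiv ℝ f z v :=
      (hf.continuous_fderiv one_ne_zero).clm_apply continuous_const
    have h1 := integral_mul_fderiv_eq_neg_fderiv_mul_of_integrable (μ := volume) (f := η) (g := f)
      (v := v)
      (((continuous_fderiv_apply hη v).mul hf.continuous).integrable_of_hasCompactSupport
        (hasCompactSupport_fderiv_apply hc v).mul_right)
      ((hη.continuous.mul hfd).integrable_of_hasCompactSupport hc.mul_right)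
      ((hη.continuous.mul hf.continuous).integrable_of_hasCompactSupport hc.mul_right)
      (fun x _ => (hη.differentiable (by simp)) x) (fun x _ => (hf.differentiable one_ne_zero) x)
    have h2 : ∀ z ∉ U, (fderiv ℝ η z v) • f z = 0 := fun z hz => by
      have : (fun z => fderiv ℝ η z v) z = 0 := image_eq_zero_of_notMem_tsupport
        (f := fun z => fderiv ℝ η z v) fun h => hz (hηU (tsupport_fderiv_apply_subset_tsupport η v h))
      simp only at this
      simp [this]
    have h3 : ∀ z ∉ U, η z • fderiv ℝ f z v = 0 := fun z hz => by
      rw [image_eq_zero_of_notMem_tsupport fun h => hz (hηU h), zero_smul]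
    rw [setIntegral_eq_integral_of_forall_compl_eq_zero h2,
      setIntegral_eq_integral_of_forall_compl_eq_zero h3]
    simp only [smul_eq_mul]
    rw [h1, neg_neg]

end Algebra

/-- The weak derivative is unique. -/
lemma HasWeakFDerivOn.ae_unique {f f' : ℂ → ℝ} {D D' : ℂ → (ℂ →L[ℝ] ℝ)}
    (hf : HasWeakFDerivOn unitDisc f D) (hf' : HasWeakFDerivOn unitDisc f' D')
    (hff' : f =ᵐ[volume.restrict unitDisc] f') : D =ᵐ[volume.restrict unitDisc] D' := by
  have h0 := hf.sub hf'
  have key : ∀ v : ℂ, ∀ᵐ z : ℂ, z ∈ unitDisc → (D z - D' z) v = 0 := by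
    intro v
    refine isOpen_unitDisc.ae_eq_zero_of_integral_contDiff_smul_eq_zero
      (LocallyIntegrableOn.clm_comp h0.locallyIntegrableOn_deriv
        (ContinuousLinearMap.apply ℝ ℝ v)) fun η hη hc hU => ?_
    have h1 := h0.integral_eq η hη hc hU v
    have h2 : ∫ z in unitDisc, (fderiv ℝ η z v) • (f z - f' z) = 0 := by
      rw [integral_congr_ae (g := fun _ => (0 : ℝ))]
      · simp
      · filter_upwards [hff'] with z hz
        simp [hz]
    rw [h2, eq_comm, neg_eq_zero] at h1
    rw [← h1, eq_comm]
    refine setIntegral_eq_integral_of_forall_compl_eq_zero fun z hz => ?_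
    rw [image_eq_zero_of_notMem_tsupport fun h => hz (hU h), zero_smul]
  rw [EventuallyEq, ae_restrict_iff' measurableSet_unitDisc]
  filter_upwards [key 1, key Complex.I] with z h1 hI hz
  refine sub_eq_zero.1 (ContinuousLinearMap.ext fun v => ?_)
  have hv : v = v.re • (1 : ℂ) + v.im • Complex.I := by
    simp [Complex.re_add_im]
  rw [hv, map_add, map_smul, map_smul, h1 hz, hI hz]
  simp

/-- A function on the disc with vanishing weak derivative is constant. -/
lemma HasWeakFDerivOn.ae_const {f : ℂ → ℝ} {D : ℂ → (ℂ →L[ℝ] ℝ)}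
    (hf : HasWeakFDerivOn unitDisc f D) (hD : D =ᵐ[volume.restrict unitDisc] 0) :
    ∃ c : ℝ, ∀ᵐ z : ℂ, z ∈ unitDisc → f z = c := by
  obtain ⟨c, hc⟩ := hf.exists_const_enorm_sub_le (g := fun _ => 0) measurable_const (by simp)
    (hD.mono fun z hz => by rw [hz, ← ofReal_norm]; simp) (x₀ := 0) (by simp [unitDisc]) one_pos le_rfl
  refine ⟨c, hc.mono fun z hz hzD => ?_⟩
  have := hz ⟨hzD, hzD⟩
  simpa [rieszPotential, sub_eq_zero] using this

/-- A quasiconformal weight does not vanish almost everywhere. -/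
lemma IsQuasiconformalWeight.weightMeasure_ne_zero {h : ℂ → ℝ} (hh : IsQuasiconformalWeight h) :
    weightMeasure h ≠ 0 := by
  obtain ⟨ψ, D, hs, ⟨hw, -, K, -, hK⟩, hhD⟩ := hh
  rw [hs] at hw hK
  intro h0
  have hmeas : AEMeasurable (fun z => ENNReal.ofReal (h z)) (volume.restrict unitDisc) := by
    by_contra hc
    have hJ : AEStronglyMeasurable (fun z => |(D z).det|) (volume.restrict unitDisc) :=
      (continuous_abs.comp ContinuousLinearMap.continuous_det).comp_aestronglyMeasurable
        hw.locallyIntegrableOn_deriv.aestronglyMeasurable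
    exact hc (hJ.congr (hhD.mono fun z hz => hz.symm)).aemeasurable.ennreal_ofReal
  rw [weightMeasure, withDensity_eq_zero_iff hmeas] at h0
  -- A vanishing Jacobian and the distortion inequality kill the whole derivative; then `ψ` is
  -- almost everywhere constant, whereas an injective map takes a value at most once.
  have hD : D =ᵐ[volume.restrict unitDisc] 0 := by
    filter_upwards [h0, hhD, hK] with z h1 h2 h3
    have h4 : h z ≤ 0 := by simpa using h1
    have h5 : |(D z).det| = 0 := le_antisymm (h2 ▸ h4) (abs_nonneg _)
    rw [h5, mul_zero] at h3
    have : ‖D z‖ = 0 := by nlinarith [norm_nonneg (D z)]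
    simpa using this
  obtain ⟨a, ha⟩ := (hw.clm_comp Complex.reCLM).ae_const
    (hD.mono fun z hz => by simp only [hz]; simp)
  obtain ⟨b, hb⟩ := (hw.clm_comp Complex.imCLM).ae_const
    (hD.mono fun z hz => by simp only [hz]; simp)
  have hsub : ({z | z ∈ unitDisc ∧ ψ z = ⟨a, b⟩} : Set ℂ).Subsingleton := by
    intro z hz w hw
    exact ψ.injOn (hs ▸ hz.1) (hs ▸ hw.1) (hz.2.trans hw.2.symm)
  have hnull : volume unitDisc = 0 := by
    refine measure_mono_null_ae (t := {z | z ∈ unitDisc ∧ ψ z = ⟨a, b⟩}) ?_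
      (hsub.measure_zero volume)
    filter_upwards [ha, hb] with z h1 h2 hz
    exact ⟨hz, Complex.ext (h1 hz) (h2 hz)⟩
  exact (Metric.measure_ball_pos volume (0 : ℂ) one_pos).ne' hnull

/-! ### The Hilbert space of gradients -/

/-- Square integrable vector fields on the disc. -/
abbrev VectorFieldL2 := Lp ℂ 2 (volume.restrict unitDisc)

lemma hasWeakFDerivOn_const (c : ℝ) :
    HasWeakFDerivOn unitDisc (fun _ => c) (fun _ => (0 : ℂ →L[ℝ] ℝ)) := by
  have := hasWeakFDerivOn_of_contDiff unitDisc (f := fun _ => c) contDiff_const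
  exact this.congr (ae_eq_refl _) (ae_of_all _ fun z => by simp)

lemma HasWeakFDerivOn.sub_const {f : ℂ → ℝ} {D : ℂ → (ℂ →L[ℝ] ℝ)}
    (hf : HasWeakFDerivOn unitDisc f D) (c : ℝ) :
    HasWeakFDerivOn unitDisc (fun z => f z - c) D := by
  simpa using hf.sub (hasWeakFDerivOn_const c)

/-- The vector fields that are weak gradients of functions on the disc. -/
def gradientSpace : Submodule ℝ VectorFieldL2 where
  carrier := {F | ∃ f : ℂ → ℝ, HasWeakFDerivOn unitDisc f (fun z => innerSL ℝ (F z))}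
  zero_mem' := ⟨fun _ => 0, (hasWeakFDerivOn_const 0).congr (ae_eq_refl _) <| by
    filter_upwards [Lp.coeFn_zero ℂ 2 (volume.restrict unitDisc)] with z hz
    rw [hz]; simp⟩
  add_mem' := by
    rintro F G ⟨f, hf⟩ ⟨g, hg⟩
    refine ⟨_, (hf.add hg).congr (ae_eq_refl _) ?_⟩
    filter_upwards [Lp.coeFn_add F G] with z hz
    rw [hz, Pi.add_apply, map_add]
  smul_mem' := by
    rintro c F ⟨f, hf⟩
    refine ⟨_, (hf.const_smul c).congr (ae_eq_refl _) ?_⟩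
    filter_upwards [Lp.coeFn_smul c F] with z hz
    rw [hz, Pi.smul_apply, map_smul]

/-- A function with a given weak gradient. -/
def potential (F : gradientSpace) : ℂ → ℝ := F.2.choose

lemma potential_spec (F : gradientSpace) :
    HasWeakFDerivOn unitDisc (potential F) (fun z => innerSL ℝ ((F : VectorFieldL2) z)) :=
  F.2.choose_spec

lemma memLp_innerSL (F : VectorFieldL2) :
    MemLp (fun z => innerSL ℝ (F z)) 2 (volume.restrict unitDisc) :=
  (Lp.memLp F).of_le ((innerSL ℝ (E := ℂ)).continuous.comp_aestronglyMeasurable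
    (Lp.memLp F).aestronglyMeasurable) (ae_of_all _ fun z => by simp)

lemma eLpNorm_innerSL (F : VectorFieldL2) :
    eLpNorm (fun z => innerSL ℝ (F z)) 2 (volume.restrict unitDisc) = ENNReal.ofReal ‖F‖ := by
  rw [Lp.norm_def, ENNReal.ofReal_toReal (Lp.memLp F).eLpNorm_ne_top]
  exact eLpNorm_congr_norm_ae (ae_of_all _ fun z => by simp)

/-- The gradient of a Sobolev function as an element of the Hilbert space of gradients. -/
lemma exists_gradient {f : ℂ → ℝ} {D : ℂ → (ℂ →L[ℝ] ℝ)} (hf : HasWeakFDerivOn unitDisc f D)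
    (hD : MemLp D 2 (volume.restrict unitDisc)) :
    ∃ F : gradientSpace, D =ᵐ[volume.restrict unitDisc]
      fun z => innerSL ℝ ((F : VectorFieldL2) z) := by
  have hm : MemLp (fun z => (InnerProductSpace.toDual ℝ ℂ).symm (D z)) 2
      (volume.restrict unitDisc) :=
    hD.of_le ((InnerProductSpace.toDual ℝ ℂ).symm.continuous.comp_aestronglyMeasurable
      hD.aestronglyMeasurable) (ae_of_all _ fun z => by simp)
  have hae : D =ᵐ[volume.restrict unitDisc] fun z => innerSL ℝ (hm.toLp _ z) := by
    filter_upwards [hm.coeFn_toLp] with z hz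
    rw [hz]
    ext v
    simp [innerSL_apply_apply]
  exact ⟨⟨hm.toLp _, f, hf.congr (ae_eq_refl _) hae⟩, hae⟩

lemma dirichletForm_eq_inner {D E : ℂ → (ℂ →L[ℝ] ℝ)} {F G : VectorFieldL2}
    (hD : D =ᵐ[volume.restrict unitDisc] fun z => innerSL ℝ (F z))
    (hE : E =ᵐ[volume.restrict unitDisc] fun z => innerSL ℝ (G z)) :
    dirichletForm D E = inner ℝ F G := by
  rw [dirichletForm, L2.inner_def]
  refine integral_congr_ae ?_
  filter_upwards [hD, hE] with z h1 h2
  simp only [h1, h2, innerSL_apply_apply, Complex.inner]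
  simp
  ring

/-! ### Mean-zero primitives in the weighted `L²` space -/

section Weighted

variable {h : ℂ → ℝ}

lemma IsRegularWeight.integrable (hh : IsRegularWeight h) {f : ℂ → ℝ} {D : ℂ → (ℂ →L[ℝ] ℝ)}
    (hf : HasWeakFDerivOn unitDisc f D) (hD : MemLp D 2 (volume.restrict unitDisc)) :
    Integrable f (weightMeasure h) := by
  have := hh.isFiniteMeasure
  exact (hh.memLp le_rfl (by norm_num) hf hD).integrable one_le_two

/-- Functions with equal gradients differ by a constant, which the mean absorbs. Hence `primitive`
is linear and independent of the choice made in `potential`. -/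
lemma IsRegularWeight.sub_average_congr (hh : IsRegularWeight h) {f f' : ℂ → ℝ}
    {D D' : ℂ → (ℂ →L[ℝ] ℝ)} (hf : HasWeakFDerivOn unitDisc f D)
    (hf' : HasWeakFDerivOn unitDisc f' D') (hD : MemLp D' 2 (volume.restrict unitDisc))
    (hDD' : D =ᵐ[volume.restrict unitDisc] D') :
    (fun z => f z - ⨍ w, f w ∂(weightMeasure h)) =ᵐ[weightMeasure h]
      fun z => f' z - ⨍ w, f' w ∂(weightMeasure h) := by
  have := hh.isFiniteMeasure
  obtain ⟨c, hc⟩ := (hf.sub hf').ae_const (hDD'.mono fun z hz => by simp [hz])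
  have hae : ∀ᵐ z ∂(weightMeasure h), f z - f' z = c := ae_weightMeasure_of_ae h hc
  rcases eq_or_ne (weightMeasure h) 0 with h0 | h0
  · rw [h0]; exact Filter.EventuallyEq.of_eq rfl |>.trans (by simp [EventuallyEq])
  have hr : (weightMeasure h).real univ ≠ 0 := by
    simp [Measure.real, ENNReal.toReal_eq_zero_iff, h0]
  have havg : ⨍ w, f w ∂(weightMeasure h) = (⨍ w, f' w ∂(weightMeasure h)) + c := by
    have h1 : ∫ w, f w ∂(weightMeasure h) = ∫ w, (f' w + c) ∂(weightMeasure h) :=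
      integral_congr_ae (hae.mono fun z hz => by simp only; linarith)
    rw [average_eq, average_eq, h1, integral_add (hh.integrable hf' hD) (integrable_const c),
      integral_const]
    simp only [smul_eq_mul]
    field_simp
  filter_upwards [hae] with z hz
  rw [havg]
  linarith

lemma IsRegularWeight.integral_sub_average (hh : IsRegularWeight h) (f : ℂ → ℝ) :
    ∫ z, (f z - ⨍ w, f w ∂(weightMeasure h)) ∂(weightMeasure h) = 0 := by
  have := hh.isFiniteMeasure
  exact _root_.MeasureTheory.integral_sub_average _ _

lemma IsRegularWeight.memLp_sub_average (hh : IsRegularWeight h) {f : ℂ → ℝ}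
    {D : ℂ → (ℂ →L[ℝ] ℝ)} (hf : HasWeakFDerivOn unitDisc f D)
    (hD : MemLp D 2 (volume.restrict unitDisc)) :
    MemLp (fun z => f z - ⨍ w, f w ∂(weightMeasure h)) 2 (weightMeasure h) :=
  hh.memLp le_rfl (by norm_num) (hf.sub_const _) hD

/-- The operator taking a gradient to the function with this gradient and weighted mean zero, as an
element of the weighted `L²` space. -/
def IsRegularWeight.primitive (hh : IsRegularWeight h) :
    gradientSpace →L[ℝ] Lp ℝ 2 (weightMeasure h) :=
  LinearMap.mkContinuous
    { toFun := fun F => (hh.memLp_sub_average (potential_spec F) (memLp_innerSL F)).toLp _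
      map_add' := fun F G => by
        rw [← MemLp.toLp_add, MemLp.toLp_eq_toLp_iff]
        refine (hh.sub_average_congr ((potential_spec F).add (potential_spec G))
          (potential_spec (F + G)) (memLp_innerSL _) ?_).symm.trans
          (Eventually.of_forall fun z => ?_)
        · filter_upwards [Lp.coeFn_add (F : VectorFieldL2) G] with z hz
          rw [Submodule.coe_add, hz, Pi.add_apply, map_add]
        · simp only [Pi.add_apply]
          have : ⨍ w, (potential F w + potential G w) ∂(weightMeasure h) =
              (⨍ w, potential F w ∂(weightMeasure h)) + ⨍ w, potential G w ∂(weightMeasure h) := by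
            rw [average_eq, average_eq, average_eq,
              integral_add (hh.integrable (potential_spec F) (memLp_innerSL F))
                (hh.integrable (potential_spec G) (memLp_innerSL G)), smul_add]
          rw [this]
          ring
      map_smul' := fun c F => by
        rw [RingHom.id_apply, ← MemLp.toLp_const_smul, MemLp.toLp_eq_toLp_iff]
        refine (hh.sub_average_congr ((potential_spec F).const_smul c)
          (potential_spec (c • F)) (memLp_innerSL _) ?_).symm.trans
          (Eventually.of_forall fun z => ?_)
        · filter_upwards [Lp.coeFn_smul c (F : VectorFieldL2)] with z hz
          rw [Submodule.coe_smul, hz, Pi.smul_apply, map_smul]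
        · simp only [Pi.smul_apply, smul_eq_mul]
          have : ⨍ w, (c * potential F w) ∂(weightMeasure h) =
              c * ⨍ w, potential F w ∂(weightMeasure h) := by
            rw [average_eq, average_eq, integral_const_mul, smul_eq_mul, smul_eq_mul]
            ring
          rw [this]
          ring }
    (poincareSobolevConst 2 h).toReal fun F => by
      have h1 := hh.eLpNorm_sub_average_le le_rfl (by norm_num) (potential_spec F)
        (memLp_innerSL F)
      have hlt := (hh.poincareSobolevConst_lt_top le_rfl (by norm_num : (2 : ℝ≥0∞) ≠ ⊤)).ne
      rw [eLpNorm_innerSL] at h1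
      have h2 := ENNReal.toReal_mono (ENNReal.mul_ne_top hlt ENNReal.ofReal_ne_top) h1
      rw [ENNReal.toReal_mul, ENNReal.toReal_ofReal (norm_nonneg _)] at h2
      simpa [Lp.norm_toLp] using h2

lemma IsRegularWeight.primitive_ae_eq (hh : IsRegularWeight h) {f : ℂ → ℝ}
    {D : ℂ → (ℂ →L[ℝ] ℝ)} (hf : HasWeakFDerivOn unitDisc f D) {F : gradientSpace}
    (hDF : D =ᵐ[volume.restrict unitDisc] fun z => innerSL ℝ ((F : VectorFieldL2) z)) :
    hh.primitive F =ᵐ[weightMeasure h] fun z => f z - ⨍ w, f w ∂(weightMeasure h) := by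
  refine (MemLp.coeFn_toLp (hh.memLp_sub_average (potential_spec F) (memLp_innerSL _))).trans ?_
  exact (hh.sub_average_congr hf (potential_spec F) (memLp_innerSL _) hDF).symm

/-! ### Completeness of the space of gradients -/

lemma isRegularWeight_one : IsRegularWeight fun _ => 1 :=
  ⟨2, by norm_num, memLp_const 1⟩

lemma weightMeasure_one : weightMeasure (fun _ => 1) = volume.restrict unitDisc := by
  simp [weightMeasure]

/-- By the unweighted Poincaré inequality, mean-zero primitives of a convergent sequence of
gradients converge in `L²`. For a given test function both sides of the integration by parts are
inner products with fixed `L²` elements, so the identity survives the limit. -/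
lemma isClosed_gradientSpace : IsClosed (gradientSpace : Set VectorFieldL2) := by
  refine IsSeqClosed.isClosed fun F F₀ hF hlim => ?_
  let G : ℕ → gradientSpace := fun n => ⟨F n, hF n⟩
  have hG : CauchySeq G := by
    rw [Metric.cauchySeq_iff]
    have := Metric.cauchySeq_iff.1 hlim.cauchySeq
    exact this
  obtain ⟨u, hu⟩ := cauchySeq_tendsto_of_complete
    (isRegularWeight_one.primitive.uniformContinuous.comp_cauchySeq hG)
  have hmeas := weightMeasure_one
  have huL : MemLp u 2 (volume.restrict unitDisc) := hmeas ▸ Lp.memLp u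
  have hweak : ∀ n, HasWeakFDerivOn unitDisc (isRegularWeight_one.primitive (G n))
      (fun z => innerSL ℝ (F n z)) := fun n => by
    have := isRegularWeight_one.primitive_ae_eq (potential_spec (G n)) (ae_eq_refl _)
    exact ((potential_spec (G n)).sub_const _).congr
      ((Measure.absolutelyContinuous_of_le hmeas.ge).ae_le this.symm) (ae_eq_refl _)
  refine ⟨u, ?_, ?_, fun η hη hc hU v => ?_⟩
  · exact IntegrableOn.locallyIntegrableOn (huL.integrable one_le_two)
  · exact IntegrableOn.locallyIntegrableOn ((memLp_innerSL F₀).integrable one_le_two)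
  have hζ : MemLp (fun z => fderiv ℝ η z v) 2 (weightMeasure fun _ => 1) := by
    rw [hmeas]
    exact ((continuous_fderiv_apply hη v).memLp_of_hasCompactSupport
      (hasCompactSupport_fderiv_apply hc v)).restrict _
  have hηv : MemLp (fun z => η z • v) 2 (volume.restrict unitDisc) :=
    ((hη.continuous.smul continuous_const).memLp_of_hasCompactSupport hc.smul_right).restrict _
  have e1 : ∀ w : Lp ℝ 2 (weightMeasure fun _ => 1),
      inner ℝ (hζ.toLp _) w = ∫ z in unitDisc, (fderiv ℝ η z v) • w z := by
    intro w
    rw [L2.inner_def]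
    refine Eq.trans (integral_congr_ae (g := fun z => (fderiv ℝ η z v) • w z) ?_)
      (congrArg (fun ν : Measure ℂ => ∫ z, (fderiv ℝ η z v) • w z ∂ν) hmeas)
    filter_upwards [hζ.coeFn_toLp] with z hz
    rw [hz]
    simp [mul_comm]
  have e2 : ∀ w : VectorFieldL2,
      inner ℝ (hηv.toLp _) w = ∫ z in unitDisc, η z • innerSL ℝ (w z) v := by
    intro w
    rw [L2.inner_def]
    refine integral_congr_ae ?_
    filter_upwards [hηv.coeFn_toLp] with z hz
    rw [hz, innerSL_apply_apply, real_inner_smul_left, real_inner_comm, smul_eq_mul]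
  rw [← e1, ← e2]
  have l1 : Tendsto (fun n => inner ℝ (hζ.toLp _) (isRegularWeight_one.primitive (G n))) atTop
      (𝓝 (inner ℝ (hζ.toLp _) u)) := tendsto_const_nhds.inner hu
  have l2 : Tendsto (fun n => -inner ℝ (hηv.toLp _) (F n)) atTop
      (𝓝 (-inner ℝ (hηv.toLp _) F₀)) := (tendsto_const_nhds.inner hlim).neg
  refine tendsto_nhds_unique (l1.congr fun n => ?_) l2
  rw [e1, e2]
  exact (hweak n).integral_eq η hη hc hU v

instance completeSpace_gradientSpace : CompleteSpace gradientSpace :=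
  isClosed_gradientSpace.completeSpace_coe

/-! ### Compactness -/

/-- Closed balls of finite-dimensional subspaces are compact; a finite net of such a ball is, up to
the approximation error, a net of `s`. -/
lemma totallyBounded_of_finiteDimensional_approx {E : Type*} [NormedAddCommGroup E]
    [NormedSpace ℝ E] {s : Set E} {R : ℝ} (hs : ∀ x ∈ s, ‖x‖ ≤ R)
    (H : ∀ ε > 0, ∃ V : Submodule ℝ E, FiniteDimensional ℝ V ∧ ∀ x ∈ s, ∃ y ∈ V, ‖x - y‖ ≤ ε) :
    TotallyBounded s := by
  rw [Metric.totallyBounded_iff]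
  intro ε hε
  obtain ⟨V, hV, hVs⟩ := H (ε / 3) (by linarith)
  have hK : IsCompact ((Submodule.subtype V) '' Metric.closedBall 0 (R + ε)) :=
    (isCompact_closedBall (0 : V) (R + ε)).image V.subtypeL.continuous
  obtain ⟨t, ht, htc⟩ := Metric.totallyBounded_iff.1 hK.totallyBounded (ε / 3) (by linarith)
  refine ⟨t, ht, fun x hx => ?_⟩
  obtain ⟨y, hyV, hxy⟩ := hVs x hx
  have hy : y ∈ (Submodule.subtype V) '' Metric.closedBall 0 (R + ε) := by
    refine ⟨⟨y, hyV⟩, ?_, rfl⟩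
    rw [mem_closedBall_zero_iff]
    change ‖y‖ ≤ R + ε
    have : ‖y‖ ≤ ‖x‖ + ‖x - y‖ := by
      simpa using norm_sub_le x (x - y)
    linarith [hs x hx]
  obtain ⟨w, hw, hyw⟩ := mem_iUnion₂.1 (htc hy)
  refine mem_iUnion₂.2 ⟨w, hw, ?_⟩
  rw [Metric.mem_ball] at hyw ⊢
  rw [← dist_eq_norm] at hxy
  linarith [dist_triangle x y w]

/-- **Rellich-type theorem**: the weighted embedding is compact. -/
theorem IsRegularWeight.isCompactOperator_primitive (hh : IsRegularWeight h) :
    IsCompactOperator hh.primitive := by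
  have hfin := hh.isFiniteMeasure
  refine (isCompactOperator_iff_isCompact_closure_image_closedBall
    (hh.primitive : gradientSpace →ₗ[ℝ] Lp ℝ 2 (weightMeasure h)) one_pos).2 ?_
  refine isCompact_iff_totallyBounded_isComplete.2
    ⟨TotallyBounded.closure ?_, isClosed_closure.isComplete⟩
  refine totallyBounded_of_finiteDimensional_approx (R := ‖hh.primitive‖) ?_ fun ε hε => ?_
  · rintro _ ⟨F, hF, rfl⟩
    exact hh.primitive.unit_le_opNorm F (by simpa using hF)
  obtain ⟨N, A, hA, happ⟩ := hh.exists_step_approx (ε := ENNReal.ofReal ε) (by simpa using hε)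
  let b : Fin N → Lp ℝ 2 (weightMeasure h) := fun j =>
    indicatorConstLp 2 (hA j) (measure_ne_top _ _) (1 : ℝ)
  refine ⟨Submodule.span ℝ (range b), FiniteDimensional.span_of_finite ℝ (finite_range b), ?_⟩
  rintro _ ⟨F, hF, rfl⟩
  have hF1 : ‖F‖ ≤ 1 := by simpa using hF
  obtain ⟨c, hc⟩ := happ _ _ ((potential_spec F).sub_const
    (⨍ w, potential F w ∂(weightMeasure h))) (memLp_innerSL F)
  refine ⟨∑ j, c j • b j, Submodule.sum_mem _ fun j _ => Submodule.smul_mem _ _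
    (Submodule.subset_span (mem_range_self j)), ?_⟩
  have hb : ∀ᵐ z ∂(weightMeasure h), ∀ j, (c j • b j : Lp ℝ 2 (weightMeasure h)) z =
      (A j).indicator (fun _ => c j) z := by
    refine ae_all_iff.2 fun j => ?_
    filter_upwards [Lp.coeFn_smul (c j) (b j),
      indicatorConstLp_coeFn (p := 2) (hs := hA j) (hμs := measure_ne_top (weightMeasure h) _)
        (c := (1 : ℝ))] with z h1 h2
    rw [h1, Pi.smul_apply, h2]
    by_cases hz : z ∈ A j <;> simp [hz]
  have hsum : (∑ j, c j • b j : Lp ℝ 2 (weightMeasure h)) =ᵐ[weightMeasure h]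
      fun z => ∑ j, (A j).indicator (fun _ => c j) z := by
    refine (Lp.coeFn_finsetSum _ _).trans ?_
    filter_upwards [hb] with z hz
    simp [hz]
  rw [Lp.norm_def]
  have hle : eLpNorm (hh.primitive F - ∑ j, c j • b j : Lp ℝ 2 (weightMeasure h)) 2
      (weightMeasure h) ≤ ENNReal.ofReal ε := by
    calc _ = _ := eLpNorm_congr_ae (by
            filter_upwards [Lp.coeFn_sub (hh.primitive F) (∑ j, c j • b j), hsum,
              hh.primitive_ae_eq (potential_spec F) (ae_eq_refl _)] with z h1 h2 h3
            rw [h1, Pi.sub_apply, h2, h3])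
      _ ≤ _ := hc
      _ ≤ ENNReal.ofReal ε * 1 := by
          rw [eLpNorm_innerSL]
          gcongr
          exact ENNReal.ofReal_le_one.2 hF1
      _ = _ := mul_one _
  exact (ENNReal.toReal_mono ENNReal.ofReal_ne_top hle).trans_eq (ENNReal.toReal_ofReal hε.le)

end Weighted

/-! ### Spectral theory of a compact embedding -/

section Spectral

universe u

variable {H : Type u} {L : Type*} [NormedAddCommGroup H] [InnerProductSpace ℝ H]
  [NormedAddCommGroup L] [InnerProductSpace ℝ L]

/-- `F` solves the eigenvalue equation `⟨F, G⟩ = lam ⟨S F, S G⟩` for all `G`. -/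
def IsEigenpair (S : H →L[ℝ] L) (lam : ℝ) (F : H) : Prop :=
  ∀ G, inner ℝ F G = lam * inner ℝ (S F) (S G)

/-- A Hilbert basis that diagonalizes the quadratic form `‖S F‖²`, for compact `S`. -/
structure SpectralBasis (S : H →L[ℝ] L) (ι : Type*) where
  /-- the eigenvectors -/
  basis : HilbertBasis ι ℝ H
  /-- the squares of the singular values -/
  val : ι → ℝ
  inner_map : ∀ i G, inner ℝ (S (basis i)) (S G) = val i * inner ℝ (basis i) G

variable {S : H →L[ℝ] L} {ι : Type*} (B : SpectralBasis S ι)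

lemma SpectralBasis.val_eq (i : ι) : B.val i = ‖S (B.basis i)‖ ^ 2 := by
  have h := B.inner_map i (B.basis i)
  rw [real_inner_self_eq_norm_sq, real_inner_self_eq_norm_sq, B.basis.orthonormal.1] at h
  linarith

lemma SpectralBasis.val_nonneg (i : ι) : 0 ≤ B.val i := by
  rw [B.val_eq]; positivity

lemma SpectralBasis.hasSum_norm_sq (F : H) :
    HasSum (fun i => inner ℝ (B.basis i) F ^ 2) (‖F‖ ^ 2) := by
  have h := B.basis.hasSum_inner_mul_inner F F
  rw [real_inner_self_eq_norm_sq] at h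
  simpa only [real_inner_comm F, ← pow_two] using h

lemma SpectralBasis.eq_zero_of_coeff {F : H} (hc : ∀ i, inner ℝ (B.basis i) F = 0) : F = 0 := by
  have h := B.hasSum_norm_sq F
  simp only [hc, ne_eq, OfNat.ofNat_ne_zero, not_false_eq_true, zero_pow] at h
  simpa using h.unique hasSum_zero

/-- The vectors `S (basis i)` are orthogonal with squared norms `val i`; infinitely many with `κ ≤
val i` would be `√κ`-separated in a relatively compact set. -/
lemma SpectralBasis.finite_val (hS : IsCompactOperator S) {κ : ℝ} (hκ : 0 < κ) :
    {i | κ ≤ B.val i}.Finite := by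
  by_contra hinf
  let e := Set.Infinite.natEmbedding _ hinf
  have hc : IsCompact (closure (S '' Metric.closedBall 0 1)) :=
    (isCompactOperator_iff_isCompact_closure_image_closedBall
      (S : H →ₗ[ℝ] L) one_pos).1 hS
  have hmem : ∀ n, S (B.basis (e n)) ∈ closure (S '' Metric.closedBall 0 1) := fun n =>
    subset_closure (mem_image_of_mem _ (by simp [B.basis.orthonormal.1]))
  obtain ⟨a, -, φ, hφ, hlim⟩ := hc.tendsto_subseq hmem
  obtain ⟨N, hN⟩ := Metric.cauchySeq_iff.1 hlim.cauchySeq (Real.sqrt κ) (Real.sqrt_pos.2 hκ)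
  have h1 := hN N le_rfl (N + 1) (Nat.le_succ N)
  set i := (e (φ N) : ι)
  set j := (e (φ (N + 1)) : ι)
  have hij : i ≠ j := fun h => by
    have := e.injective (Subtype.ext h)
    exact (hφ (Nat.lt_succ_self N)).ne this
  have h2 : ‖S (B.basis i) - S (B.basis j)‖ ^ 2 = B.val i + B.val j := by
    rw [@norm_sub_sq_real, B.inner_map, B.basis.orthonormal.2 hij, B.val_eq, B.val_eq]
    ring
  rw [Function.comp_apply, Function.comp_apply, dist_eq_norm] at h1
  have h3 : ‖S (B.basis i) - S (B.basis j)‖ ^ 2 < κ := by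
    calc _ < Real.sqrt κ ^ 2 := pow_lt_pow_left₀ h1 (norm_nonneg _) two_ne_zero
      _ = κ := Real.sq_sqrt hκ.le
  have h4 : κ ≤ B.val i := (e (φ N)).2
  linarith [B.val_nonneg j]

lemma SpectralBasis.finite_level (hS : IsCompactOperator S) (t : ℝ) :
    {i | 1 ≤ t * B.val i}.Finite := by
  rcases le_or_gt t 0 with ht | ht
  · refine Set.finite_empty.subset fun i hi => ?_
    have h1 : 1 ≤ t * B.val i := hi
    nlinarith [B.val_nonneg i]
  · refine (B.finite_val hS (inv_pos.2 ht)).subset fun i hi => ?_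
    have h1 : 1 ≤ t * B.val i := hi
    exact (inv_le_iff_one_le_mul₀' ht).2 h1

/-- Testing with a basis vector: an eigenvector has components only where `val i` is the reciprocal
of its eigenvalue. -/
lemma IsEigenpair.coeff {lam : ℝ} {F : H} (hF : IsEigenpair S lam F) (i : ι)
    (hi : inner ℝ (B.basis i) F ≠ 0) : lam * B.val i = 1 := by
  have h := hF (B.basis i)
  rw [real_inner_comm, real_inner_comm (S (B.basis i)), B.inner_map] at h
  have h2 : (lam * B.val i - 1) * inner ℝ (B.basis i) F = 0 := by linarith
  rcases mul_eq_zero.1 h2 with h3 | h3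
  · linarith
  · exact absurd h3 hi

variable [CompleteSpace H] [CompleteSpace L]

/-- Spectral theorem for the compact self-adjoint operator `S* S`: orthonormal bases of all
eigenspaces, kernel included, are combined, and the sum of the eigenspaces has trivial orthogonal
complement. -/
lemma exists_spectralBasis (hS : IsCompactOperator S) :
    ∃ ι : Type u, Nonempty (SpectralBasis S ι) := by
  let T : H →L[ℝ] H := (ContinuousLinearMap.adjoint S).comp S
  have hT : IsCompactOperator T := hS.clm_comp (ContinuousLinearMap.adjoint S)
  have hTi : ∀ x y, inner ℝ (T x) y = inner ℝ (S x) (S y) := fun x y => by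
    simp [T, ContinuousLinearMap.adjoint_inner_left]
  have hsym : (T : H →ₗ[ℝ] H).IsSymmetric := fun x y => by
    change inner ℝ (T x) y = inner ℝ x (T y)
    rw [hTi, real_inner_comm, ← hTi, real_inner_comm]
  have hcomplete : ∀ μ : ℝ, CompleteSpace (Module.End.eigenspace (T : H →ₗ[ℝ] H) μ) := fun μ => by
    have : (Module.End.eigenspace (T : H →ₗ[ℝ] H) μ : Set H) = {x | T x = μ • x} := by
      ext x; simp
    have hc : IsClosed (Module.End.eigenspace (T : H →ₗ[ℝ] H) μ : Set H) := by
      rw [this]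
      exact isClosed_eq T.continuous (continuous_const_smul μ)
    exact hc.completeSpace_coe
  choose w b hb using fun μ : ℝ =>
    exists_hilbertBasis ℝ (Module.End.eigenspace (T : H →ₗ[ℝ] H) μ)
  let v : (Σ μ : ℝ, w μ) → H := fun a => ((b a.1 a.2 : Module.End.eigenspace (T : H →ₗ[ℝ] H) a.1) : H)
  have hv : Orthonormal ℝ v :=
    hsym.orthogonalFamily_eigenspaces.orthonormal_sigma_orthonormal fun μ => (b μ).orthonormal
  have hbot : (Submodule.span ℝ (range v))ᗮ = ⊥ := by
    rw [eq_bot_iff, ← ContinuousLinearMap.orthogonalComplement_iSup_eigenspaces_eq_bot hT hsym,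
      ← Submodule.iInf_orthogonal]
    refine le_iInf fun μ x hx => ?_
    rw [Submodule.mem_orthogonal]
    intro u hu
    have hsum := ((b μ).hasSum_repr ⟨u, hu⟩).mapL (Submodule.subtypeL _)
    have hsum2 := hsum.mapL (innerSL ℝ x)
    have h0 : ∀ i, (innerSL ℝ x) ((Submodule.subtypeL _) ((b μ).repr ⟨u, hu⟩ i • b μ i)) = 0 := by
      intro i
      have h1 : inner ℝ (v ⟨μ, i⟩) x = 0 :=
        (Submodule.mem_orthogonal _ _).1 hx _ (Submodule.subset_span (mem_range_self _))
      rw [real_inner_comm] at h1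
      rw [map_smul, map_smul, innerSL_apply_apply]
      change _ • inner ℝ x (v ⟨μ, i⟩) = (0 : ℝ)
      rw [h1, smul_zero]
    simp_rw [h0] at hsum2
    have h2 := hsum2.unique hasSum_zero
    rw [real_inner_comm]
    simpa using h2
  refine ⟨_, ⟨HilbertBasis.mkOfOrthogonalEqBot hv hbot, fun a => a.1, fun i G => ?_⟩⟩
  rw [HilbertBasis.coe_mkOfOrthogonalEqBot, ← hTi]
  have : T (v i) = i.1 • v i :=
    Module.End.mem_eigenspace_iff.1 (b i.1 i.2).2
  rw [this, real_inner_smul_left]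

lemma SpectralBasis.hasSum_map_norm_sq (F : H) :
    HasSum (fun i => B.val i * inner ℝ (B.basis i) F ^ 2) (‖S F‖ ^ 2) := by
  have h := B.basis.hasSum_inner_mul_inner (ContinuousLinearMap.adjoint S (S F)) F
  simp only [ContinuousLinearMap.adjoint_inner_left, real_inner_self_eq_norm_sq] at h
  have e : ∀ i, inner ℝ (S F) (S (B.basis i)) * inner ℝ (B.basis i) F =
      B.val i * (inner ℝ (B.basis i) F : ℝ) ^ 2 := fun i => by
    rw [real_inner_comm (S (B.basis i)), B.inner_map]
    ring
  simpa only [e] using h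

lemma SpectralBasis.norm_sq_le {t : ℝ} {F : H}
    (hF : ∀ i, ¬ 1 ≤ t * B.val i → inner ℝ (B.basis i) F = 0) : ‖F‖ ^ 2 ≤ t * ‖S F‖ ^ 2 := by
  refine hasSum_le (fun i => ?_) (B.hasSum_norm_sq F) ((B.hasSum_map_norm_sq F).mul_left t)
  by_cases hi : 1 ≤ t * B.val i
  · nlinarith [sq_nonneg (inner ℝ (B.basis i) F : ℝ)]
  · simp [hF i hi]

/-- The coordinates not assumed zero have `t * val i < 1`, so `‖F‖² - t ‖S F‖²` is a series of
nonnegative terms with nonpositive sum, and every term vanishes. -/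
lemma SpectralBasis.eq_zero {t : ℝ} {F : H} (hF : ‖F‖ ^ 2 ≤ t * ‖S F‖ ^ 2)
    (h0 : ∀ i, 1 ≤ t * B.val i → inner ℝ (B.basis i) F = 0) : F = 0 := by
  have hs := (B.hasSum_norm_sq F).sub ((B.hasSum_map_norm_sq F).mul_left t)
  have hnn : ∀ i, 0 ≤ inner ℝ (B.basis i) F ^ 2 - t * (B.val i * inner ℝ (B.basis i) F ^ 2) := by
    intro i
    by_cases hi : 1 ≤ t * B.val i
    · simp [h0 i hi]
    · nlinarith [sq_nonneg (inner ℝ (B.basis i) F : ℝ)]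
  have hzero : ‖F‖ ^ 2 - t * ‖S F‖ ^ 2 = 0 := le_antisymm (by linarith) (hs.nonneg hnn)
  rw [hzero, hasSum_zero_iff_of_nonneg hnn] at hs
  have hc : ∀ i, inner ℝ (B.basis i) F = 0 := by
    intro i
    by_cases hi : 1 ≤ t * B.val i
    · exact h0 i hi
    · have h1 := congrFun hs i
      simp only [Pi.zero_apply] at h1
      have h2 : (1 - t * B.val i) * (inner ℝ (B.basis i) F : ℝ) ^ 2 = 0 := by linarith
      rcases mul_eq_zero.1 h2 with h3 | h3
      · exact absurd (by linarith) hi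
      · simpa using h3
  exact B.eq_zero_of_coeff hc

/-- Min-max, upper half: a subspace on which `‖F‖² ≤ t ‖S F‖²` yields as many independent
eigenvectors with eigenvalues at most `t`. -/
theorem exists_eigenvectors_of_subspace (hS : IsCompactOperator S) {t : ℝ} (W : Submodule ℝ H)
    (hW : ∀ F ∈ W, ‖F‖ ^ 2 ≤ t * ‖S F‖ ^ 2) :
    ∃ (lam : Fin (Module.finrank ℝ W) → ℝ) (F : Fin (Module.finrank ℝ W) → H),
      LinearIndependent ℝ F ∧ ∀ i, 0 < lam i ∧ lam i ≤ t ∧ IsEigenpair S (lam i) (F i) := by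
  obtain ⟨ι, ⟨B⟩⟩ := exists_spectralBasis hS
  have hfin := B.finite_level hS t
  let I := {i | 1 ≤ t * B.val i}
  have : Fintype I := hfin.fintype
  -- The finitely many coordinates with `1 ≤ t * val i` determine a vector of `W`, so there are at
  -- least `dim W` of them.
  let Φ : W →ₗ[ℝ] (I → ℝ) :=
    LinearMap.pi fun i => ((innerSL ℝ (B.basis i) : H →L[ℝ] ℝ) : H →ₗ[ℝ] ℝ).comp W.subtype
  have hΦ : Function.Injective Φ := by
    rw [injective_iff_map_eq_zero]
    intro F hF
    refine Subtype.ext (B.eq_zero (hW F F.2) fun i hi => ?_)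
    simpa [Φ] using congrFun hF ⟨i, hi⟩
  have hcard := LinearMap.finrank_le_finrank_of_injective hΦ
  rw [Module.finrank_fintype_fun_eq_card] at hcard
  obtain ⟨e⟩ : Nonempty (Fin (Module.finrank ℝ W) ↪ I) :=
    Function.Embedding.nonempty_of_card_le (by simpa using hcard)
  refine ⟨fun k => (B.val (e k))⁻¹, fun k => B.basis (e k), ?_, fun k => ?_⟩
  · exact B.basis.orthonormal.linearIndependent.comp _ (Subtype.val_injective.comp e.injective)
  · have hk : 1 ≤ t * B.val (e k) := (e k).2
    have hpos : 0 < B.val (e k) := lt_of_le_of_ne (B.val_nonneg _) fun h => by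
      rw [← h] at hk; norm_num at hk
    refine ⟨inv_pos.2 hpos, ?_, fun G => ?_⟩
    · rwa [inv_le_iff_one_le_mul₀ hpos]
    · rw [B.inner_map, inv_mul_cancel_left₀ hpos.ne']

/-- Min-max, lower half. -/
theorem norm_sq_le_of_mem_span_eigenvectors (hS : IsCompactOperator S) {t : ℝ} {κ : Type*}
    {lam : κ → ℝ} {F : κ → H} (hlam : ∀ k, lam k ≤ t)
    (hF : ∀ k, IsEigenpair S (lam k) (F k)) {x : H} (hx : x ∈ Submodule.span ℝ (range F)) :
    ‖x‖ ^ 2 ≤ t * ‖S x‖ ^ 2 := by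
  obtain ⟨ι, ⟨B⟩⟩ := exists_spectralBasis hS
  -- The quadratic inequality is not stable under sums, but vanishing of the coordinates with `t *
  -- val i < 1` is a linear condition.
  refine B.norm_sq_le fun i hi => ?_
  induction hx using Submodule.span_induction with
  | mem x hx =>
    obtain ⟨k, rfl⟩ := hx
    by_contra h
    have h1 := (hF k).coeff B i h
    exact hi (h1 ▸ mul_le_mul_of_nonneg_right (hlam k) (B.val_nonneg i))
  | zero => simp
  | add x y _ _ hx hy => rw [inner_add_right, hx, hy, add_zero]
  | smul c x _ hx => rw [inner_smul_right, hx, mul_zero]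

/-- Each such eigenvalue is the reciprocal of one of the finitely many values with `1 ≤ t * val i`.
This discreteness is why the infimum in `neumannEigenvalue` is attained. -/
lemma finite_eigenvalues (hS : IsCompactOperator S) (t : ℝ) :
    {lam : ℝ | lam ≤ t ∧ ∃ F, F ≠ 0 ∧ IsEigenpair S lam F}.Finite := by
  obtain ⟨ι, ⟨B⟩⟩ := exists_spectralBasis hS
  refine ((B.finite_level hS t).image fun i => (B.val i)⁻¹).subset ?_
  rintro lam ⟨hle, F, hF0, hF⟩
  obtain ⟨i, hi⟩ : ∃ i, inner ℝ (B.basis i) F ≠ 0 := by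
    by_contra! h
    exact hF0 (B.eq_zero_of_coeff h)
  have h1 := hF.coeff B i hi
  refine ⟨i, ?_, ?_⟩
  · change 1 ≤ t * B.val i
    rw [← h1]
    exact mul_le_mul_of_nonneg_right hle (B.val_nonneg i)
  · exact (eq_inv_of_mul_eq_one_left h1).symm

end Spectral

/-! ### Weak solutions and eigenpairs -/

section WeakSolutions

variable {h : ℂ → ℝ}

lemma IsRegularWeight.inner_primitive (hh : IsRegularWeight h) {f g : ℂ → ℝ}
    {D E : ℂ → (ℂ →L[ℝ] ℝ)} (hf : HasWeakFDerivOn unitDisc f D) (hg : HasWeakFDerivOn unitDisc g E)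
    {F G : gradientSpace}
    (hD : D =ᵐ[volume.restrict unitDisc] fun z => innerSL ℝ ((F : VectorFieldL2) z))
    (hE : E =ᵐ[volume.restrict unitDisc] fun z => innerSL ℝ ((G : VectorFieldL2) z)) :
    inner ℝ (hh.primitive F) (hh.primitive G) =
      ∫ z, (f z - ⨍ w, f w ∂(weightMeasure h)) * (g z - ⨍ w, g w ∂(weightMeasure h))
        ∂(weightMeasure h) := by
  rw [L2.inner_def]
  refine integral_congr_ae ?_
  filter_upwards [hh.primitive_ae_eq hf hD, hh.primitive_ae_eq hg hE] with z h1 h2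
  rw [h1, h2, real_inner_eq_re_inner, RCLike.inner_apply]
  simp [mul_comm]

lemma IsRegularWeight.integral_sub_average_mul (hh : IsRegularWeight h) {f g : ℂ → ℝ}
    (hf : MemLp f 2 (weightMeasure h)) (hg : MemLp g 2 (weightMeasure h)) :
    ∫ z, (f z - ⨍ w, f w ∂(weightMeasure h)) * (g z - ⨍ w, g w ∂(weightMeasure h))
        ∂(weightMeasure h) =
      (∫ z, f z * g z ∂(weightMeasure h)) -
        (⨍ w, g w ∂(weightMeasure h)) * ∫ z, f z ∂(weightMeasure h) := by
  have := hh.isFiniteMeasure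
  set a := ⨍ w, f w ∂(weightMeasure h)
  set b := ⨍ w, g w ∂(weightMeasure h)
  have h0 : ∫ z, (g z - b) ∂(weightMeasure h) = 0 := hh.integral_sub_average g
  have hg' : Integrable (fun z => g z - b) (weightMeasure h) :=
    (hg.integrable one_le_two).sub (integrable_const b)
  have hfg : Integrable (fun z => f z * g z) (weightMeasure h) := hf.integrable_mul hg
  have hf1 : Integrable (fun z => b * f z) (weightMeasure h) :=
    (hf.integrable one_le_two).const_mul b
  have e : ∀ z, (f z - a) * (g z - b) = f z * g z - b * f z - a * (g z - b) := fun z => by ring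
  have hfg1 : Integrable (fun z => f z * g z - b * f z) (weightMeasure h) := hfg.sub hf1
  simp_rw [e]
  rw [integral_sub hfg1 (hg'.const_mul a), integral_sub hfg hf1, integral_const_mul,
    integral_const_mul, h0]
  ring

lemma IsWeakSolution.congr {lam : ℝ} {f f' : ℂ → ℝ} (hf : IsWeakSolution h lam f)
    (hff' : f =ᵐ[volume.restrict unitDisc] f') : IsWeakSolution h lam f' := by
  have hν : f =ᵐ[weightMeasure h] f' := (weightMeasure_absolutelyContinuous h).ae_le hff'
  obtain ⟨D, ⟨h1, h2, h3⟩, h4⟩ := hf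
  refine ⟨D, ⟨h1.congr hff' (ae_eq_refl _), h2.ae_eq hν, h3⟩, fun g Dg hg => ?_⟩
  rw [h4 g Dg hg]
  congr 1
  exact integral_congr_ae (hν.mono fun z hz => by simp only [hz])

lemma IsRegularWeight.memSobolev_const (hh : IsRegularWeight h) (c : ℝ) :
    MemSobolev h (fun _ => c) (fun _ => 0) :=
  hh.memSobolev_iff.2 ⟨hasWeakFDerivOn_const c, (memLp_const (0 : ℂ →L[ℝ] ℝ))⟩

lemma dirichletForm_zero_left (D : ℂ → (ℂ →L[ℝ] ℝ)) : dirichletForm (fun _ => 0) D = 0 := by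
  simp [dirichletForm]

lemma dirichletForm_zero_right (D : ℂ → (ℂ →L[ℝ] ℝ)) : dirichletForm D (fun _ => 0) = 0 := by
  simp [dirichletForm]

lemma IsRegularWeight.isWeakSolution_const (hh : IsRegularWeight h) (c : ℝ) :
    IsWeakSolution h 0 (fun _ => c) :=
  ⟨_, hh.memSobolev_const c, fun g Dg _ => by rw [dirichletForm_zero_left, zero_mul]⟩

/-- The graph of the weak gradient. -/
def gradientGraph : Submodule ℝ ((ℂ →ₘ[volume.restrict unitDisc] ℝ) × gradientSpace) where
  carrier := {p | HasWeakFDerivOn unitDisc p.1 (fun z => innerSL ℝ ((p.2 : VectorFieldL2) z))}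
  zero_mem' := (hasWeakFDerivOn_const 0).congr
    (AEEqFun.coeFn_zero (μ := volume.restrict unitDisc) (β := ℝ)).symm <| by
      filter_upwards [Lp.coeFn_zero ℂ 2 (volume.restrict unitDisc)] with z hz
      change (0 : ℂ →L[ℝ] ℝ) = innerSL ℝ ((0 : VectorFieldL2) z)
      rw [hz, Pi.zero_apply, map_zero]
  add_mem' := by
    rintro ⟨u, F⟩ ⟨v, G⟩ hu hv
    refine (HasWeakFDerivOn.add hu hv).congr (AEEqFun.coeFn_add u v).symm ?_
    filter_upwards [Lp.coeFn_add (F : VectorFieldL2) G] with z hz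
    simp only [Prod.mk_add_mk, Submodule.coe_add]
    rw [hz, Pi.add_apply, map_add]
  smul_mem' := by
    rintro c ⟨u, F⟩ hu
    refine (HasWeakFDerivOn.const_smul hu c).congr (AEEqFun.coeFn_smul c u).symm ?_
    filter_upwards [Lp.coeFn_smul c (F : VectorFieldL2)] with z hz
    simp only [Prod.smul_mk, Submodule.coe_smul]
    rw [hz, Pi.smul_apply, map_smul]

lemma mem_gradientGraph {u : ℂ →ₘ[volume.restrict unitDisc] ℝ} {F : gradientSpace} :
    (u, F) ∈ gradientGraph ↔
      HasWeakFDerivOn unitDisc u (fun z => innerSL ℝ ((F : VectorFieldL2) z)) := Iff.rfl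

lemma eq_zero_of_mem_gradientGraph_const {u : ℂ →ₘ[volume.restrict unitDisc] ℝ} {F : gradientSpace}
    (hu : (u, F) ∈ gradientGraph) {c : ℝ} (hc : u =ᵐ[volume.restrict unitDisc] fun _ => c) :
    F = 0 := by
  have h1 := HasWeakFDerivOn.ae_unique (mem_gradientGraph.1 hu) (hasWeakFDerivOn_const c) hc
  refine Subtype.ext (Lp.ext ?_)
  filter_upwards [h1, Lp.coeFn_zero ℂ 2 (volume.restrict unitDisc)] with z hz hz0
  rw [ZeroMemClass.coe_zero, hz0, Pi.zero_apply, ← norm_eq_zero, ← innerSL_apply_norm ℝ, hz,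
    norm_zero]

lemma ae_const_of_mem_gradientGraph_zero {u : ℂ →ₘ[volume.restrict unitDisc] ℝ}
    (hu : (u, (0 : gradientSpace)) ∈ gradientGraph) :
    ∃ c : ℝ, u =ᵐ[volume.restrict unitDisc] fun _ => c := by
  obtain ⟨c, hc⟩ := HasWeakFDerivOn.ae_const (mem_gradientGraph.1 hu) (by
    filter_upwards [Lp.coeFn_zero ℂ 2 (volume.restrict unitDisc)] with z hz
    change innerSL ℝ ((0 : VectorFieldL2) z) = 0
    rw [hz, Pi.zero_apply, map_zero])
  exact ⟨c, (ae_restrict_iff' measurableSet_unitDisc).2 hc⟩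

/-- Testing with the constant `1` gives `lam * ∫ u = 0`, which removes the mean corrections and
turns the weak equation into one between gradients. If the gradient vanishes, `u` is constant, and a
nonzero constant forces `lam = 0` because the weight has positive mass. -/
lemma IsRegularWeight.exists_eigenpair_of_isWeakSolution (hh : IsRegularWeight h)
    (hn : weightMeasure h ≠ 0) {lam : ℝ} {u : ℂ →ₘ[volume.restrict unitDisc] ℝ}
    (hu : IsWeakSolution h lam u) :
    ∃ F : gradientSpace, (u, F) ∈ gradientGraph ∧ IsEigenpair hh.primitive lam F ∧
      (F = 0 → u ≠ 0 → lam = 0) := by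
  have := hh.isFiniteMeasure
  obtain ⟨D, ⟨hD, hu2, hD2⟩, hsol⟩ := hu
  obtain ⟨F, hF⟩ := exists_gradient hD hD2
  have h1 : lam * ∫ z, u z ∂(weightMeasure h) = 0 := by
    have := hsol _ _ (hh.memSobolev_const 1)
    rw [dirichletForm_zero_right] at this
    simpa using this.symm
  refine ⟨F, hD.congr (ae_eq_refl _) hF, fun G => ?_, fun hF0 hu0 => ?_⟩
  · have hG := hh.memSobolev_iff.2 ⟨potential_spec G, memLp_innerSL _⟩
    rw [hh.inner_primitive hD (potential_spec G) hF (ae_eq_refl _),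
      hh.integral_sub_average_mul hu2 hG.2.1]
    have h2 := hsol _ _ hG
    rw [dirichletForm_eq_inner hF (ae_eq_refl _)] at h2
    rw [Submodule.coe_inner, h2]
    linear_combination (⨍ w, potential G w ∂(weightMeasure h)) * h1
  · subst hF0
    obtain ⟨c, hc⟩ := ae_const_of_mem_gradientGraph_zero (u := u) (hD.congr (ae_eq_refl _) hF)
    have hc0 : c ≠ 0 := by
      rintro rfl
      exact hu0 (AEEqFun.ext (hc.trans AEEqFun.coeFn_zero.symm))
    have h2 : ∫ z, u z ∂(weightMeasure h) = (weightMeasure h).real univ * c := by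
      rw [integral_congr_ae ((weightMeasure_absolutelyContinuous h).ae_le hc), integral_const,
        smul_eq_mul]
    rw [h2] at h1
    have h3 : (weightMeasure h).real univ ≠ 0 := by
      simp [Measure.real, ENNReal.toReal_eq_zero_iff, hn]
    simpa [h3, hc0] using h1

/-- The mean-zero primitive of a gradient as a class of functions on the disc. -/
def normalizedPotential (h : ℂ → ℝ) (F : gradientSpace) : ℂ →ₘ[volume.restrict unitDisc] ℝ :=
  AEEqFun.mk (fun z => potential F z - ⨍ w, potential F w ∂(weightMeasure h))
    ((potential_spec F).sub_const _).aestronglyMeasurable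

lemma normalizedPotential_mem (h : ℂ → ℝ) (F : gradientSpace) :
    (normalizedPotential h F, F) ∈ gradientGraph :=
  ((potential_spec F).sub_const _).congr (AEEqFun.coeFn_mk _ _).symm (ae_eq_refl _)

/-- The solution has mean zero, so subtracting from a test function its mean changes neither side of
the equation. -/
lemma IsRegularWeight.isWeakSolution_normalizedPotential (hh : IsRegularWeight h) {lam : ℝ}
    {F : gradientSpace} (hF : IsEigenpair hh.primitive lam F) :
    IsWeakSolution h lam (normalizedPotential h F) := by
  have := hh.isFiniteMeasure
  refine IsWeakSolution.congr ?_ (AEEqFun.coeFn_mk _ _).symm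
  have hS := hh.memSobolev_iff.2 ⟨(potential_spec F).sub_const
    (⨍ w, potential F w ∂(weightMeasure h)), memLp_innerSL _⟩
  refine ⟨_, hS, fun g Dg hg => ?_⟩
  obtain ⟨G, hG⟩ := exists_gradient hg.1 hg.2.2
  have h0 : ∫ z, (potential F z - ⨍ w, potential F w ∂(weightMeasure h)) ∂(weightMeasure h) = 0 :=
    hh.integral_sub_average _
  have h1 := hh.inner_primitive hS.1 hg.1 (ae_eq_refl _) hG
  rw [hh.integral_sub_average_mul hS.2.1 hg.2.1, h0, mul_zero, sub_zero] at h1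
  rw [dirichletForm_eq_inner (ae_eq_refl _) hG, ← Submodule.coe_inner, hF G, h1]

/-! ### The variational description of the eigenvalue levels -/

lemma eigenvalueLevels_antitone (h : ℂ → ℝ) {m n : ℕ} (hmn : m ≤ n) :
    eigenvalueLevels h n ⊆ eigenvalueLevels h m := by
  rintro t ⟨lam, u, hu, hs⟩
  exact ⟨lam ∘ Fin.castLE hmn, u ∘ Fin.castLE hmn, hu.comp _ (Fin.castLE_injective hmn),
    fun i => hs _⟩

/-- The constant function, with eigenvalue `0`, joins the eigenfunctions obtained from `W`: hence
the `+ 1` and the condition `0 ≤ t`. -/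
lemma IsRegularWeight.mem_eigenvalueLevels_of_subspace (hh : IsRegularWeight h) {t : ℝ}
    (ht : 0 ≤ t) (W : Submodule ℝ gradientSpace)
    (hW : ∀ F ∈ W, ‖F‖ ^ 2 ≤ t * ‖hh.primitive F‖ ^ 2) :
    t ∈ eigenvalueLevels h (Module.finrank ℝ W + 1) := by
  obtain ⟨lam, F, hF, hs⟩ :=
    exists_eigenvectors_of_subspace hh.isCompactOperator_primitive W hW
  have hsum : ∀ c : Fin (Module.finrank ℝ W) → ℝ,
      (∑ i, c i • normalizedPotential h (F i), ∑ i, c i • F i) ∈ gradientGraph := by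
    intro c
    have := Submodule.sum_mem gradientGraph (t := Finset.univ) fun i _ =>
      gradientGraph.smul_mem (c i) (normalizedPotential_mem h (F i))
    simp only [Prod.smul_mk, ← prod_mk_sum] at this
    exact this
  -- A constant combination of primitives has zero gradient, so independence of the gradients makes
  -- the primitives independent and separates them from `1`.
  have hconst : ∀ (c : Fin (Module.finrank ℝ W) → ℝ) (a : ℝ),
      ∑ i, c i • normalizedPotential h (F i) = AEEqFun.const ℂ a → ∀ i, c i = 0 := by
    intro c a hca
    have h1 := eq_zero_of_mem_gradientGraph_const (hsum c) (c := a) (by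
      rw [hca]; exact AEEqFun.coeFn_const _ _)
    exact Fintype.linearIndependent_iff.1 hF c h1
  refine ⟨Fin.cons 0 lam, Fin.cons (AEEqFun.const ℂ 1) fun i => normalizedPotential h (F i),
    linearIndependent_finCons.2 ⟨?_, ?_⟩, fun i => ?_⟩
  · exact Fintype.linearIndependent_iff.2 fun c hc => hconst c 0 hc
  · intro hmem
    obtain ⟨c, hc⟩ := (Submodule.mem_span_range_iff_exists_fun ℝ).1 hmem
    have h1 := hconst c 1 hc
    simp only [h1, zero_smul, Finset.sum_const_zero] at hc
    have h2 : ∀ᵐ z ∂(volume.restrict unitDisc), (0 : ℝ) = 1 := by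
      filter_upwards [AEEqFun.coeFn_const (μ := volume.restrict unitDisc) ℂ (1 : ℝ),
        AEEqFun.coeFn_zero (μ := volume.restrict unitDisc) (β := ℝ)] with z h3 h4
      rw [← hc, h4] at h3
      simp at h3
    have h3 : volume unitDisc = 0 := by simpa [ae_iff] using h2
    exact (Metric.measure_ball_pos volume (0 : ℂ) one_pos).ne' h3
  · refine Fin.cases ?_ (fun i => ?_) i
    · refine ⟨by simpa using ht, ?_⟩
      simp only [Fin.cons_zero]
      exact (hh.isWeakSolution_const 1).congr (AEEqFun.coeFn_const _ _).symm
    · simp only [Fin.cons_succ]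
      exact ⟨(hs i).2.1, hh.isWeakSolution_normalizedPotential (hs i).2.2⟩

/-- On the span of the eigenfunctions only constants have zero gradient, so passing to gradients
loses at most one dimension. -/
lemma IsRegularWeight.exists_subspace_of_mem_eigenvalueLevels (hh : IsRegularWeight h)
    (hn : weightMeasure h ≠ 0) {t : ℝ} {n : ℕ} (ht : t ∈ eigenvalueLevels h n) :
    ∃ W : Submodule ℝ gradientSpace, n ≤ Module.finrank ℝ W + 1 ∧
      ∀ F ∈ W, ‖F‖ ^ 2 ≤ t * ‖hh.primitive F‖ ^ 2 := by
  obtain ⟨lam, u, hu, hs⟩ := ht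
  choose F hFu hF hF0 using fun i => hh.exists_eigenpair_of_isWeakSolution hn (hs i).2
  refine ⟨Submodule.span ℝ (range F), ?_, fun x hx =>
    norm_sq_le_of_mem_span_eigenvectors hh.isCompactOperator_primitive (fun i => (hs i).1) hF hx⟩
  let Φ := Fintype.linearCombination ℝ F
  let U := Fintype.linearCombination ℝ u
  have hU : Function.Injective U := linearIndependent_iff_injective_fintypeLinearCombination.1 hu
  have hsum : ∀ c, (U c, Φ c) ∈ gradientGraph := by
    intro c
    have := Submodule.sum_mem gradientGraph (t := Finset.univ) fun i _ =>
      gradientGraph.smul_mem (c i) (hFu i)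
    simp only [Prod.smul_mk, ← prod_mk_sum] at this
    exact this
  let one : ℂ →ₘ[volume.restrict unitDisc] ℝ := AEEqFun.const ℂ 1
  have hker : ∀ c : Φ.ker, U c ∈ Submodule.span ℝ {one} := by
    intro c
    have h1 := hsum c
    rw [LinearMap.mem_ker.1 c.2] at h1
    obtain ⟨a, ha⟩ := ae_const_of_mem_gradientGraph_zero h1
    refine Submodule.mem_span_singleton.2 ⟨a, AEEqFun.ext ?_⟩
    filter_upwards [ha, AEEqFun.coeFn_smul a one,
      AEEqFun.coeFn_const (μ := volume.restrict unitDisc) ℂ (1 : ℝ)] with z h2 h3 h4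
    rw [h2, h3, Pi.smul_apply]
    simp only [one]
    rw [h4]
    simp
  have h1 : Module.finrank ℝ Φ.ker ≤ 1 := by
    refine (LinearMap.finrank_le_finrank_of_injective
      (f := (U.domRestrict Φ.ker).codRestrict (Submodule.span ℝ {one}) hker) ?_).trans
      ((finrank_span_le_card {one}).trans (by simp))
    intro a b hab
    exact Subtype.ext (hU (congrArg Subtype.val hab))
  have h2 := Φ.finrank_range_add_finrank_ker
  rw [Fintype.range_linearCombination, Module.finrank_fin_fun] at h2
  omega

end WeakSolutions

/-! ### Attainment of the eigenvalues -/

section Attainment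

variable {h : ℂ → ℝ}

lemma IsEigenpair.pos {V E : Type*} [NormedAddCommGroup V] [InnerProductSpace ℝ V]
    [NormedAddCommGroup E] [InnerProductSpace ℝ E] {S : V →L[ℝ] E} {lam : ℝ} {F : V}
    (hF : IsEigenpair S lam F) (h0 : F ≠ 0) : 0 < lam := by
  have h1 := hF F
  rw [real_inner_self_eq_norm_sq, real_inner_self_eq_norm_sq] at h1
  have h2 : 0 < ‖F‖ ^ 2 := by positivity
  rw [h1] at h2
  exact pos_of_mul_pos_left h2 (by positivity)

lemma IsRegularWeight.eigenvalue_cases (hh : IsRegularWeight h) (hn : weightMeasure h ≠ 0)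
    {lam : ℝ} {u : ℂ →ₘ[volume.restrict unitDisc] ℝ} (hu : IsWeakSolution h lam u) (h0 : u ≠ 0) :
    lam = 0 ∨ 0 < lam ∧ ∃ F : gradientSpace, F ≠ 0 ∧ IsEigenpair hh.primitive lam F := by
  obtain ⟨F, -, hF, hF0⟩ := hh.exists_eigenpair_of_isWeakSolution hn hu
  by_cases hz : F = 0
  · exact Or.inl (hF0 hz h0)
  · exact Or.inr ⟨hF.pos hz, F, hz, hF⟩

lemma IsRegularWeight.nonneg_of_mem_eigenvalueLevels (hh : IsRegularWeight h)
    (hn : weightMeasure h ≠ 0) {t : ℝ} {n : ℕ} (h1n : 1 ≤ n) (ht : t ∈ eigenvalueLevels h n) :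
    0 ≤ t := by
  obtain ⟨lam, u, hu, hs⟩ := ht
  have i : Fin n := ⟨0, h1n⟩
  refine le_trans ?_ (hs i).1
  rcases hh.eigenvalue_cases hn (hs i).2 (hu.ne_zero i) with h1 | h1
  · exact h1.ge
  · exact h1.1.le

/-- A level `t ≤ t₁` can be lowered to the largest eigenvalue it uses, which is again a level and
lies in the finite set `Λ`. The value `0` in `Λ` accounts for constant eigenfunctions, whose
gradient is zero. -/
lemma IsRegularWeight.isLeast_neumannEigenvalue (hh : IsRegularWeight h)
    (hn : weightMeasure h ≠ 0) {n : ℕ} (h1n : 1 ≤ n) (hne : (eigenvalueLevels h n).Nonempty) :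
    IsLeast (eigenvalueLevels h n) (neumannEigenvalue h n) := by
  obtain ⟨t₁, ht₁⟩ := hne
  set Λ : Set ℝ := insert 0 {lam | lam ≤ t₁ ∧ ∃ F, F ≠ 0 ∧ IsEigenpair hh.primitive lam F}
  have hfin : (Λ ∩ eigenvalueLevels h n).Finite :=
    ((finite_eigenvalues hh.isCompactOperator_primitive t₁).insert 0).subset inter_subset_left
  have key : ∀ t ∈ eigenvalueLevels h n, t ≤ t₁ → ∃ t' ∈ Λ ∩ eigenvalueLevels h n, t' ≤ t := by
    rintro t ⟨lam, u, hu, hs⟩ htt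
    have : Nonempty (Fin n) := ⟨⟨0, h1n⟩⟩
    obtain ⟨i, hi⟩ := Finite.exists_max lam
    refine ⟨lam i, ⟨?_, lam, u, hu, fun j => ⟨hi j, (hs j).2⟩⟩, (hs i).1⟩
    rcases hh.eigenvalue_cases hn (hs i).2 (hu.ne_zero i) with h1 | h1
    · exact Or.inl h1
    · exact Or.inr ⟨(hs i).1.trans htt, h1.2⟩
  obtain ⟨t₂, ht₂, ht₂₁⟩ := key t₁ ht₁ le_rfl
  obtain ⟨m, hm, hmin⟩ := Set.exists_min_image _ id hfin ⟨t₂, ht₂⟩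
  have hleast : IsLeast (eigenvalueLevels h n) m := by
    refine ⟨hm.2, fun t ht => ?_⟩
    rcases le_total t t₁ with h1 | h1
    · obtain ⟨t', ht', h2⟩ := key t ht h1
      exact (hmin t' ht').trans h2
    · exact ((hmin t₂ ht₂).trans ht₂₁).trans h1
  rw [neumannEigenvalue, hleast.csInf_eq]
  exact hleast

/-! ### Existence of infinitely many eigenvalues -/

/-- The level set consists of finitely many vertical lines. -/
lemma volume_polynomial_re_level (p : Polynomial ℝ) (a : ℝ) (hp : p ≠ Polynomial.C a) :
    volume {z : ℂ | p.eval z.re = a} = 0 := by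
  have h1 : {z : ℂ | p.eval z.re = a} =
      Complex.measurableEquivRealProd ⁻¹' ({x : ℝ | p.eval x = a} ×ˢ univ) := by
    ext z; simp [Complex.measurableEquivRealProd]
  have hfin : {x : ℝ | p.eval x = a}.Finite := by
    have := Polynomial.finite_setOfPred_isRoot (sub_ne_zero.2 hp)
    refine this.subset fun x hx => ?_
    simpa [Polynomial.IsRoot, sub_eq_zero] using hx
  rw [h1, Complex.volume_preserving_equiv_real_prod.measure_preimage
    (hfin.measurableSet.prod MeasurableSet.univ).nullMeasurableSet, Measure.volume_eq_prod,
    Measure.prod_prod, hfin.measure_zero, zero_mul]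

lemma contDiff_polynomial_re (p : Polynomial ℝ) : ContDiff ℝ 1 fun z : ℂ => p.eval z.re :=
  (p.contDiff_aeval 1).comp (Complex.reCLM.contDiff)

lemma continuous_polynomial_re (p : Polynomial ℝ) : Continuous fun z : ℂ => p.eval z.re :=
  (contDiff_polynomial_re p).continuous

/-- The class of `z ↦ p (re z)` on the disc. -/
def polynomialRe : Polynomial ℝ →ₗ[ℝ] (ℂ →ₘ[volume.restrict unitDisc] ℝ) where
  toFun p := AEEqFun.mk (fun z => p.eval z.re) (continuous_polynomial_re p).aestronglyMeasurable
  map_add' p q := by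
    rw [AEEqFun.mk_add_mk]
    congr 1; ext z; simp
  map_smul' c p := by
    rw [RingHom.id_apply]
    refine Eq.trans ?_ (AEEqFun.smul_mk c (fun z : ℂ => p.eval z.re)
      (continuous_polynomial_re p).aestronglyMeasurable)
    congr 1; ext z; simp

lemma exists_polynomialRe_mem_gradientGraph (p : Polynomial ℝ) :
    ∃ F : gradientSpace, (polynomialRe p, F) ∈ gradientGraph := by
  have h1 := hasWeakFDerivOn_of_contDiff unitDisc (contDiff_polynomial_re p)
  have hc : Continuous (fderiv ℝ fun z : ℂ => p.eval z.re) :=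
    (contDiff_polynomial_re p).continuous_fderiv one_ne_zero
  obtain ⟨C, hC⟩ := (isCompact_closedBall (0 : ℂ) 1).exists_bound_of_continuousOn hc.continuousOn
  have h2 : MemLp (fderiv ℝ fun z : ℂ => p.eval z.re) 2 (volume.restrict unitDisc) := by
    have : IsFiniteMeasure (volume.restrict unitDisc) :=
      ⟨by rw [Measure.restrict_apply_univ]; exact measure_ball_lt_top⟩
    refine MemLp.of_bound hc.aestronglyMeasurable C ?_
    exact (ae_restrict_mem measurableSet_unitDisc).mono fun z hz =>
      hC z (Metric.ball_subset_closedBall hz)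
  obtain ⟨F, hF⟩ := exists_gradient h1 h2
  exact ⟨F, h1.congr (AEEqFun.coeFn_mk _ _).symm hF⟩

/-- Otherwise a level set of the polynomial would carry all the mass of the weight, although it is
Lebesgue null and the weight measure is nonzero and absolutely continuous. -/
lemma IsRegularWeight.eq_C_of_primitive_eq_zero (hh : IsRegularWeight h)
    (hn : weightMeasure h ≠ 0) {p : Polynomial ℝ} {F : gradientSpace}
    (hF : (polynomialRe p, F) ∈ gradientGraph) (h0 : hh.primitive F = 0) :
    ∃ a, p = Polynomial.C a := by
  by_contra! hp
  have h1 := hh.primitive_ae_eq (mem_gradientGraph.1 hF) (ae_eq_refl _)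
  rw [h0] at h1
  set a := ⨍ w, polynomialRe p w ∂(weightMeasure h)
  have h2 : ∀ᵐ z ∂(weightMeasure h), p.eval z.re = a := by
    filter_upwards [h1, Lp.coeFn_zero ℝ 2 (weightMeasure h),
      (weightMeasure_absolutelyContinuous h).ae_le (AEEqFun.coeFn_mk _
        (continuous_polynomial_re p).aestronglyMeasurable)] with z h3 h4 h5
    rw [h4, Pi.zero_apply] at h3
    rw [← h5]
    exact (sub_eq_zero.1 h3.symm)
  have h3 : ∀ᵐ z ∂(weightMeasure h), p.eval z.re ≠ a := by
    refine (weightMeasure_absolutelyContinuous h).ae_le (ae_restrict_of_ae ?_)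
    simpa [ae_iff] using volume_polynomial_re_level p a (hp a)
  refine hn (ae_eq_bot.1 (Filter.eventually_false_iff_eq_bot.1 ?_))
  filter_upwards [h2, h3] with z h4 h5 using h5 h4

/-- An injective linear map on a finite-dimensional space is bounded below. -/
lemma exists_norm_sq_le_of_span {V E ι : Type*} [NormedAddCommGroup V] [InnerProductSpace ℝ V]
    [NormedAddCommGroup E] [InnerProductSpace ℝ E] [Fintype ι] {S : V →L[ℝ] E} {F : ι → V}
    (hinj : ∀ c : ι → ℝ, S (∑ i, c i • F i) = 0 → ∀ i, c i = 0) :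
    ∃ t : ℝ, 0 ≤ t ∧ ∀ x ∈ Submodule.span ℝ (range F), ‖x‖ ^ 2 ≤ t * ‖S x‖ ^ 2 := by
  set W := Submodule.span ℝ (range F)
  have hker : (S.toLinearMap.domRestrict W).ker = ⊥ := by
    refine LinearMap.ker_eq_bot'.2 fun x hx => ?_
    obtain ⟨c, hc⟩ := (Submodule.mem_span_range_iff_exists_fun ℝ).1 x.2
    have h1 : S (∑ i, c i • F i) = 0 := by rw [hc]; exact hx
    have h2 := hinj c h1
    refine Subtype.ext ?_
    rw [← hc]
    simp [h2]
  have : FiniteDimensional ℝ W := FiniteDimensional.span_of_finite ℝ (finite_range F)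
  obtain ⟨K, -, hK⟩ := LinearMap.exists_antilipschitzWith _ hker
  refine ⟨(K : ℝ) ^ 2, sq_nonneg _, fun x hx => ?_⟩
  have h1 := hK.le_mul_norm_sub ⟨x, hx⟩ 0
  rw [add_zero, map_zero, add_zero, norm_neg, norm_neg] at h1
  rw [← mul_pow]
  exact pow_le_pow_left₀ (norm_nonneg _) h1 2

/-- Min-max applied to the gradients of `(re z) ^ (i + 1)`; starting at exponent one excludes
constants, which keeps `primitive` injective on their span. -/
lemma IsRegularWeight.eigenvalueLevels_nonempty (hh : IsRegularWeight h)
    (hn : weightMeasure h ≠ 0) (n : ℕ) : (eigenvalueLevels h n).Nonempty := by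
  choose F hF using fun i : Fin n =>
    exists_polynomialRe_mem_gradientGraph (Polynomial.X ^ ((i : ℕ) + 1))
  let P : (Fin n → ℝ) → Polynomial ℝ := fun c => ∑ i, c i • Polynomial.X ^ ((i : ℕ) + 1)
  have hsum : ∀ c : Fin n → ℝ, (polynomialRe (P c), ∑ i, c i • F i) ∈ gradientGraph := by
    intro c
    have := Submodule.sum_mem gradientGraph (t := Finset.univ) fun i _ =>
      gradientGraph.smul_mem (c i) (hF i)
    simp only [Prod.smul_mk, ← prod_mk_sum] at this
    simpa [P, map_sum] using this
  have hinj : ∀ c : Fin n → ℝ, hh.primitive (∑ i, c i • F i) = 0 → ∀ i, c i = 0 := by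
    intro c hc i
    obtain ⟨a, ha⟩ := hh.eq_C_of_primitive_eq_zero hn (hsum c) hc
    have h1 := congrArg (fun q => q.coeff ((i : ℕ) + 1)) ha
    simpa [P, Polynomial.coeff_C, Polynomial.finsetSum_coeff, Polynomial.coeff_X_pow,
      Fin.val_inj] using h1
  have hli : LinearIndependent ℝ F := Fintype.linearIndependent_iff.2 fun c hc =>
    hinj c (by rw [hc, map_zero])
  set W := Submodule.span ℝ (range F)
  have hW : Module.finrank ℝ W = n := by
    rw [finrank_span_eq_card hli, Fintype.card_fin]
  obtain ⟨t, ht, hb⟩ := exists_norm_sq_le_of_span (S := hh.primitive) (F := F) hinj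
  have := hh.mem_eigenvalueLevels_of_subspace ht W hb
  rw [hW] at this
  exact ⟨_, eigenvalueLevels_antitone h n.le_succ this⟩

end Attainment

/-! ### Comparison of two weights -/

section Comparison

variable {h h₁ h₂ : ℂ → ℝ} {s : ℝ≥0∞}

lemma weightDist_comm (s : ℝ≥0∞) (h₁ h₂ : ℂ → ℝ) : weightDist s h₁ h₂ = weightDist s h₂ h₁ := by
  simp only [weightDist, min_comm (h₁ _), enorm_sub_rev (h₁ _)]

lemma toReal_one_sub_inv_pos (hs : 1 < s) : 0 < (1 - s⁻¹).toReal := by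
  refine ENNReal.toReal_pos ?_ (by simp)
  exact (tsub_pos_of_lt (ENNReal.inv_lt_one.2 hs)).ne'

lemma sobolevExponent_eq_ofReal (hs : 1 < s) :
    sobolevExponent s = ENNReal.ofReal (2 / (1 - s⁻¹).toReal) := by
  rw [ENNReal.ofReal_div_of_pos (toReal_one_sub_inv_pos hs), ENNReal.ofReal_toReal (by simp),
    sobolevExponent]
  simp

lemma two_le_sobolevExponent : 2 ≤ sobolevExponent s := by
  rw [sobolevExponent, ENNReal.le_div_iff_mul_le (by simp) (by simp)]
  calc (2 : ℝ≥0∞) * (1 - s⁻¹) ≤ 2 * 1 := by gcongr; exact tsub_le_self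
    _ = 2 := mul_one 2

lemma sobolevExponent_ne_top (hs : 1 < s) : sobolevExponent s ≠ ⊤ := by
  rw [sobolevExponent_eq_ofReal hs]
  exact ENNReal.ofReal_ne_top

lemma ae_lt_top_of_eLpNorm_lt_top {α : Type*} [MeasurableSpace α] {μ : Measure α}
    {w : α → ℝ≥0∞} (hw : AEMeasurable w μ) (hs : s ≠ 0) (h : eLpNorm w s μ < ⊤) :
    ∀ᵐ z ∂μ, w z < ⊤ := by
  rcases eq_or_ne s ⊤ with rfl | hs'
  · rw [eLpNorm_exponent_top] at h
    filter_upwards [ae_lt_of_essSup_lt h] with z hz using hz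
  · have h1 := lintegral_rpow_enorm_lt_top_of_eLpNorm_lt_top hs hs' h
    have h2 := ae_lt_top' (hw.enorm.pow_const s.toReal) h1.ne
    filter_upwards [h2] with z hz
    exact (ENNReal.rpow_lt_top_iff_of_pos (ENNReal.toReal_pos hs hs')).1 hz

/-- Hölder with the conjugate exponent written as `1 / (1 - s⁻¹)`, so that `s = ⊤` is included. -/
lemma lintegral_mul_le_eLpNorm_mul_rpow {α : Type*} [MeasurableSpace α] {μ : Measure α}
    {w v : α → ℝ≥0∞} (hw : AEMeasurable w μ) (hv : AEMeasurable v μ) (hs : 1 < s) :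
    ∫⁻ z, w z * v z ∂μ ≤
      eLpNorm w s μ * (∫⁻ z, v z ^ (1 - s⁻¹).toReal⁻¹ ∂μ) ^ (1 - s⁻¹).toReal := by
  rcases eq_or_ne s ⊤ with rfl | hs'
  · simp only [ENNReal.inv_top, tsub_zero, ENNReal.toReal_one, inv_one, ENNReal.rpow_one,
      eLpNorm_exponent_top]
    rw [← lintegral_const_mul'' _ hv]
    refine lintegral_mono_ae ?_
    filter_upwards [enorm_ae_le_eLpNormEssSup w μ] with z hz
    exact mul_le_mul_left hz _
  · have hs0 : s ≠ 0 := (one_pos.trans hs).ne'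
    have hp : 1 < s.toReal := by
      rw [← ENNReal.toReal_one]; exact (ENNReal.toReal_lt_toReal (by simp) hs').2 hs
    have hθ : (1 - s⁻¹).toReal = 1 - s.toReal⁻¹ := by
      rw [ENNReal.toReal_sub_of_le (ENNReal.inv_le_one.2 hs.le) (by simp), ENNReal.toReal_inv,
        ENNReal.toReal_one]
    have hpq : s.toReal.HolderConjugate (1 - s⁻¹).toReal⁻¹ := by
      rw [Real.holderConjugate_iff]
      exact ⟨hp, by rw [inv_inv, hθ]; ring⟩
    have := ENNReal.lintegral_mul_le_Lp_mul_Lq μ hpq hw hv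
    rw [eLpNorm_eq_lintegral_rpow_enorm_toReal hs0 hs']
    simpa using this

lemma IsRegularWeight.aemeasurable (hh : IsRegularWeight h) :
    AEMeasurable h (volume.restrict unitDisc) := by
  obtain ⟨β, -, hβ⟩ := hh
  exact hβ.aestronglyMeasurable.aemeasurable

lemma lintegral_weightMeasure (hh : IsRegularWeight h) {g : ℂ → ℝ≥0∞}
    (hg : AEMeasurable g (volume.restrict unitDisc)) :
    ∫⁻ z, g z ∂(weightMeasure h) = ∫⁻ z in unitDisc, ENNReal.ofReal (h z) * g z :=
  lintegral_withDensity_eq_lintegral_mul₀ hh.aemeasurable.ennreal_ofReal hg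

/-- With `θ = 1 - s⁻¹`, factor `|h₁ - h₂|` as the integrand of `weightDist` times `min ^ θ` and
apply Hölder with exponents `s` and `1 / θ`; then `min ≤ h₁` turns the second factor into a norm
weighted by `h₁`, of exponent `2 / θ`. -/
lemma lintegral_enorm_sub_mul_sq_le (hr₁ : IsRegularWeight h₁) (hr₂ : IsRegularWeight h₂)
    (hs : 1 < s) (hd : weightDist s h₁ h₂ < ⊤) {u : ℂ → ℝ}
    (hu : AEMeasurable u (volume.restrict unitDisc)) :
    ∫⁻ z in unitDisc, ‖h₁ z - h₂ z‖ₑ * ‖u z‖ₑ ^ 2 ≤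
      weightDist s h₁ h₂ * eLpNorm u (sobolevExponent s) (weightMeasure h₁) ^ 2 := by
  have hθ := toReal_one_sub_inv_pos hs
  rw [sobolevExponent_eq_ofReal hs]
  set θ := (1 - s⁻¹).toReal with hθ_def
  set m : ℂ → ℝ≥0∞ := fun z => ENNReal.ofReal (min (h₁ z) (h₂ z)) with hm_def
  have hm : AEMeasurable m (volume.restrict unitDisc) :=
    (hr₁.aemeasurable.min hr₂.aemeasurable).ennreal_ofReal
  set w : ℂ → ℝ≥0∞ := fun z => ‖h₁ z - h₂ z‖ₑ * m z ^ (-θ) with hw_def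
  have hw : AEMeasurable w (volume.restrict unitDisc) :=
    (hr₁.aemeasurable.sub hr₂.aemeasurable).enorm.mul (hm.pow_const _)
  have hv : AEMeasurable (fun z => m z ^ θ * ‖u z‖ₑ ^ 2) (volume.restrict unitDisc) :=
    (hm.pow_const _).mul (hu.enorm.pow_const _)
  have hle : ∫⁻ z in unitDisc, ‖h₁ z - h₂ z‖ₑ * ‖u z‖ₑ ^ 2 ≤
      ∫⁻ z in unitDisc, w z * (m z ^ θ * ‖u z‖ₑ ^ 2) := by
    refine lintegral_mono_ae ?_
    -- Where the weights differ and the minimum is zero, the integrand of `weightDist` is infinite;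
    -- finiteness of the distance excludes this almost everywhere.
    filter_upwards [ae_lt_top_of_eLpNorm_lt_top hw (one_pos.trans hs).ne' hd] with z hz
    rcases eq_or_ne (h₁ z) (h₂ z) with h0 | h0
    · simp [h0]
    · have h0' : ‖h₁ z - h₂ z‖ₑ ≠ 0 := by simpa [sub_eq_zero] using h0
      have hm0 : m z ≠ 0 := by
        intro hm0
        simp only [hw_def, hm0, ENNReal.zero_rpow_of_neg (neg_neg_of_pos hθ),
          ENNReal.mul_top h0', lt_self_iff_false] at hz
      have h1 : m z ^ (-θ) * m z ^ θ = 1 := by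
        rw [← ENNReal.rpow_add _ _ hm0 ENNReal.ofReal_ne_top, neg_add_cancel, ENNReal.rpow_zero]
      have h2 : w z * (m z ^ θ * ‖u z‖ₑ ^ 2) =
          ‖h₁ z - h₂ z‖ₑ * (m z ^ (-θ) * m z ^ θ) * ‖u z‖ₑ ^ 2 := by
        simp only [hw_def]; ring
      rw [h2, h1, mul_one]
  refine hle.trans ((lintegral_mul_le_eLpNorm_mul_rpow hw hv hs).trans ?_)
  refine mul_le_mul_right ?_ _
  have hr : (0 : ℝ) < 2 / θ := by positivity
  rw [eLpNorm_eq_lintegral_rpow_enorm_toReal (by simpa using hr) ENNReal.ofReal_ne_top,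
    ENNReal.toReal_ofReal hr.le, ← ENNReal.rpow_natCast, ← ENNReal.rpow_mul,
    lintegral_weightMeasure hr₁ (hu.enorm.pow_const _)]
  have he : 1 / (2 / θ) * ((2 : ℕ) : ℝ) = θ := by push_cast; field_simp
  rw [he, ← hθ_def]
  refine ENNReal.rpow_le_rpow (lintegral_mono fun z => ?_) hθ.le
  have h3 : (m z ^ θ * ‖u z‖ₑ ^ 2) ^ θ⁻¹ = m z * ‖u z‖ₑ ^ (2 / θ) := by
    rw [ENNReal.mul_rpow_of_nonneg _ _ (by positivity), ← ENNReal.rpow_mul,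
      mul_inv_cancel₀ hθ.ne', ENNReal.rpow_one, ← ENNReal.rpow_natCast, ← ENNReal.rpow_mul]
    congr 2
  rw [h3]
  exact mul_le_mul_left (ENNReal.ofReal_le_ofReal (min_le_left _ _)) _

lemma lintegral_sq_weightMeasure_le (hr₁ : IsRegularWeight h₁) (hr₂ : IsRegularWeight h₂)
    {u : ℂ → ℝ} (hu : AEMeasurable u (volume.restrict unitDisc)) :
    ∫⁻ z, ‖u z‖ₑ ^ 2 ∂(weightMeasure h₂) ≤ (∫⁻ z, ‖u z‖ₑ ^ 2 ∂(weightMeasure h₁)) +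
      ∫⁻ z in unitDisc, ‖h₁ z - h₂ z‖ₑ * ‖u z‖ₑ ^ 2 := by
  have hu2 : AEMeasurable (fun z => ‖u z‖ₑ ^ 2) (volume.restrict unitDisc) := hu.enorm.pow_const _
  have hm : AEMeasurable (fun z => ENNReal.ofReal (h₁ z) * ‖u z‖ₑ ^ 2) (volume.restrict unitDisc) :=
    hr₁.aemeasurable.ennreal_ofReal.mul hu2
  rw [lintegral_weightMeasure hr₁ hu2, lintegral_weightMeasure hr₂ hu2, ← lintegral_add_left' hm]
  refine lintegral_mono fun z => ?_
  rw [← add_mul]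
  refine mul_le_mul_left ?_ _
  calc ENNReal.ofReal (h₂ z) ≤ ENNReal.ofReal (h₁ z + ‖h₁ z - h₂ z‖) := by
        refine ENNReal.ofReal_le_ofReal ?_
        have := neg_abs_le (h₁ z - h₂ z)
        have := le_abs_self (h₂ z - h₁ z)
        rw [abs_sub_comm] at this
        rw [Real.norm_eq_abs]
        linarith
    _ ≤ _ := by
        rw [← ofReal_norm]
        exact ENNReal.ofReal_add_le

lemma ofReal_integral_mul_self {α : Type*} [MeasurableSpace α] {μ : Measure α} {u : α → ℝ}
    (hu : MemLp u 2 μ) : ENNReal.ofReal (∫ z, u z * u z ∂μ) = ∫⁻ z, ‖u z‖ₑ ^ 2 ∂μ := by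
  have hi : Integrable (fun z => u z * u z) μ := hu.integrable_mul hu
  rw [ofReal_integral_eq_lintegral_ofReal hi (ae_of_all _ fun z => mul_self_nonneg _)]
  refine lintegral_congr fun z => ?_
  rw [← ofReal_norm, ← ENNReal.ofReal_pow (norm_nonneg _), Real.norm_eq_abs, sq_abs, sq]

/-- The primitive of `h₁`-mean zero is measured in both weights. Recentring it at its `h₂`-mean can
only lower its `L²(h₂)` norm; the rest is `h₂ ≤ h₁ + |h₁ - h₂|`, `lintegral_enorm_sub_mul_sq_le` and
Poincaré–Sobolev for `h₁`. -/
lemma norm_sq_primitive_le (hr₁ : IsRegularWeight h₁) (hr₂ : IsRegularWeight h₂) (hs : 1 < s)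
    (hd : weightDist s h₁ h₂ < ⊤) (F : gradientSpace) :
    ‖hr₂.primitive F‖ ^ 2 ≤ ‖hr₁.primitive F‖ ^ 2 +
      (poincareSobolevConst (sobolevExponent s) h₁).toReal ^ 2 * (weightDist s h₁ h₂).toReal *
        ‖F‖ ^ 2 := by
  have hF := potential_spec F
  have hL := memLp_innerSL (F : VectorFieldL2)
  set u : ℂ → ℝ := fun z => potential F z - ⨍ w, potential F w ∂(weightMeasure h₁) with hu_def
  have hu : HasWeakFDerivOn unitDisc u _ := hF.sub_const _
  have hu1 : MemLp u 2 (weightMeasure h₁) := hr₁.memLp le_rfl (by norm_num) hu hL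
  have hu2 : MemLp u 2 (weightMeasure h₂) := hr₂.memLp le_rfl (by norm_num) hu hL
  have hB := (hr₁.poincareSobolevConst_lt_top two_le_sobolevExponent (sobolevExponent_ne_top hs)).ne
  have e1 : ENNReal.ofReal (‖hr₁.primitive F‖ ^ 2) = ∫⁻ z, ‖u z‖ₑ ^ 2 ∂(weightMeasure h₁) := by
    rw [← ofReal_integral_mul_self hu1, ← real_inner_self_eq_norm_sq,
      hr₁.inner_primitive hF hF (ae_eq_refl _) (ae_eq_refl _)]
  have e2 : ENNReal.ofReal (‖hr₂.primitive F‖ ^ 2) ≤ ∫⁻ z, ‖u z‖ₑ ^ 2 ∂(weightMeasure h₂) := by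
    rw [← ofReal_integral_mul_self hu2, ← real_inner_self_eq_norm_sq,
      hr₂.inner_primitive hu hu (ae_eq_refl _) (ae_eq_refl _),
      hr₂.integral_sub_average_mul hu2 hu2, average_eq, smul_eq_mul, mul_assoc]
    refine ENNReal.ofReal_le_ofReal (sub_le_self _ ?_)
    exact mul_nonneg (inv_nonneg.2 measureReal_nonneg) (mul_self_nonneg _)
  have hum : AEMeasurable u (volume.restrict unitDisc) := hu.aestronglyMeasurable.aemeasurable
  have e3 := hr₁.eLpNorm_sub_average_le two_le_sobolevExponent (sobolevExponent_ne_top hs) hF hL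
  rw [eLpNorm_innerSL] at e3
  have e4 : ENNReal.ofReal (‖hr₂.primitive F‖ ^ 2) ≤ ENNReal.ofReal (‖hr₁.primitive F‖ ^ 2) +
      weightDist s h₁ h₂ *
        (poincareSobolevConst (sobolevExponent s) h₁ * ENNReal.ofReal ‖F‖) ^ 2 := by
    refine e2.trans ((lintegral_sq_weightMeasure_le hr₁ hr₂ hum).trans ?_)
    rw [e1]
    refine add_le_add le_rfl ((lintegral_enorm_sub_mul_sq_le hr₁ hr₂ hs hd hum).trans ?_)
    gcongr
    exact e3
  have e5 := ENNReal.toReal_mono (by finiteness) e4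
  rw [ENNReal.toReal_add (by finiteness) (by finiteness), ENNReal.toReal_mul, ENNReal.toReal_pow,
    ENNReal.toReal_mul, ENNReal.toReal_ofReal (sq_nonneg _), ENNReal.toReal_ofReal (sq_nonneg _),
    ENNReal.toReal_ofReal (norm_nonneg _)] at e5
  refine e5.trans_eq ?_
  rw [Submodule.coe_norm]
  ring

/-- Comparing the primitives of two weights shifts the eigenvalue levels by a controlled amount. -/
lemma div_mem_eigenvalueLevels (hr₁ : IsRegularWeight h₁) (hr₂ : IsRegularWeight h₂)
    (hn₁ : weightMeasure h₁ ≠ 0) {δ : ℝ}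
    (hδ : ∀ F, ‖hr₁.primitive F‖ ^ 2 ≤ ‖hr₂.primitive F‖ ^ 2 + δ * ‖F‖ ^ 2) {t : ℝ} (ht : 0 ≤ t)
    (htδ : t * δ < 1) {n : ℕ} (htn : t ∈ eigenvalueLevels h₁ n) :
    t / (1 - t * δ) ∈ eigenvalueLevels h₂ n := by
  have hpos : 0 < 1 - t * δ := by linarith
  obtain ⟨W, hnW, hW⟩ := hr₁.exists_subspace_of_mem_eigenvalueLevels hn₁ htn
  refine eigenvalueLevels_antitone h₂ hnW
    (hr₂.mem_eigenvalueLevels_of_subspace (div_nonneg ht hpos.le) W fun F hF => ?_)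
  -- In `‖F‖² ≤ t (‖S₂ F‖² + δ ‖F‖²)` the term `t δ ‖F‖²` is absorbed on the left.
  rw [div_mul_eq_mul_div, le_div_iff₀ hpos]
  nlinarith [hW F hF, mul_le_mul_of_nonneg_left (hδ F) ht]

/-- If `x δ < 1`, clearing the denominator gives `y - x ≤ x y δ`; if `x δ ≥ 1`, already `y ≤ x y δ`.
Then `x y ≤ y²`. -/
lemma sub_le_of_div_le {x y δ : ℝ} (hx : 0 ≤ x) (hxy : x ≤ y) (hδ : 0 ≤ δ)
    (H : x * δ < 1 → y ≤ x / (1 - x * δ)) : y - x ≤ y ^ 2 * δ := by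
  have hxyy : x * y ≤ y ^ 2 := by nlinarith
  have h0 := mul_le_mul_of_nonneg_right hxyy hδ
  rcases lt_or_ge (x * δ) 1 with h1 | h1
  · have h2 := (le_div_iff₀ (sub_pos.2 h1)).1 (H h1)
    nlinarith
  · nlinarith [mul_le_mul_of_nonneg_left h1 (hx.trans hxy)]

end Comparison

end SpectralStability

end

/-! ### The stability estimate for the eigenvalues -/

theorem mainTheorem3 (h₁ h₂ : ℂ → ℝ)
    (hq₁ : SpectralStability.IsQuasiconformalWeight h₁)
    (hq₂ : SpectralStability.IsQuasiconformalWeight h₂)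
    (hr₁ : SpectralStability.IsRegularWeight h₁)
    (hr₂ : SpectralStability.IsRegularWeight h₂)
    (s : ℝ≥0∞) (hs : 1 < s)
    (hd : SpectralStability.weightDist s h₁ h₂ < ⊤) :
    SpectralStability.poincareSobolevConst₂ (SpectralStability.sobolevExponent s) h₁ h₂ < ⊤ ∧
    ∀ n : ℕ, 1 ≤ n →
      IsLeast (SpectralStability.eigenvalueLevels h₁ n)
        (SpectralStability.neumannEigenvalue h₁ n) ∧
      IsLeast (SpectralStability.eigenvalueLevels h₂ n)
        (SpectralStability.neumannEigenvalue h₂ n) ∧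
      |SpectralStability.neumannEigenvalue h₁ n - SpectralStability.neumannEigenvalue h₂ n| ≤
        SpectralStability.eigenvalueConst h₁ h₂ n *
          (SpectralStability.poincareSobolevConst₂
            (SpectralStability.sobolevExponent s) h₁ h₂).toReal ^ 2 *
          (SpectralStability.weightDist s h₁ h₂).toReal := by
  have hlt₁ := hr₁.poincareSobolevConst_lt_top SpectralStability.two_le_sobolevExponent
    (SpectralStability.sobolevExponent_ne_top hs)
  have hlt₂ := hr₂.poincareSobolevConst_lt_top SpectralStability.two_le_sobolevExponent
    (SpectralStability.sobolevExponent_ne_top hs)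
  have hB : SpectralStability.poincareSobolevConst₂ (SpectralStability.sobolevExponent s) h₁ h₂
      < ⊤ := max_lt hlt₁ hlt₂
  have hn₁ := hq₁.weightMeasure_ne_zero
  have hn₂ := hq₂.weightMeasure_ne_zero
  refine ⟨hB, fun n hn => ?_⟩
  have hx := hr₁.isLeast_neumannEigenvalue hn₁ hn (hr₁.eigenvalueLevels_nonempty hn₁ n)
  have hy := hr₂.isLeast_neumannEigenvalue hn₂ hn (hr₂.eigenvalueLevels_nonempty hn₂ n)
  refine ⟨hx, hy, ?_⟩
  have hx0 := hr₁.nonneg_of_mem_eigenvalueLevels hn₁ hn hx.1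
  have hy0 := hr₂.nonneg_of_mem_eigenvalueLevels hn₂ hn hy.1
  set δ := (SpectralStability.poincareSobolevConst₂
    (SpectralStability.sobolevExponent s) h₁ h₂).toReal ^ 2 *
      (SpectralStability.weightDist s h₁ h₂).toReal
  have hδ : 0 ≤ δ := by positivity
  have hδ₁ : (SpectralStability.poincareSobolevConst (SpectralStability.sobolevExponent s) h₁).toReal
      ^ 2 * (SpectralStability.weightDist s h₁ h₂).toReal ≤ δ := by
    refine mul_le_mul_of_nonneg_right (pow_le_pow_left₀ ENNReal.toReal_nonneg ?_ 2)
      ENNReal.toReal_nonneg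
    exact ENNReal.toReal_mono hB.ne (le_max_left _ _)
  have hδ₂ : (SpectralStability.poincareSobolevConst (SpectralStability.sobolevExponent s) h₂).toReal
      ^ 2 * (SpectralStability.weightDist s h₁ h₂).toReal ≤ δ := by
    refine mul_le_mul_of_nonneg_right (pow_le_pow_left₀ ENNReal.toReal_nonneg ?_ 2)
      ENNReal.toReal_nonneg
    exact ENNReal.toReal_mono hB.ne (le_max_right _ _)
  have h₂₁ : ∀ F, ‖hr₂.primitive F‖ ^ 2 ≤ ‖hr₁.primitive F‖ ^ 2 + δ * ‖F‖ ^ 2 := fun F =>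
    (SpectralStability.norm_sq_primitive_le hr₁ hr₂ hs hd F).trans (by gcongr)
  have h₁₂ : ∀ F, ‖hr₁.primitive F‖ ^ 2 ≤ ‖hr₂.primitive F‖ ^ 2 + δ * ‖F‖ ^ 2 := fun F => by
    have hF := SpectralStability.norm_sq_primitive_le hr₂ hr₁ hs
      (SpectralStability.weightDist_comm s h₁ h₂ ▸ hd) F
    rw [SpectralStability.weightDist_comm s h₂ h₁] at hF
    exact hF.trans (by gcongr)
  rw [mul_assoc, SpectralStability.eigenvalueConst]
  -- The smaller eigenvalue is transported to the other weight, and the square of the larger one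
  -- results; hence the maximum in the constant.
  rcases le_total (SpectralStability.neumannEigenvalue h₁ n)
    (SpectralStability.neumannEigenvalue h₂ n) with hxy | hxy
  · rw [abs_sub_comm, abs_of_nonneg (sub_nonneg.2 hxy)]
    refine (SpectralStability.sub_le_of_div_le hx0 hxy hδ fun h1 => hy.2
      (SpectralStability.div_mem_eigenvalueLevels hr₁ hr₂ hn₁ h₁₂ hx0 h1 hx.1)).trans ?_
    exact mul_le_mul_of_nonneg_right (le_max_right _ _) hδ
  · rw [abs_of_nonneg (sub_nonneg.2 hxy)]
    refine (SpectralStability.sub_le_of_div_le hy0 hxy hδ fun h1 => hx.2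
      (SpectralStability.div_mem_eigenvalueLevels hr₂ hr₁ hn₂ h₂₁ hy0 h1 hy.1)).trans ?_
    exact mul_le_mul_of_nonneg_right (le_max_left _ _) hδ
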